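/- **Setting.** Let $M$ be a smooth 4-manifold with boundary, $g_{\alpha\beta}$ a smooth metric on $M$ of signature $(-,+,+,+)$ and $\Omega\colon M\to\mathbb{R}$ smooth, with $\Omega>0$ on the interior $\hat M$ of $M$ and $\mathscr{J}:=\partial M=\{\Omega=0\}$. The physical metric $\hat g=\Omega^{-2}g$ on $\hat M$ satisfies $\hat R_{\alpha\beta}-\frac12\hat R\,\hat g_{\alpha\beta}+\Lambda\hat g_{\alpha\beta}=\kappa\hat T_{\alpha\beta}$ with $\Lambda,\kappa>0$, where the components of $\hat T_{\alpha\beta}$ in charts of $M$ are $O(\Omega)$ at the points of $\mathscr{J}$. Let $\nabla$ and $C_{\alpha\beta\gamma}{}^{\delta}$ be the Levi-Civita connection and the Weyl tensor of $g$, with $(\nabla_\alpha\nabla_\beta-\nabla_\beta\nabla_\alpha)v_\gamma=R_{\alpha\beta\gamma}{}^\mu v_\mu$, and let ${}^*$ be the Hodge dual on the first pair of indices. Put $N_\alpha=\nabla_\alpha\Omega$, $N=\sqrt{-N_\alpha N^\alpha}$ and $n_\alpha=N^{-1}N_\alpha$ where $N_\alpha$ is timelike, let $d_{\alpha\beta\gamma}{}^\delta=\Omega^{-1}C_{\alpha\beta\gamma}{}^\delta$,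 extended by continuity to $\mathscr{J}$, and define $$\mathcal{D}_{\alpha\beta\gamma\delta}=d_{\alpha\mu\gamma}{}^{\nu}d_{\delta\nu\beta}{}^{\mu}+{}^*d_{\alpha\mu\gamma}{}^{\nu}\,{}^*d_{\delta\nu\beta}{}^{\mu},\qquad \mathcal{P}^\alpha=-n^\mu n^\nu n^\rho\mathcal{D}^\alpha{}_{\mu\nu\rho},\qquad p^\alpha=-N^\mu N^\nu N^\rho\mathcal{D}^\alpha{}_{\mu\nu\rho}.$$ **Statement.** On $\mathscr{J}$ one has $N_\alpha N^\alpha=-\Lambda/3$. The tensor $d_{\alpha\beta\gamma}{}^\delta$ is well defined and continuously differentiable on all of $M$, with $\Omega\, d_{\alpha\beta\gamma}{}^\delta=C_{\alpha\beta\gamma}{}^\delta$, and $\mathcal{P}^\alpha$ and $p^\alpha$ are continuously differentiable at $\mathscr{J}$. Moreover: 1. Let $M$ be time-oriented and let $\mathscr{J}^{+}$ (resp. $\mathscr{J}^-$) be the set of points of $\mathscr{J}$ at which $N^\alpha$ is future-pointing (resp. past-pointing). Then $\mathscr{J}=\mathscr{J}^+\cup\mathscr{J}^-$, and on some open neighbourhood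 of $\mathscr{J}^+$ the vector $N^\alpha$ is timelike and future-pointing and $\mathcal{P}^\alpha$ is causal and future-pointing (possibly zero). The same holds for $\mathscr{J}^-$ with 'past' in place of 'future'. 2. Under a gauge transformation $(g,\Omega)\mapsto(\omega^2 g,\omega\Omega)$ with smooth $\omega>0$ on $M$, $\mathcal{P}^\alpha$ changes into $\omega^{-7}\mathcal{P}^\alpha$ at every point of $\mathscr{J}$. Consequently the no-radiation criterion is gauge invariant: for every $\Delta\subset\mathscr{J}$, the asymptotic super-Poynting vector $(\delta^\alpha_\mu+n^\alpha n_\mu)\mathcal{P}^\mu$ vanishes on $\Delta$ for $(g,\Omega)$ if and only if it does for $(\omega^2g,\omega\Omega)$. 3. If the gauge is divergence-free, i.e. $\nabla_\alpha N_\beta=0$ on $\mathscr{J}$, and the components of $\hat T_{\alpha\beta}$ in charts of $M$ are $O(\Omega^3)$ at the points of $\mathscr{J}$ (for instance $\hat T_{\alpha\beta}=0$), then $\nabla_\mu\mathcal{P}^\mu=0$ on $\mathscr{J}$. Properties 1, 2 ($p^\alpha\mapsto\omega^{-7}p^\alpha$) and 3 hold for $p^\alpha$ as well. -/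

import Mathlib

open Set Filter Topology Asymptotics
open scoped Manifold ContDiff BigOperators

noncomputable section

namespace Scri

/-! ### Tensor calculus in a coordinate patch

All tensor fields are written through their components with respect to a chart of a
four-dimensional manifold with boundary, that is, as functions on (a relatively open part of) the
closed half-space of `ℝ⁴`. Signature `(-,+,+,+)`. -/

/-- Coordinate space `ℝ⁴`. -/
abbrev Coord : Type := EuclideanSpace ℝ (Fin 4)

/-- The closed half-space in which charts take their values. -/
abbrev HS : Set Coord := Set.range (𝓡∂ 4)

/-- Partial derivative `∂_i f` (one-sided at boundary points). -/
def pd (i : Fin 4) (f : Coord → ℝ) (x : Coord) : ℝ :=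
  fderivWithin ℝ f HS x (EuclideanSpace.single i 1)

/-- Components `g_{ab}` of a metric. -/
abbrev MetricComp : Type := Coord → Matrix (Fin 4) (Fin 4) ℝ

/-- Inverse metric `g^{ab}`. -/
def ginv (G : MetricComp) (x : Coord) (a b : Fin 4) : ℝ := (G x)⁻¹ a b

/-- Christoffel symbols `Γ^c_{ab}`. -/
def christoffel (G : MetricComp) (c a b : Fin 4) (x : Coord) : ℝ :=
  (1 / 2) * ∑ l, ginv G x c l *
    (pd a (fun y => G y l b) x + pd b (fun y => G y l a) x - pd l (fun y => G y a b) x)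

/-- Curvature `R_{abc}{}^d`, with `(∇_a ∇_b - ∇_b ∇_a) v_c = R_{abc}{}^d v_d`. -/
def riemann (G : MetricComp) (a b c d : Fin 4) (x : Coord) : ℝ :=
  pd b (christoffel G d a c) x - pd a (christoffel G d b c) x
    + ∑ e, (christoffel G e a c x * christoffel G d b e x
      - christoffel G e b c x * christoffel G d a e x)

/-- Ricci tensor `R_{ac} = R_{abc}{}^b`. -/
def ricci (G : MetricComp) (a c : Fin 4) (x : Coord) : ℝ := ∑ b, riemann G a b c b x

/-- Scalar curvature `R = g^{ac} R_{ac}`. -/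
def scalarCurv (G : MetricComp) (x : Coord) : ℝ := ∑ a, ∑ c, ginv G x a c * ricci G a c x

/-- Fully covariant curvature `R_{abcd} = R_{abc}{}^e g_{ed}`. -/
def riemannLow (G : MetricComp) (a b c d : Fin 4) (x : Coord) : ℝ :=
  ∑ e, riemann G a b c e x * G x e d

/-- Fully covariant Weyl tensor `C_{abcd}` in dimension four. -/
def weylLow (G : MetricComp) (a b c d : Fin 4) (x : Coord) : ℝ :=
  riemannLow G a b c d x
    - (1 / 2) * (G x a c * ricci G b d x - G x a d * ricci G b c x
        - G x b c * ricci G a d x + G x b d * ricci G a c x)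
    + (scalarCurv G x / 6) * (G x a c * G x b d - G x a d * G x b c)

/-- Weyl tensor `C_{abc}{}^d`. -/
def weyl (G : MetricComp) (a b c d : Fin 4) (x : Coord) : ℝ :=
  ∑ e, weylLow G a b c e x * ginv G x e d

/-- The alternating symbol `ε_{abcd}` with `ε_{0123} = 1`. -/
def altSymbol (a b c d : Fin 4) : ℝ :=
  Matrix.det (Matrix.of fun i j : Fin 4 => if ![a, b, c, d] i = j then (1 : ℝ) else 0)

/-- The volume form `η_{abcd}` of the coordinate orientation. (Reversing the orientation changes its
sign, which leaves everything below unchanged: the dual enters quadratically.) -/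
def volForm (G : MetricComp) (a b c d : Fin 4) (x : Coord) : ℝ :=
  Real.sqrt |(G x).det| * altSymbol a b c d

/-- Hodge dual `*w_{abc}{}^d = (1/2) η_{abef} g^{ep} g^{fq} w_{pqc}{}^d` on the first index pair. -/
def hodge (G : MetricComp) (w : Fin 4 → Fin 4 → Fin 4 → Fin 4 → Coord → ℝ)
    (a b c d : Fin 4) (x : Coord) : ℝ :=
  (1 / 2) * ∑ e, ∑ f, ∑ p, ∑ q,
    volForm G a b e f x * ginv G x e p * ginv G x f q * w p q c d x

/-- The Bel-Robinson expression
`w_{amc}{}^n w_{dnb}{}^m + *w_{amc}{}^n *w_{dnb}{}^m` with free indices `a b c d`. -/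
def belRobinson (G : MetricComp) (w : Fin 4 → Fin 4 → Fin 4 → Fin 4 → Coord → ℝ)
    (a b c d : Fin 4) (x : Coord) : ℝ :=
  ∑ m, ∑ n, (w a m c n x * w d n b m x + hodge G w a m c n x * hodge G w d n b m x)

/-- Rescaled Weyl tensor `d_{abc}{}^d = Ω⁻¹ C_{abc}{}^d`, extended by continuity from the
physical region `{Ω > 0}` to the points where `Ω = 0`. -/
def rescaledWeyl (G : MetricComp) (Ω : Coord → ℝ) (a b c d : Fin 4) : Coord → ℝ :=
  extendFrom {y | y ∈ HS ∧ 0 < Ω y} (fun y => (Ω y)⁻¹ * weyl G a b c d y)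

/-- Rescaled Bel-Robinson tensor `𝒟_{abcd}`. -/
def rescaledBR (G : MetricComp) (Ω : Coord → ℝ) (a b c d : Fin 4) (x : Coord) : ℝ :=
  belRobinson G (rescaledWeyl G Ω) a b c d x

/-- `N_a = ∇_a Ω`. -/
def normalLow (Ω : Coord → ℝ) (x : Coord) (a : Fin 4) : ℝ := pd a Ω x

/-- `N^a = g^{ab} N_b`. -/
def normal (G : MetricComp) (Ω : Coord → ℝ) (x : Coord) (a : Fin 4) : ℝ :=
  ∑ b, ginv G x a b * normalLow Ω x b

/-- `N_a N^a`. -/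
def normalSq (G : MetricComp) (Ω : Coord → ℝ) (x : Coord) : ℝ :=
  ∑ a, normalLow Ω x a * normal G Ω x a

/-- `N`, the positive root of `N² = -N_a N^a` (where `N_a` is timelike). -/
def lapse (G : MetricComp) (Ω : Coord → ℝ) (x : Coord) : ℝ := Real.sqrt (-normalSq G Ω x)

/-- `n_a = N⁻¹ N_a`. -/
def unitNormalLow (G : MetricComp) (Ω : Coord → ℝ) (x : Coord) (a : Fin 4) : ℝ :=
  (lapse G Ω x)⁻¹ * normalLow Ω x a

/-- `n^a = N⁻¹ N^a`. -/
def unitNormal (G : MetricComp) (Ω : Coord → ℝ) (x : Coord) (a : Fin 4) : ℝ :=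
  (lapse G Ω x)⁻¹ * normal G Ω x a

/-- Supermomentum relative to `v`: the vector `-v^m v^n v^r 𝒟^a{}_{mnr}`. -/
def supermomentum (G : MetricComp) (Ω : Coord → ℝ) (v : Coord → Fin 4 → ℝ)
    (x : Coord) (a : Fin 4) : ℝ :=
  -∑ e, ∑ m, ∑ n, ∑ r, v x m * v x n * v x r * (ginv G x a e * rescaledBR G Ω e m n r x)

/-- Asymptotic supermomentum `p^a = -N^m N^n N^r 𝒟^a{}_{mnr}`. -/
def asymptoticSupermomentum (G : MetricComp) (Ω : Coord → ℝ) : Coord → Fin 4 → ℝ :=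
  supermomentum G Ω (normal G Ω)

/-- Canonical asymptotic supermomentum `𝒫^a = -n^m n^n n^r 𝒟^a{}_{mnr}`. -/
def canonicalSupermomentum (G : MetricComp) (Ω : Coord → ℝ) : Coord → Fin 4 → ℝ :=
  supermomentum G Ω (unitNormal G Ω)

/-- Asymptotic super-Poynting vector: the part `(δ^a_m + n^a n_m) 𝒫^m` of `𝒫^a` orthogonal
to `n^a`. -/
def superPoynting (G : MetricComp) (Ω : Coord → ℝ) (x : Coord) (a : Fin 4) : ℝ :=
  canonicalSupermomentum G Ω x a
    + unitNormal G Ω x a * ∑ m, unitNormalLow G Ω x m * canonicalSupermomentum G Ω x m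

/-- Covariant divergence `∇_m V^m`. -/
def divergence (G : MetricComp) (V : Coord → Fin 4 → ℝ) (x : Coord) : ℝ :=
  ∑ m, (pd m (fun y => V y m) x + ∑ l, christoffel G m m l x * V x l)

/-- `∇_a N_b = ∇_a ∇_b Ω`. -/
def hessian (G : MetricComp) (Ω : Coord → ℝ) (a b : Fin 4) (x : Coord) : ℝ :=
  pd a (fun y => pd b Ω y) x - ∑ c, christoffel G c a b x * pd c Ω x

/-- The physical metric `Ω⁻² g_{ab}`. -/
def physicalMetric (G : MetricComp) (Ω : Coord → ℝ) : MetricComp :=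
  fun x => (Ω x ^ 2)⁻¹ • G x

/-- The energy-momentum tensor that the Einstein equations
`R_{ab} - (1/2) R g_{ab} + Λ g_{ab} = κ T_{ab}` assign to a metric. -/
def energyMomentum (κ Λ : ℝ) (G : MetricComp) (a b : Fin 4) (x : Coord) : ℝ :=
  κ⁻¹ * (ricci G a b x - (1 / 2) * scalarCurv G x * G x a b + Λ * G x a b)

/-! ### Conformal completions -/

/-- Field of bilinear forms on the tangent spaces of `M`. -/
abbrev BilinField (M : Type*) [TopologicalSpace M] [ChartedSpace (EuclideanHalfSpace 4) M] :=
  (p : M) → LinearMap.BilinForm ℝ (TangentSpace (𝓡∂ 4) p)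

section Manifold

variable {M : Type*} [TopologicalSpace M] [ChartedSpace (EuclideanHalfSpace 4) M]

/-- A chart of the smooth structure of `M`. -/
def IsChart (e : OpenPartialHomeomorph M (EuclideanHalfSpace 4)) : Prop :=
  e ∈ IsManifold.maximalAtlas (𝓡∂ 4) ∞ M

/-- The set of coordinate values of a chart, relatively open in the half-space. -/
abbrev dom (e : OpenPartialHomeomorph M (EuclideanHalfSpace 4)) : Set Coord :=
  (e.extend (𝓡∂ 4)).target

/-- The point with coordinates `x`. -/
abbrev pt (e : OpenPartialHomeomorph M (EuclideanHalfSpace 4)) (x : Coord) : M :=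
  (e.extend (𝓡∂ 4)).symm x

/-- Coordinate vector `∂_i` at the point with coordinates `x`. -/
def coordVec (e : OpenPartialHomeomorph M (EuclideanHalfSpace 4)) (x : Coord) (i : Fin 4) :
    TangentSpace (𝓡∂ 4) (pt e x) :=
  mfderivWithin 𝓘(ℝ, Coord) (𝓡∂ 4) (pt e) HS x (EuclideanSpace.single i (1 : ℝ))

/-- The tangent vector `V^i ∂_i`. -/
def toTangent (e : OpenPartialHomeomorph M (EuclideanHalfSpace 4)) (x : Coord) (V : Fin 4 → ℝ) :
    TangentSpace (𝓡∂ 4) (pt e x) :=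
  ∑ i, V i • coordVec e x i

/-- Components `g(∂_i, ∂_j)` in a chart. -/
def comps (g : BilinField M) (e : OpenPartialHomeomorph M (EuclideanHalfSpace 4)) : MetricComp :=
  fun x => Matrix.of fun i j => g (pt e x) (coordVec e x i) (coordVec e x j)

/-- A function in a chart. -/
def inChart (f : M → ℝ) (e : OpenPartialHomeomorph M (EuclideanHalfSpace 4)) : Coord → ℝ :=
  fun x => f (pt e x)

/-- Smooth metric of signature `(-,+,+,+)`. -/
structure IsLorentzMetric (g : BilinField M) : Prop where
  symm : ∀ p u v, g p u v = g p v u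
  signature : ∀ p, ∃ b : Module.Basis (Fin 4) ℝ (TangentSpace (𝓡∂ 4) p),
    ∀ i j, g p (b i) (b j) = if i = j then (if i = 0 then -1 else 1) else 0
  smooth : ∀ e, IsChart e → ∀ i j, ContDiffOn ℝ ∞ (fun x => comps g e x i j) (dom e)

/-- The physical energy-momentum tensor, computed from `Ω⁻² g` on `{Ω > 0}`, is `O(Ω^k)` near
`{Ω = 0}`: so are its components in every chart of `M`, at each point of `{Ω = 0}`. -/
def EnergyMomentumDecay (κ Λ : ℝ) (g : BilinField M) (Ω : M → ℝ) (k : ℕ) : Prop :=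
  ∀ e, IsChart e → ∀ x ∈ dom e, inChart Ω e x = 0 → ∀ a b,
    energyMomentum κ Λ (physicalMetric (comps g e) (inChart Ω e)) a b
      =O[𝓝[{y | y ∈ HS ∧ 0 < inChart Ω e y}] x] fun y => inChart Ω e y ^ k

/-- `(M, g, Ω)` is a smooth conformal completion, with boundary `𝒥 = ∂M = {Ω = 0}`, of the physical
space-time `(interior of M, Ω⁻² g)`, which satisfies the Einstein equations with cosmological
constant `Λ`, gravitational constant `κ` and energy-momentum tensor `O(Ω)` near `𝒥`. -/
structure IsConformalCompletion (κ Λ : ℝ) (g : BilinField M) (Ω : M → ℝ) : Prop where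
  metric : IsLorentzMetric g
  smooth : ContMDiff (𝓡∂ 4) 𝓘(ℝ, ℝ) ∞ Ω
  pos : ∀ p ∈ (𝓡∂ 4).interior M, 0 < Ω p
  zero : ∀ p ∈ (𝓡∂ 4).boundary M, Ω p = 0
  decay : EnergyMomentumDecay κ Λ g Ω 1

/-- `𝒥 = {Ω = 0}`. -/
def scri (Ω : M → ℝ) : Set M := {p | Ω p = 0}

/-- A time orientation: a continuous timelike vector field, declared to be future-pointing. -/
structure IsTimeOrientation [IsManifold (𝓡∂ 4) ∞ M] (g : BilinField M) (T : (p : M) → TangentSpace (𝓡∂ 4) p) : Prop where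
  continuous : Continuous fun p => (⟨p, T p⟩ : TangentBundle (𝓡∂ 4) M)
  timelike : ∀ p, g p (T p) (T p) < 0

/-- With respect to a form `B` of signature `(-,+,+,+)` and a future-pointing timelike `t`, the
vector `v` is future-pointing timelike. -/
def FutureTimelike {V : Type*} [AddCommGroup V] [Module ℝ V] (B : LinearMap.BilinForm ℝ V)
    (t v : V) : Prop := B v v < 0 ∧ B t v < 0

/-- `v` is causal and future-pointing, the zero vector being allowed. -/
def FutureCausal {V : Type*} [AddCommGroup V] [Module ℝ V] (B : LinearMap.BilinForm ℝ V)
    (t v : V) : Prop := B v v ≤ 0 ∧ (v = 0 ∨ B t v < 0)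

/-- `N_a T^a = dΩ(T)`. -/
def normalPairing (Ω : M → ℝ) (T : (p : M) → TangentSpace (𝓡∂ 4) p) (p : M) : ℝ :=
  mfderiv (𝓡∂ 4) 𝓘(ℝ, ℝ) Ω p (T p)

/-- `𝒥⁺`: the points of `𝒥` at which `N^a` is future-pointing. -/
def futureScri (Ω : M → ℝ) (T : (p : M) → TangentSpace (𝓡∂ 4) p) : Set M :=
  {p | p ∈ scri Ω ∧ normalPairing Ω T p < 0}

/-- `𝒥⁻`: the points of `𝒥` at which `N^a` is past-pointing. -/
def pastScri (Ω : M → ℝ) (T : (p : M) → TangentSpace (𝓡∂ 4) p) : Set M :=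
  {p | p ∈ scri Ω ∧ 0 < normalPairing Ω T p}

/-- Divergence-free gauge: `∇_a N_b = 0` at `𝒥`. -/
def DivergenceFreeGauge (g : BilinField M) (Ω : M → ℝ) : Prop :=
  ∀ e, IsChart e → ∀ x ∈ dom e, pt e x ∈ scri Ω →
    ∀ a b, hessian (comps g e) (inChart Ω e) a b x = 0

/-- The metric `φ² g` of the gauge-transformed completion `(φ² g, φ Ω)`. -/
def gaugeMetric (φ : M → ℝ) (g : BilinField M) : BilinField M := fun p => (φ p ^ 2) • g p

/-- The radiation criterion: the asymptotic super-Poynting vector vanishes on `Δ`. -/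
def NoRadiationOn (g : BilinField M) (Ω : M → ℝ) (Δ : Set M) : Prop :=
  ∀ e, IsChart e → ∀ x ∈ dom e, pt e x ∈ Δ →
    ∀ a, superPoynting (comps g e) (inChart Ω e) x a = 0

end Manifold

end Scri

end

open Scri

namespace Scri

/-! ### Calculus on the half-space -/

/-! Everything is local, so the geometry is done in charts, with one-sided derivatives on the
half-space, and carried over to the manifold at the end.

The basic mechanism is that equations on the physical region are multiplied by powers of Ω until
both sides are smooth up to the boundary, and are then evaluated there by continuity. For the
conformal factor Ω⁻¹ the Ricci tensor has only a pole of order two, so Ω² times the physical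
energy-momentum tensor is the smooth field `emNum` (`energyMomentum_physical`). Under decay of order
k it is O(Ω^(k+2)). Already for k = 1 its trace at the boundary reads 12 N_a N^a + 4Λ = 0, which is
`normalSq_eq`. Hence dΩ ≠ 0 there, Ω is a boundary defining function, and Hadamard's lemma
(`exists_eq_coord_mul`, `exists_eq_pow_mul`) turns estimates O(Ω^m) of smooth functions into smooth
factors Ω^m.

The contracted Bianchi identity of the physical metric, rewritten through conformal invariance of
the Weyl tensor, takes the form Ω ∇_d C_{abc}^d - N_d C_{abc}^d = Ω^k Z with Z smooth up to the
boundary (`exists_weyl_divergence`). With k = 1 it gives N_d C_{abc}^d = 0 at the boundary. A Weyl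
tensor annihilated by a timelike vector vanishes, so C = 0 there (`weyl_eq_zero`), and dividing by Ω
gives a smooth d (`smAt_rescaledWeyl_and_eq`). With k = 3 and C = Ω d it becomes ∇_d d_{abc}^d = Ω
Z, which vanishes at the boundary.

Causality is pointwise algebra. In an orthonormal frame whose first leg is along N, a Weyl candidate
is a pair (E, H) of symmetric trace-free 3×3 matrices. The Bel-Robinson covector then has energy
|E|² + |H|² and momentum the sum of the cross products 2 E_n × H_n of rows, which is dominated by
the energy (`brCovector_mink_dominant`, `brCovector_causal`). This applies wherever N is timelike,
an open condition holding on 𝒥, and so gives a whole neighbourhood.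

For the divergence, a frame is chosen that is orthonormal at the point and parallel to first order.
In a divergence-free gauge N and n are parallel at the boundary, so only d gets differentiated, and
the result is a combination of the equations ∇_d d_{abc}^d = 0 with coefficients E and H, as in
Poynting's theorem (`sum_brForm_mink_eq_zero`, `divergence_supermomentum`).

The gauge weight is a count: d_{abc}^d has weight -1 and enters twice, each of the three vectors has
weight -1, and the inverse metric has weight -2. Derivatives of the gauge factor do not enter,
because Ω = 0 on 𝒥. -/

lemma uniqueDiffOn_HS : UniqueDiffOn ℝ HS := (𝓡∂ 4).uniqueDiffOn

lemma mem_HS {x : Coord} : x ∈ HS ↔ 0 ≤ x 0 := by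
  rw [HS, range_modelWithCornersEuclideanHalfSpace]; rfl

lemma interior_HS : interior HS = {x : Coord | 0 < x 0} :=
  interior_range_modelWithCornersEuclideanHalfSpace 4

lemma convex_HS : Convex ℝ HS := (𝓡∂ 4).convex_range

lemma mem_closure_interior_HS {x : Coord} (hx : x ∈ HS) : x ∈ closure (interior HS) := by
  rw [convex_HS.closure_interior_eq_closure_of_nonempty_interior (𝓡∂ 4).nonempty_interior]
  exact subset_closure hx

/-- Differentiability within the half-space. -/
abbrev DAt (f : Coord → ℝ) (x : Coord) : Prop := DifferentiableWithinAt ℝ f HS x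

/-- Smoothness within the half-space. -/
def SmAt (f : Coord → ℝ) (x : Coord) : Prop := ContDiffWithinAt ℝ ∞ f HS x

variable {f g : Coord → ℝ} {x : Coord} {ι : Type*}

lemma SmAt.dAt (hf : SmAt f x) : DAt f x := hf.differentiableWithinAt (by simp)

lemma SmAt.continuousWithinAt (hf : SmAt f x) : ContinuousWithinAt f HS x :=
  ContDiffWithinAt.continuousWithinAt hf

lemma SmAt.add (hf : SmAt f x) (hg : SmAt g x) : SmAt (fun y => f y + g y) x :=
  ContDiffWithinAt.add hf hg

lemma SmAt.sub (hf : SmAt f x) (hg : SmAt g x) : SmAt (fun y => f y - g y) x :=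
  ContDiffWithinAt.sub hf hg

lemma SmAt.mul (hf : SmAt f x) (hg : SmAt g x) : SmAt (fun y => f y * g y) x :=
  ContDiffWithinAt.mul hf hg

lemma SmAt.neg (hf : SmAt f x) : SmAt (fun y => -f y) x := ContDiffWithinAt.neg hf

lemma SmAt.pow (hf : SmAt f x) (n : ℕ) : SmAt (fun y => f y ^ n) x := ContDiffWithinAt.pow hf n

lemma SmAt.inv (hf : SmAt f x) (h : f x ≠ 0) : SmAt (fun y => (f y)⁻¹) x :=
  ContDiffWithinAt.inv hf h

lemma SmAt.const (c : ℝ) : SmAt (fun _ => c) x := contDiffWithinAt_const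

lemma SmAt.sum {s : Finset ι} {F : ι → Coord → ℝ} (h : ∀ i ∈ s, SmAt (F i) x) :
    SmAt (fun y => ∑ i ∈ s, F i y) x := ContDiffWithinAt.sum h

lemma SmAt.prod {s : Finset ι} {F : ι → Coord → ℝ} (h : ∀ i ∈ s, SmAt (F i) x) :
    SmAt (fun y => ∏ i ∈ s, F i y) x := contDiffWithinAt_prod h

lemma SmAt.pd (hf : SmAt f x) (hx : x ∈ HS) (i : Fin 4) : SmAt (pd i f) x :=
  (ContDiffWithinAt.fderivWithin_right (m := ∞) hf uniqueDiffOn_HS (by simp) hx).clm_apply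
    contDiffWithinAt_const

lemma SmAt.congr (hf : SmAt f x) (hx : x ∈ HS) (h : g =ᶠ[𝓝[HS] x] f) : SmAt g x :=
  ContDiffWithinAt.congr_of_eventuallyEq hf h (h.self_of_nhdsWithin hx)

lemma pd_congr (hx : x ∈ HS) (h : f =ᶠ[𝓝[HS] x] g) (i : Fin 4) : pd i f x = pd i g x := by
  rw [pd, pd, h.fderivWithin_eq (h.self_of_nhdsWithin hx)]

lemma pd_const (_hx : x ∈ HS) (i : Fin 4) (c : ℝ) : pd i (fun _ => c) x = 0 := by
  simp [pd]

lemma pd_add (hx : x ∈ HS) (i : Fin 4) (hf : DAt f x) (hg : DAt g x) :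
    pd i (fun y => f y + g y) x = pd i f x + pd i g x := by
  simp only [pd]; rw [fderivWithin_fun_add (uniqueDiffOn_HS x hx) hf hg]; rfl

lemma pd_sub (hx : x ∈ HS) (i : Fin 4) (hf : DAt f x) (hg : DAt g x) :
    pd i (fun y => f y - g y) x = pd i f x - pd i g x := by
  simp only [pd]; rw [fderivWithin_fun_sub (uniqueDiffOn_HS x hx) hf hg]; rfl

lemma pd_neg (hx : x ∈ HS) (i : Fin 4) :
    pd i (fun y => -f y) x = -pd i f x := by
  simp only [pd]; rw [fderivWithin_fun_neg (uniqueDiffOn_HS x hx)]; rfl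

lemma pd_mul (hx : x ∈ HS) (i : Fin 4) (hf : DAt f x) (hg : DAt g x) :
    pd i (fun y => f y * g y) x = pd i f x * g x + f x * pd i g x := by
  simp only [pd]; rw [fderivWithin_fun_mul (uniqueDiffOn_HS x hx) hf hg]; simp; ring

lemma pd_const_mul (hx : x ∈ HS) (i : Fin 4) (c : ℝ) (hf : DAt f x) :
    pd i (fun y => c * f y) x = c * pd i f x := by
  rw [pd_mul hx i (differentiableWithinAt_const c) hf, pd_const hx]; ring

lemma pd_sum (hx : x ∈ HS) (i : Fin 4) {s : Finset ι} {F : ι → Coord → ℝ}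
    (h : ∀ j ∈ s, DAt (F j) x) :
    pd i (fun y => ∑ j ∈ s, F j y) x = ∑ j ∈ s, pd i (F j) x := by
  simp only [pd]; rw [fderivWithin_fun_sum (uniqueDiffOn_HS x hx) h]; simp

lemma pd_pow (hx : x ∈ HS) (i : Fin 4) (n : ℕ) (hf : DAt f x) :
    pd i (fun y => f y ^ n) x = n * f x ^ (n - 1) * pd i f x := by
  simp only [pd]; rw [fderivWithin_fun_pow (uniqueDiffOn_HS x hx) n hf]; simp

lemma pd_inv (hx : x ∈ HS) (i : Fin 4) (hf : DAt f x) (h : f x ≠ 0) :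
    pd i (fun y => (f y)⁻¹) x = -pd i f x * ((f x)⁻¹) ^ 2 := by
  have hd : DAt (fun y => (f y)⁻¹) x := hf.fun_inv h
  have h1 : pd i (fun y => f y * (f y)⁻¹) x = 0 := by
    rw [← pd_const hx i 1]
    refine pd_congr hx ?_ i
    filter_upwards [hf.continuousWithinAt.eventually_ne h] with y hy
    exact mul_inv_cancel₀ hy
  rw [pd_mul hx i hf hd] at h1
  field_simp at h1 ⊢
  linarith

/-- Boundary points lie in the closure of the interior of the half-space, so the symmetry of the
second derivative extends to them by continuity. -/
lemma pd_comm (hx : x ∈ HS) (hf : SmAt f x) (i j : Fin 4) :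
    pd i (pd j f) x = pd j (pd i f) x := by
  have h2 : DifferentiableWithinAt ℝ (fderivWithin ℝ f HS) HS x :=
    (ContDiffWithinAt.fderivWithin_right (m := ∞) hf uniqueDiffOn_HS (by simp)
      hx).differentiableWithinAt (by simp)
  have key : ∀ k l : Fin 4, pd k (pd l f) x =
      fderivWithin ℝ (fderivWithin ℝ f HS) HS x (EuclideanSpace.single k 1)
        (EuclideanSpace.single l 1) := by
    intro k l
    have : pd l f = fun y => fderivWithin ℝ f HS y (EuclideanSpace.single l 1) := rfl
    rw [this, pd, fderivWithin_clm_apply (uniqueDiffOn_HS x hx) h2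
      (differentiableWithinAt_const _)]
    simp
  rw [key, key]
  exact (ContDiffWithinAt.isSymmSndFDerivWithinAt hf
    (by rw [minSmoothness_of_isRCLikeNormedField]; exact WithTop.coe_le_coe.2 le_top) uniqueDiffOn_HS
    (mem_closure_interior_HS hx) hx).eq _ _

/-- Relatively open subset of the half-space. -/
structure RelOpen (U : Set Coord) : Prop where
  sub : U ⊆ HS
  nhd : ∀ x ∈ U, U ∈ 𝓝[HS] x

lemma RelOpen.eventually {U : Set Coord} (hU : RelOpen U) (hx : x ∈ U) {p : Coord → Prop}
    (h : ∀ y ∈ U, p y) : ∀ᶠ y in 𝓝[HS] x, p y := by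
  filter_upwards [hU.nhd x hx] with y hy using h y hy

/-! ### Entrywise derivatives of matrix fields -/

/-- Matrices of size four. -/
abbrev Mat : Type := Matrix (Fin 4) (Fin 4) ℝ

/-- Entrywise partial derivative of a matrix field. -/
noncomputable def pdM (i : Fin 4) (F : Coord → Mat) (x : Coord) : Mat :=
  Matrix.of fun c d => pd i (fun y => F y c d) x

/-- Entrywise smoothness. -/
def SmM (F : Coord → Mat) (x : Coord) : Prop := ∀ c d, SmAt (fun y => F y c d) x

variable {F H : Coord → Mat}

lemma SmM.mul (hF : SmM F x) (hH : SmM H x) : SmM (fun y => F y * H y) x := fun c d => by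
  simp only [Matrix.mul_apply]
  exact SmAt.sum fun e _ => (hF c e).mul (hH e d)

lemma SmM.add (hF : SmM F x) (hH : SmM H x) : SmM (fun y => F y + H y) x := fun c d =>
  (hF c d).add (hH c d)

lemma SmM.sub (hF : SmM F x) (hH : SmM H x) : SmM (fun y => F y - H y) x := fun c d =>
  (hF c d).sub (hH c d)

lemma SmM.transpose (hF : SmM F x) : SmM (fun y => (F y).transpose) x := fun c d => hF d c

lemma SmM.pdM (hF : SmM F x) (hx : x ∈ HS) (i : Fin 4) : SmM (pdM i F) x :=
  fun c d => (hF c d).pd hx i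

lemma SmM.det (hF : SmM F x) : SmAt (fun y => (F y).det) x := by
  simp only [Matrix.det_apply]
  refine SmAt.sum fun σ _ => ?_
  simp only [Units.smul_def, zsmul_eq_mul]
  exact (SmAt.const _).mul (SmAt.prod fun i _ => hF _ _)

/-- Cramer's rule: each entry of the inverse is a minor-type determinant divided by the determinant.
-/
lemma SmM.inv (hF : SmM F x) (h : (F x).det ≠ 0) : SmM (fun y => (F y)⁻¹) x := fun c d => by
  simp only [Matrix.inv_def, Matrix.smul_apply, Ring.inverse_eq_inv', smul_eq_mul,
    Matrix.adjugate_apply]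
  refine (hF.det.inv h).mul (SmM.det fun i j => ?_)
  simp only [Matrix.updateRow_apply]
  split_ifs
  · exact SmAt.const _
  · exact hF _ _

lemma pdM_congr (hx : x ∈ HS) (h : F =ᶠ[𝓝[HS] x] H) (i : Fin 4) : pdM i F x = pdM i H x := by
  ext c d
  exact pd_congr hx (h.mono fun y hy => by rw [hy]) i

lemma pdM_mul (hx : x ∈ HS) (i : Fin 4) (hF : SmM F x) (hH : SmM H x) :
    pdM i (fun y => F y * H y) x = pdM i F x * H x + F x * pdM i H x := by
  ext c d
  simp only [pdM, Matrix.mul_apply, Matrix.of_apply, Matrix.add_apply]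
  rw [pd_sum hx i fun e _ => ((hF c e).mul (hH e d)).dAt, ← Finset.sum_add_distrib]
  exact Finset.sum_congr rfl fun e _ => pd_mul hx i (hF c e).dAt (hH e d).dAt

lemma pdM_add (hx : x ∈ HS) (i : Fin 4) (hF : SmM F x) (hH : SmM H x) :
    pdM i (fun y => F y + H y) x = pdM i F x + pdM i H x := by
  ext c d; exact pd_add hx i (hF c d).dAt (hH c d).dAt

lemma pdM_sub (hx : x ∈ HS) (i : Fin 4) (hF : SmM F x) (hH : SmM H x) :
    pdM i (fun y => F y - H y) x = pdM i F x - pdM i H x := by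
  ext c d; exact pd_sub hx i (hF c d).dAt (hH c d).dAt

lemma pdM_transpose (i : Fin 4) :
    pdM i (fun y => (F y).transpose) x = (pdM i F x).transpose := rfl

lemma pdM_comm (hx : x ∈ HS) (hF : SmM F x) (i j : Fin 4) :
    pdM i (pdM j F) x = pdM j (pdM i F) x := by
  ext c d; exact pd_comm hx (hF c d) i j

lemma pdM_inv (hx : x ∈ HS) (i : Fin 4) (hF : SmM F x) (h : (F x).det ≠ 0) :
    pdM i (fun y => (F y)⁻¹) x = -((F x)⁻¹ * pdM i F x * (F x)⁻¹) := by
  have h1 : pdM i (fun y => F y * (F y)⁻¹) x = 0 := by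
    have : pdM i (fun _ => (1 : Mat)) x = 0 := by ext c d; exact pd_const hx i _
    rw [← this]
    refine pdM_congr hx ?_ i
    filter_upwards [hF.det.continuousWithinAt.eventually_ne h] with y hy
    exact Matrix.mul_nonsing_inv _ (isUnit_iff_ne_zero.2 hy)
  rw [pdM_mul hx i hF (hF.inv h)] at h1
  have h2 := congrArg (fun K => (F x)⁻¹ * K) h1
  simp only [Matrix.mul_add, mul_zero] at h2
  rw [Matrix.nonsing_inv_mul_cancel_left _ _ (isUnit_iff_ne_zero.2 h)] at h2
  rw [← Matrix.mul_assoc] at h2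
  exact (eq_neg_of_add_eq_zero_right h2)

end Scri

namespace Scri

/-! ### The Levi-Civita connection -/

/-- A smooth nondegenerate symmetric matrix field on a relatively open set. -/
structure MetricOn (U : Set Coord) (G : MetricComp) : Prop extends RelOpen U where
  sm : ∀ x ∈ U, SmM G x
  symm : ∀ x ∈ U, (G x).transpose = G x
  det : ∀ x ∈ U, (G x).det ≠ 0

/-- Connection matrices: `(conn G a)_{cd} = Γ^d_{ac}`. -/
noncomputable def conn (G : MetricComp) (a : Fin 4) (x : Coord) : Mat :=
  Matrix.of fun c d => christoffel G d a c x

/-- Curvature matrices: `(curv G a b)_{cd} = R_{abc}{}^d`. -/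
noncomputable def curv (G : MetricComp) (a b : Fin 4) (x : Coord) : Mat :=
  Matrix.of fun c d => riemann G a b c d x

/-- The Ricci tensor as a matrix. -/
noncomputable def ricM (G : MetricComp) (x : Coord) : Mat := Matrix.of fun a c => ricci G a c x

namespace MetricOn

variable {U : Set Coord} {G : MetricComp} {x : Coord} (h : MetricOn U G) (hx : x ∈ U)
include h hx

lemma hs : x ∈ HS := h.sub hx

lemma symm_apply (a b : Fin 4) : G x a b = G x b a := congrFun (congrFun (h.symm x hx) b) a

lemma inv_mul : (G x)⁻¹ * G x = 1 := Matrix.nonsing_inv_mul _ (isUnit_iff_ne_zero.2 (h.det x hx))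

lemma mul_inv : G x * (G x)⁻¹ = 1 := Matrix.mul_nonsing_inv _ (isUnit_iff_ne_zero.2 (h.det x hx))

lemma inv_symm : ((G x)⁻¹).transpose = (G x)⁻¹ := by
  rw [Matrix.transpose_nonsing_inv, h.symm x hx]

lemma ginv_symm (a b : Fin 4) : ginv G x a b = ginv G x b a :=
  congrFun (congrFun (h.inv_symm hx) b) a

lemma sum_ginv_mul (a b : Fin 4) : ∑ e, ginv G x a e * G x e b = if a = b then 1 else 0 := by
  have := congrFun (congrFun (h.inv_mul hx) a) b
  rwa [Matrix.mul_apply, Matrix.one_apply] at this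

lemma sum_mul_ginv (a b : Fin 4) : ∑ e, G x a e * ginv G x e b = if a = b then 1 else 0 := by
  have := congrFun (congrFun (h.mul_inv hx) a) b
  rwa [Matrix.mul_apply, Matrix.one_apply] at this

lemma smM_inv : SmM (fun y => (G y)⁻¹) x := (h.sm x hx).inv (h.det x hx)

lemma sm_ginv (a b : Fin 4) : SmAt (fun y => ginv G y a b) x := h.smM_inv hx a b

lemma pd_symm (i a b : Fin 4) : pd i (fun y => G y a b) x = pd i (fun y => G y b a) x :=
  pd_congr (h.hs hx) (h.eventually hx fun _ hy => h.symm_apply hy a b) i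

lemma christoffel_symm (c a b : Fin 4) : christoffel G c a b x = christoffel G c b a x := by
  simp only [christoffel]
  congr 1
  refine Finset.sum_congr rfl fun l _ => ?_
  rw [h.pd_symm hx l a b]; ring

lemma sm_christoffel (c a b : Fin 4) : SmAt (christoffel G c a b) x := by
  have hs := h.hs hx
  unfold christoffel
  exact (SmAt.const _).mul (SmAt.sum fun l _ => (h.sm_ginv hx c l).mul
    ((((h.sm x hx l b).pd hs a).add ((h.sm x hx l a).pd hs b)).sub ((h.sm x hx a b).pd hs l)))

lemma smM_conn (a : Fin 4) : SmM (conn G a) x := fun c d => h.sm_christoffel hx d a c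

lemma christoffel_lower (a c d : Fin 4) : ∑ e, christoffel G e a c x * G x e d =
    (1 / 2) * (pd a (fun y => G y d c) x + pd c (fun y => G y d a) x
      - pd d (fun y => G y a c) x) := by
  simp only [christoffel, mul_assoc, ← Finset.mul_sum, Finset.sum_mul]
  rw [Finset.sum_comm]
  congr 1
  have : ∀ l e, ginv G x e l * ((pd a (fun y => G y l c) x + pd c (fun y => G y l a) x
      - pd l (fun y => G y a c) x) * G x e d) = (pd a (fun y => G y l c) x
      + pd c (fun y => G y l a) x - pd l (fun y => G y a c) x) * (ginv G x l e * G x e d) := by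
    intro l e; rw [h.ginv_symm hx e l]; ring
  simp only [this, ← Finset.mul_sum, h.sum_ginv_mul hx]
  simp

lemma pdM_metric (a : Fin 4) : pdM a G x = conn G a x * G x + G x * (conn G a x).transpose := by
  ext c d
  have h1 := h.christoffel_lower hx a c d
  have h2 := h.christoffel_lower hx a d c
  have h3 : ∑ e, G x c e * christoffel G e a d x = ∑ e, christoffel G e a d x * G x e c :=
    Finset.sum_congr rfl fun e _ => by rw [h.symm_apply hx c e]; ring
  simp only [pdM, conn, Matrix.of_apply, Matrix.add_apply, Matrix.mul_apply,
    Matrix.transpose_apply]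
  rw [h3, h1, h2, h.pd_symm hx a d c, h.pd_symm hx d a c, h.pd_symm hx c a d]
  ring

lemma pdM_metricInv (a : Fin 4) : pdM a (fun y => (G y)⁻¹) x =
    -((G x)⁻¹ * conn G a x + (conn G a x).transpose * (G x)⁻¹) := by
  rw [pdM_inv (h.hs hx) a (h.sm x hx) (h.det x hx), h.pdM_metric hx, Matrix.mul_add,
    Matrix.add_mul, Matrix.mul_assoc, Matrix.mul_assoc, h.mul_inv hx, ← Matrix.mul_assoc (G x)⁻¹ (G x),
    h.inv_mul hx, Matrix.one_mul, Matrix.mul_one]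

omit h hx in
-- With this placement of indices the curvature is ∂_bΓ_a - ∂_aΓ_b + [Γ_a, Γ_b] as matrices, so the
-- Bianchi identities reduce to identities in a noncommutative ring.
lemma curv_eq (a b : Fin 4) : curv G a b = fun y => pdM b (conn G a) y - pdM a (conn G b) y
    + conn G a y * conn G b y - conn G b y * conn G a y := by
  funext x
  ext c d
  simp only [curv, conn, pdM, Matrix.of_apply, Matrix.add_apply, Matrix.sub_apply,
    Matrix.mul_apply, riemann, Finset.sum_sub_distrib]
  ring

lemma smM_curv (a b : Fin 4) : SmM (curv G a b) x := by
  have hs := h.hs hx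
  rw [curv_eq]
  exact ((((h.smM_conn hx a).pdM hs b).sub ((h.smM_conn hx b).pdM hs a)).add
    ((h.smM_conn hx a).mul (h.smM_conn hx b))).sub ((h.smM_conn hx b).mul (h.smM_conn hx a))

lemma sm_riemann (a b c d : Fin 4) : SmAt (riemann G a b c d) x := h.smM_curv hx a b c d

lemma sm_ricci (a c : Fin 4) : SmAt (ricci G a c) x := by
  unfold ricci; exact SmAt.sum fun b _ => h.sm_riemann hx a b c b

lemma sm_scalarCurv : SmAt (scalarCurv G) x := by
  unfold scalarCurv
  exact SmAt.sum fun a _ => SmAt.sum fun c _ => (h.sm_ginv hx a c).mul (h.sm_ricci hx a c)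

lemma sm_weylLow (a b c d : Fin 4) : SmAt (weylLow G a b c d) x := by
  have g := h.sm x hx
  have r := fun a c => h.sm_ricci hx a c
  unfold weylLow riemannLow
  simp only [div_eq_mul_inv]
  exact ((SmAt.sum fun e _ => (h.sm_riemann hx a b c e).mul (g e d)).sub ((SmAt.const _).mul
    (((((g a c).mul (r b d)).sub ((g a d).mul (r b c))).sub ((g b c).mul (r a d))).add
      ((g b d).mul (r a c))))).add (((h.sm_scalarCurv hx).mul (SmAt.const _)).mul
      (((g a c).mul (g b d)).sub ((g a d).mul (g b c))))

lemma sm_weyl (a b c d : Fin 4) : SmAt (weyl G a b c d) x := by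
  unfold weyl
  exact SmAt.sum fun e _ => (h.sm_weylLow hx a b c e).mul (h.sm_ginv hx e d)

omit h hx in
lemma riemann_antisymm (a b c d : Fin 4) : riemann G a b c d x = -riemann G b a c d x := by
  simp only [riemann, Finset.sum_sub_distrib]; ring

omit h hx in
lemma curv_antisymm (a b : Fin 4) : curv G a b x = -curv G b a x := by
  ext c d; exact riemann_antisymm a b c d

/-- Second partial derivatives of the metric commute; expressing them through metric compatibility
leaves exactly the curvature terms. This is the antisymmetry of R_{abcd} in the last pair. -/
lemma curv_mul_metric (a b : Fin 4) :
    curv G a b x * G x + G x * (curv G a b x).transpose = 0 := by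
  have hs := h.hs hx
  have e : ∀ i, pdM i G =ᶠ[𝓝[HS] x] fun y => conn G i y * G y + G y * (conn G i y).transpose :=
    fun i => h.eventually hx fun y hy => h.pdM_metric hy i
  have key : ∀ i j, pdM j (pdM i G) x = pdM j (conn G i) x * G x
      + conn G i x * (conn G j x * G x + G x * (conn G j x).transpose)
      + ((conn G j x * G x + G x * (conn G j x).transpose) * (conn G i x).transpose
      + G x * (pdM j (conn G i) x).transpose) := by
    intro i j
    rw [pdM_congr hs (e i), pdM_add hs j ((h.smM_conn hx i).mul (h.sm x hx))
      ((h.sm x hx).mul (h.smM_conn hx i).transpose), pdM_mul hs j (h.smM_conn hx i) (h.sm x hx),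
      pdM_mul hs j (h.sm x hx) (h.smM_conn hx i).transpose, h.pdM_metric hx j, pdM_transpose]
  have hc := pdM_comm hs (h.sm x hx) b a
  rw [key, key] at hc
  rw [curv_eq]
  simp only [Matrix.transpose_add, Matrix.transpose_sub, Matrix.transpose_mul]
  rw [← sub_eq_zero] at hc
  rw [← hc]
  noncomm_ring

lemma riemann_cyclic (a b c d : Fin 4) :
    riemann G a b c d x + riemann G b c a d x + riemann G c a b d x = 0 := by
  have s := fun i c a b => pd_congr (h.hs hx)
    (h.eventually hx fun y hy => h.christoffel_symm hy c a b) i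
  have t := fun c a b => h.christoffel_symm hx c a b
  simp only [riemann, Finset.sum_sub_distrib]
  rw [s a d c b, s b d c a, s a d b c, s c d b a]
  simp only [t _ c b, t _ c a, t _ b a]
  rw [s c d a b]
  ring

/-- Covariant derivative `∇_e R_{abc}{}^d` as a matrix in `c, d`. -/
noncomputable def _root_.Scri.covCurv (G : MetricComp) (e a b : Fin 4) (x : Coord) : Mat :=
  pdM e (curv G a b) x - conn G e x * curv G a b x + curv G a b x * conn G e x
    - ∑ f, christoffel G f e a x • curv G f b x - ∑ f, christoffel G f e b x • curv G a f x

/-- Covariant derivative `∇_a F_{bc}`. -/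
noncomputable def _root_.Scri.cov2 (G : MetricComp) (F : Fin 4 → Fin 4 → Coord → ℝ)
    (a b c : Fin 4) (x : Coord) : ℝ :=
  pd a (F b c) x - ∑ e, (christoffel G e a b x * F e c x + christoffel G e a c x * F b e x)

/-- Covariant divergence `∇_d W_{abc}{}^d`. -/
noncomputable def _root_.Scri.covDiv (G : MetricComp)
    (W : Fin 4 → Fin 4 → Fin 4 → Fin 4 → Coord → ℝ) (a b c : Fin 4) (x : Coord) : ℝ :=
  ∑ d, (pd d (W a b c d) x - ∑ e, (christoffel G e d a x * W e b c d x
    + christoffel G e d b x * W a e c d x + christoffel G e d c x * W a b e d x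
    - christoffel G d d e x * W a b c e x))

/-- Second Bianchi identity. Second derivatives of Γ cancel because partial derivatives commute, the
Christoffel terms acting on the form indices cancel in pairs by torsion-freeness (`t` below), and
what remains is a Jacobi identity for the connection matrices. -/
lemma covCurv_cyclic (e a b : Fin 4) :
    covCurv G e a b x + covCurv G a b e x + covCurv G b e a x = 0 := by
  have hs := h.hs hx
  have key : ∀ e a b, pdM e (curv G a b) x = pdM e (pdM b (conn G a)) x
      - pdM e (pdM a (conn G b)) x + (pdM e (conn G a) x * conn G b x
      + conn G a x * pdM e (conn G b) x) - (pdM e (conn G b) x * conn G a x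
      + conn G b x * pdM e (conn G a) x) := by
    intro e a b
    have A := h.smM_conn hx a
    have B := h.smM_conn hx b
    rw [curv_eq, pdM_sub hs e (((A.pdM hs b).sub (B.pdM hs a)).add (A.mul B)) (B.mul A),
      pdM_add hs e ((A.pdM hs b).sub (B.pdM hs a)) (A.mul B),
      pdM_sub hs e (A.pdM hs b) (B.pdM hs a), pdM_mul hs e A B, pdM_mul hs e B A]
  have t : ∀ (a b c : Fin 4), ∑ f, christoffel G f a b x • curv G f c x
      = -∑ f, christoffel G f b a x • curv G c f x := by
    intro a b c
    rw [← Finset.sum_neg_distrib]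
    refine Finset.sum_congr rfl fun f _ => ?_
    rw [h.christoffel_symm hx f a b, curv_antisymm f c, smul_neg]
  simp only [covCurv]
  rw [t e a b, t a b e, t b e a, key, key, key,
    pdM_comm hs (h.smM_conn hx a) e b, pdM_comm hs (h.smM_conn hx b) e a,
    pdM_comm hs (h.smM_conn hx e) a b]
  simp only [curv_eq]
  noncomm_ring

lemma inv_curv_antisymm (a b : Fin 4) :
    (curv G a b x).transpose * (G x)⁻¹ = -((G x)⁻¹ * curv G a b x) := by
  have h1 := congrArg (fun K => (G x)⁻¹ * K * (G x)⁻¹) (h.curv_mul_metric hx a b)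
  simp only [Matrix.mul_add, Matrix.add_mul, mul_zero, zero_mul] at h1
  rw [Matrix.mul_assoc, Matrix.mul_assoc, h.mul_inv hx, ← Matrix.mul_assoc (G x)⁻¹ (G x),
    h.inv_mul hx, Matrix.mul_one, Matrix.one_mul] at h1
  exact eq_neg_of_add_eq_zero_right h1

/-- The metric is parallel, so the antisymmetry of the curvature in its last pair survives covariant
differentiation: the derivative of the inverse metric supplies exactly the connection terms of
`covCurv`. -/
lemma inv_covCurv_antisymm (e a b : Fin 4) :
    ((G x)⁻¹ * covCurv G e a b x).transpose = -((G x)⁻¹ * covCurv G e a b x) := by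
  have hs := h.hs hx
  have k : ∀ a b, (curv G a b x).transpose * (G x)⁻¹ = -((G x)⁻¹ * curv G a b x) :=
    fun a b => h.inv_curv_antisymm hx a b
  have h1 : pdM e (fun y => (curv G a b y).transpose * (G y)⁻¹ + (G y)⁻¹ * curv G a b y) x = 0 := by
    have : pdM e (fun _ => (0 : Mat)) x = 0 := by ext c d; exact pd_const hs e _
    rw [← this]
    refine pdM_congr hs (h.eventually hx fun y hy => ?_) e
    rw [h.inv_curv_antisymm hy, neg_add_cancel]
  rw [pdM_add hs e ((h.smM_curv hx a b).transpose.mul (h.smM_inv hx))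
    ((h.smM_inv hx).mul (h.smM_curv hx a b)), pdM_mul hs e (h.smM_curv hx a b).transpose
    (h.smM_inv hx), pdM_mul hs e (h.smM_inv hx) (h.smM_curv hx a b), h.pdM_metricInv hx,
    pdM_transpose] at h1
  have e1 : (pdM e (curv G a b) x).transpose * (G x)⁻¹ + (G x)⁻¹ * pdM e (curv G a b) x =
      (curv G a b x).transpose * ((G x)⁻¹ * conn G e x + (conn G e x).transpose * (G x)⁻¹)
      + ((G x)⁻¹ * conn G e x + (conn G e x).transpose * (G x)⁻¹) * curv G a b x := by
    rw [← sub_eq_zero, ← h1]; noncomm_ring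
  have e2 : (curv G a b x).transpose * ((G x)⁻¹ * conn G e x)
      = -((G x)⁻¹ * curv G a b x * conn G e x) := by
    rw [← Matrix.mul_assoc, k, Matrix.neg_mul]
  rw [Matrix.transpose_mul, h.inv_symm hx]
  simp only [covCurv, Matrix.transpose_add, Matrix.transpose_sub, Matrix.transpose_mul,
    Matrix.transpose_sum, Matrix.transpose_smul, Matrix.sub_mul, Matrix.add_mul, Finset.sum_mul,
    Matrix.smul_mul, k, smul_neg, Finset.sum_neg_distrib, Matrix.mul_sub, Matrix.mul_add,
    Finset.mul_sum, Matrix.mul_smul]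
  have e3 : (conn G e x).transpose * (curv G a b x).transpose * (G x)⁻¹
      = -((conn G e x).transpose * (G x)⁻¹ * curv G a b x) := by
    rw [Matrix.mul_assoc, k, Matrix.mul_neg, Matrix.mul_assoc]
  rw [eq_sub_of_add_eq e1, e3]
  simp only [Matrix.mul_add, Matrix.add_mul, e2]
  noncomm_ring

end MetricOn
end Scri

/-! ### Symmetries of the curvature, contracted Bianchi identities, the Weyl tensor -/

namespace Scri
namespace MetricOn

variable {U : Set Coord} {G : MetricComp} {x : Coord} (h : MetricOn U G) (hx : x ∈ U)
include h hx

lemma riemannLow_antisymm_right (a b c d : Fin 4) :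
    riemannLow G a b c d x = -riemannLow G a b d c x := by
  have h1 := congrFun (congrFun (h.curv_mul_metric hx a b) c) d
  simp only [Matrix.add_apply, Matrix.mul_apply, Matrix.transpose_apply, curv, Matrix.of_apply,
    Matrix.zero_apply] at h1
  simp only [riemannLow]
  rw [eq_neg_of_add_eq_zero_left h1]
  congr 1
  exact Finset.sum_congr rfl fun e _ => by rw [h.symm_apply hx c e]; ring

omit h hx in
lemma riemannLow_antisymm_left (a b c d : Fin 4) :
    riemannLow G a b c d x = -riemannLow G b a c d x := by
  simp only [riemannLow, ← Finset.sum_neg_distrib]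
  exact Finset.sum_congr rfl fun e _ => by rw [riemann_antisymm a b]; ring

lemma riemannLow_cyclic (a b c d : Fin 4) :
    riemannLow G a b c d x + riemannLow G b c a d x + riemannLow G c a b d x = 0 := by
  simp only [riemannLow, ← Finset.sum_add_distrib, ← add_mul, h.riemann_cyclic hx, zero_mul,
    Finset.sum_const_zero]

lemma trace_curv (a b : Fin 4) : ∑ c, riemann G a b c c x = 0 := by
  have h1 := h.inv_curv_antisymm hx a b
  have h2 : (curv G a b x).trace = -(curv G a b x).trace := by
    conv_lhs => rw [← Matrix.trace_transpose, ← Matrix.mul_one (curv G a b x).transpose,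
      ← h.inv_mul hx, ← Matrix.mul_assoc, h1, Matrix.neg_mul, Matrix.trace_neg,
      Matrix.mul_assoc, Matrix.trace_mul_comm, Matrix.mul_assoc, h.mul_inv hx, Matrix.mul_one]
  have h3 : (curv G a b x).trace = 0 := by linarith
  simpa [Matrix.trace, curv] using h3

lemma ricci_symm (a c : Fin 4) : ricci G a c x = ricci G c a x := by
  have h1 : ∑ b, (riemann G a b c b x + riemann G b c a b x + riemann G c a b b x) = 0 :=
    Finset.sum_eq_zero fun b _ => h.riemann_cyclic hx a b c b
  rw [Finset.sum_add_distrib, Finset.sum_add_distrib, h.trace_curv hx] at h1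
  have h2 : ∑ b, riemann G b c a b x = -ricci G c a x := by
    rw [ricci, ← Finset.sum_neg_distrib]
    exact Finset.sum_congr rfl fun b _ => riemann_antisymm b c a b
  rw [h2] at h1
  unfold ricci at h1 ⊢
  linarith

lemma pd_ricci (i a c : Fin 4) :
    pd i (ricci G a c) x = ∑ b, pd i (riemann G a b c b) x := by
  unfold ricci
  exact pd_sum (h.hs hx) i fun b _ => (h.sm_riemann hx a b c b).dAt

omit h hx in
lemma covCurv_apply (e a b c d : Fin 4) : covCurv G e a b x c d =
    pd e (riemann G a b c d) x - ∑ f, christoffel G f e c x * riemann G a b f d x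
      + ∑ f, riemann G a b c f x * christoffel G d e f x
      - ∑ f, christoffel G f e a x * riemann G f b c d x
      - ∑ f, christoffel G f e b x * riemann G a f c d x := by
  simp [covCurv, curv, conn, pdM, Matrix.sub_apply, Matrix.add_apply, Matrix.mul_apply,
    Matrix.sum_apply]

/-- Contraction commutes with covariant differentiation: the two Christoffel terms attached to the
contracted pair cancel. -/
lemma trace_covCurv (e a c : Fin 4) :
    ∑ b, covCurv G e a b x c b = cov2 G (ricci G) e a c x := by
  simp only [covCurv_apply, Finset.sum_sub_distrib, Finset.sum_add_distrib, cov2, h.pd_ricci hx]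
  rw [Finset.sum_comm (f := fun b f => christoffel G f e c x * riemann G a b f b x),
    Finset.sum_comm (f := fun b f => christoffel G f e a x * riemann G f b c b x),
    Finset.sum_comm (f := fun b f => riemann G a b c f x * christoffel G b e f x)]
  simp only [ricci, Finset.mul_sum, mul_comm (riemann G _ _ _ _ x)]
  ring

omit h hx in
lemma covDiv_riemann (a b c : Fin 4) :
    covDiv G (riemann G) a b c x = ∑ d, covCurv G d a b x c d := by
  refine Finset.sum_congr rfl fun d _ => ?_
  simp only [covCurv_apply, Finset.sum_sub_distrib, Finset.sum_add_distrib,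
    mul_comm (riemann G _ _ _ _ x)]
  ring

lemma covDiv_riemann_eq (a b c : Fin 4) : covDiv G (riemann G) a b c x =
    cov2 G (ricci G) b a c x - cov2 G (ricci G) a b c x := by
  have h1 : ∑ d, (covCurv G d a b x c d + covCurv G a b d x c d + covCurv G b d a x c d) = 0 :=
    Finset.sum_eq_zero fun d _ => by
      have := congrFun (congrFun (h.covCurv_cyclic hx d a b) c) d
      simpa using this
  have h2 : ∀ e a b, covCurv G e a b x = -covCurv G e b a x := by
    intro e a b
    ext c d
    simp only [covCurv_apply, Matrix.neg_apply]
    have : pd e (riemann G a b c d) x = -pd e (riemann G b a c d) x := by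
      rw [← pd_neg (h.hs hx)]
      exact pd_congr (h.hs hx) (Eventually.of_forall fun y => riemann_antisymm a b c d) e
    rw [this]
    simp only [riemann_antisymm a b, riemann_antisymm a _ c d, riemann_antisymm _ b c d,
      neg_mul, mul_neg, Finset.sum_neg_distrib]
    ring
  rw [Finset.sum_add_distrib, Finset.sum_add_distrib, h.trace_covCurv hx] at h1
  have h3 : ∑ d, covCurv G b d a x c d = -cov2 G (ricci G) b a c x := by
    rw [← h.trace_covCurv hx, ← Finset.sum_neg_distrib]
    exact Finset.sum_congr rfl fun d _ => by rw [h2 b d a]; rfl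
  rw [covDiv_riemann, eq_sub_of_add_eq (eq_sub_of_add_eq (h1.trans (sub_self _).symm)), h3]
  ring

lemma pd_scalarCurv (a : Fin 4) :
    pd a (scalarCurv G) x = ∑ b, ∑ c, ginv G x b c * cov2 G (ricci G) a b c x := by
  have hs := h.hs hx
  have hr : SmM (ricM G) x := fun b c => h.sm_ricci hx b c
  have e1 : scalarCurv G =ᶠ[𝓝[HS] x] fun y => ((G y)⁻¹ * ricM G y).trace :=
    h.eventually hx fun y hy => by
      simp only [Matrix.trace, Matrix.diag, Matrix.mul_apply, scalarCurv, ginv, ricM,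
        Matrix.of_apply]
      exact Finset.sum_congr rfl fun b _ => Finset.sum_congr rfl fun c _ => by
        rw [h.ricci_symm hy b c]
  have e2 : pd a (fun y => ((G y)⁻¹ * ricM G y).trace) x
      = (pdM a (fun y => (G y)⁻¹ * ricM G y) x).trace := by
    simp only [Matrix.trace, Matrix.diag]
    exact pd_sum hs a fun i _ => ((h.smM_inv hx).mul hr i i).dAt
  have e3 : Matrix.of (fun b c => cov2 G (ricci G) a b c x) =
      pdM a (ricM G) x - conn G a x * ricM G x - ricM G x * (conn G a x).transpose := by
    ext b c
    simp [cov2, pdM, ricM, conn, Matrix.mul_apply, Finset.sum_add_distrib, mul_comm]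
    rw [sub_sub]
  have e4 : ∑ b, ∑ c, ginv G x b c * cov2 G (ricci G) a b c x =
      ((G x)⁻¹ * (Matrix.of fun b c => cov2 G (ricci G) a b c x).transpose).trace := by
    simp [Matrix.trace, Matrix.mul_apply, ginv]
  have e5 : (ricM G x).transpose = ricM G x := by
    ext b c; exact h.ricci_symm hx c b
  rw [pd_congr hs e1, e2, pdM_mul hs a (h.smM_inv hx) hr, h.pdM_metricInv hx, e4, e3]
  simp only [Matrix.transpose_sub, Matrix.transpose_mul, Matrix.transpose_transpose, e5,
    ← pdM_transpose]
  have e6 : pdM a (fun y => (ricM G y).transpose) x = pdM a (ricM G) x :=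
    pdM_congr hs (h.eventually hx fun y hy => by ext b c; exact h.ricci_symm hy c b) a
  rw [e6]
  simp only [Matrix.mul_sub, Matrix.neg_mul, Matrix.add_mul, Matrix.trace_add, Matrix.trace_sub,
    Matrix.trace_neg]
  rw [Matrix.mul_assoc (G x)⁻¹ (conn G a x), Matrix.mul_assoc _ (G x)⁻¹ (ricM G x),
    Matrix.trace_mul_comm (conn G a x).transpose]
  rw [Matrix.mul_assoc (G x)⁻¹ (ricM G x)]
  have e7 : ((G x)⁻¹ * (conn G a x * ricM G x)).trace
      = ((G x)⁻¹ * (ricM G x * (conn G a x).transpose)).trace := by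
    rw [← Matrix.trace_transpose]
    simp only [Matrix.transpose_mul, e5, h.inv_symm hx]
    rw [Matrix.trace_mul_comm]
  rw [e7]
  ring

/-- Double contraction of the second Bianchi identity. The index `c` is raised in `Q` so that the
antisymmetry in the last pair can be used; two of the three terms become the divergence of the Ricci
tensor and the third the gradient of the scalar curvature. -/
lemma contracted_bianchi (a : Fin 4) :
    ∑ b, ∑ c, ginv G x b c * cov2 G (ricci G) b a c x = (1 / 2) * pd a (scalarCurv G) x := by
  have hs := h.hs hx
  set Q : Fin 4 → Fin 4 → Fin 4 → Mat := fun e a b => (G x)⁻¹ * covCurv G e a b x with hQ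
  have q1 : ∀ e a b c d, Q e a b c d = -Q e a b d c := fun e a b c d =>
    congrFun (congrFun (h.inv_covCurv_antisymm hx e a b) d) c
  have q2 : ∀ e a b c d, Q e a b c d = -Q e b a c d := by
    have h2 : ∀ e a b, covCurv G e a b x = -covCurv G e b a x := by
      intro e a b
      ext c d
      simp only [covCurv_apply, Matrix.neg_apply]
      have : pd e (riemann G a b c d) x = -pd e (riemann G b a c d) x := by
        rw [← pd_neg (h.hs hx)]
        exact pd_congr (h.hs hx) (Eventually.of_forall fun y => riemann_antisymm a b c d) e
      rw [this]
      simp only [riemann_antisymm a b, riemann_antisymm a _ c d, riemann_antisymm _ b c d,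
        neg_mul, mul_neg, Finset.sum_neg_distrib]
      ring
    intro e a b c d
    simp only [hQ]
    rw [h2 e a b, Matrix.mul_neg]; rfl
  have q3 : ∀ e a b c d, Q e a b c d + Q a b e c d + Q b e a c d = 0 := by
    intro e a b c d
    have := congrArg (fun K => ((G x)⁻¹ * K) c d) (h.covCurv_cyclic hx e a b)
    simpa [Matrix.mul_add, hQ] using this
  have q4 : ∀ e a c, ∑ b, Q e a b c b = ∑ c', ginv G x c c' * cov2 G (ricci G) e a c' x := by
    intro e a c
    simp only [hQ, Matrix.mul_apply, ← h.trace_covCurv hx, Finset.mul_sum]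
    exact Finset.sum_comm
  have t : ∑ b, ∑ d, (Q d a b b d + Q a b d b d + Q b d a b d) = 0 :=
    Finset.sum_eq_zero fun b _ => Finset.sum_eq_zero fun d _ => q3 d a b b d
  simp only [Finset.sum_add_distrib] at t
  have t1 : ∑ b, ∑ d, Q d a b b d = -∑ d, ∑ b, Q d a b d b := by
    rw [Finset.sum_comm, ← Finset.sum_neg_distrib]
    exact Finset.sum_congr rfl fun d _ => by
      rw [← Finset.sum_neg_distrib]
      exact Finset.sum_congr rfl fun b _ => q1 d a b b d
  have t2 : ∑ b, ∑ d, Q b d a b d = -∑ b, ∑ d, Q b a d b d := by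
    rw [← Finset.sum_neg_distrib]
    exact Finset.sum_congr rfl fun d _ => by
      rw [← Finset.sum_neg_distrib]
      exact Finset.sum_congr rfl fun b _ => q2 _ _ _ _ _
  rw [t1, t2] at t
  simp only [q4] at t
  rw [← h.pd_scalarCurv hx] at t
  linarith

/-- The Weyl tensor with its last index raised. -/
lemma weyl_eq (a b c d : Fin 4) : weyl G a b c d x = riemann G a b c d x
    - (1 / 2) * (G x a c * ∑ e, ginv G x d e * ricci G b e x - (if a = d then ricci G b c x else 0)
      - G x b c * ∑ e, ginv G x d e * ricci G a e x + (if b = d then ricci G a c x else 0))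
    + (scalarCurv G x / 6) * (G x a c * (if b = d then 1 else 0)
      - (if a = d then 1 else 0) * G x b c) := by
  have s : ∀ a, (∑ e, G x a e * ginv G x e d) = if a = d then 1 else 0 :=
    fun a => h.sum_mul_ginv hx a d
  have s1 : ∑ e, riemannLow G a b c e x * ginv G x e d = riemann G a b c d x := by
    simp only [riemannLow, Finset.sum_mul, mul_assoc]
    rw [Finset.sum_comm]
    simp only [← Finset.mul_sum, s]
    simp
  have s2 : ∀ a, ∑ e, ricci G a e x * ginv G x e d = ∑ e, ginv G x d e * ricci G a e x :=
    fun a => Finset.sum_congr rfl fun e _ => by rw [h.ginv_symm hx d e]; ring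
  have e1 : ∀ e, weylLow G a b c e x * ginv G x e d = riemannLow G a b c e x * ginv G x e d
    - (1 / 2) * (G x a c * (ricci G b e x * ginv G x e d)
      - ricci G b c x * (G x a e * ginv G x e d)
      - G x b c * (ricci G a e x * ginv G x e d) + ricci G a c x * (G x b e * ginv G x e d))
    + (scalarCurv G x / 6) * (G x a c * (G x b e * ginv G x e d)
      - G x b c * (G x a e * ginv G x e d)) := fun e => by simp only [weylLow]; ring
  rw [weyl]
  simp only [e1, Finset.sum_add_distrib, Finset.sum_sub_distrib, ← Finset.mul_sum, s, s1, s2]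
  split_ifs <;> ring

end MetricOn
end Scri

/-! ### Calculus of covariant divergences and the divergence of the Weyl tensor -/

namespace Scri

section covDiv

variable {G : MetricComp} {x : Coord}

lemma covDiv_congr (hx : x ∈ HS) {W W' : Fin 4 → Fin 4 → Fin 4 → Fin 4 → Coord → ℝ}
    (hW : ∀ a b c d, W a b c d =ᶠ[𝓝[HS] x] W' a b c d) (a b c : Fin 4) :
    covDiv G W a b c x = covDiv G W' a b c x := by
  have e : ∀ a b c d, W a b c d x = W' a b c d x := fun a b c d =>
    (hW a b c d).self_of_nhdsWithin hx
  simp only [covDiv, e, pd_congr hx (hW _ _ _ _)]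

lemma covDiv_add (hx : x ∈ HS) {W W' : Fin 4 → Fin 4 → Fin 4 → Fin 4 → Coord → ℝ}
    (hW : ∀ a b c d, DAt (W a b c d) x) (hW' : ∀ a b c d, DAt (W' a b c d) x) (a b c : Fin 4) :
    covDiv G (fun a b c d y => W a b c d y + W' a b c d y) a b c x
      = covDiv G W a b c x + covDiv G W' a b c x := by
  simp only [covDiv, ← Finset.sum_add_distrib]
  refine Finset.sum_congr rfl fun d _ => ?_
  rw [show pd d (fun y => W a b c d y + W' a b c d y) x = _ from
    pd_add hx d (hW a b c d) (hW' a b c d)]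
  simp only [mul_add, Finset.sum_add_distrib, Finset.sum_sub_distrib]
  ring

lemma covDiv_smul (hx : x ∈ HS) {W : Fin 4 → Fin 4 → Fin 4 → Fin 4 → Coord → ℝ} {f : Coord → ℝ}
    (hf : DAt f x) (hW : ∀ a b c d, DAt (W a b c d) x) (a b c : Fin 4) :
    covDiv G (fun a b c d y => f y * W a b c d y) a b c x
      = f x * covDiv G W a b c x + ∑ d, pd d f x * W a b c d x := by
  simp only [covDiv, Finset.mul_sum, ← Finset.sum_add_distrib]
  refine Finset.sum_congr rfl fun d _ => ?_
  rw [show pd d (fun y => f y * W a b c d y) x = _ from pd_mul hx d hf (hW a b c d)]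
  simp only [mul_add, mul_sub, Finset.mul_sum, Finset.sum_add_distrib, Finset.sum_sub_distrib,
    mul_left_comm (f x)]
  ring

lemma cov2_smul (hx : x ∈ HS) {F : Fin 4 → Fin 4 → Coord → ℝ} {f : Coord → ℝ}
    (hf : DAt f x) (hF : ∀ a b, DAt (F a b) x) (a b c : Fin 4) :
    cov2 G (fun b c y => f y * F b c y) a b c x
      = f x * cov2 G F a b c x + pd a f x * F b c x := by
  simp only [cov2]
  rw [show pd a (fun y => f y * F b c y) x = _ from pd_mul hx a hf (hF b c)]
  simp only [mul_add, mul_sub, Finset.mul_sum, Finset.sum_add_distrib, mul_left_comm (f x)]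
  ring

lemma cov2_add (hx : x ∈ HS) {F F' : Fin 4 → Fin 4 → Coord → ℝ}
    (hF : ∀ a b, DAt (F a b) x) (hF' : ∀ a b, DAt (F' a b) x) (a b c : Fin 4) :
    cov2 G (fun b c y => F b c y + F' b c y) a b c x
      = cov2 G F a b c x + cov2 G F' a b c x := by
  simp only [cov2]
  rw [show pd a (fun y => F b c y + F' b c y) x = _ from pd_add hx a (hF b c) (hF' b c)]
  simp only [mul_add, Finset.sum_add_distrib]
  ring

lemma cov2_congr (hx : x ∈ HS) {F F' : Fin 4 → Fin 4 → Coord → ℝ}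
    (hF : ∀ a b, F a b =ᶠ[𝓝[HS] x] F' a b) (a b c : Fin 4) :
    cov2 G F a b c x = cov2 G F' a b c x := by
  have e : ∀ a b, F a b x = F' a b x := fun a b => (hF a b).self_of_nhdsWithin hx
  simp only [cov2, e, pd_congr hx (hF _ _)]

/-- The Kronecker delta is parallel. Together with the metric versions below, this handles each
correction term of the Weyl tensor, which is a tensor product of a delta or a metric with a
two-index tensor. -/
lemma covDiv_delta_left (hx : x ∈ HS) (F : Fin 4 → Fin 4 → Coord → ℝ) (a b c : Fin 4) :
    covDiv G (fun a b c d y => if a = d then F b c y else 0) a b c x = cov2 G F a b c x := by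
  have e : ∀ d, pd d (fun y => if a = d then F b c y else 0) x
      = if a = d then pd a (F b c) x else 0 := by
    intro d
    by_cases hd : a = d
    · subst hd; simp
    · simp [hd, pd_const hx]
  simp only [covDiv, e, cov2, Finset.sum_sub_distrib, Finset.sum_add_distrib, mul_ite, mul_zero,
    Finset.sum_ite_eq, Finset.sum_ite_eq', Finset.mem_univ, if_true]
  rw [Finset.sum_comm (f := fun d e => if a = d then christoffel G e d b x * F e c x else 0),
    Finset.sum_comm (f := fun d e => if a = d then christoffel G e d c x * F b e x else 0)]
  simp only [Finset.sum_ite_eq, Finset.mem_univ, if_true]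
  ring

lemma covDiv_delta_right (hx : x ∈ HS) (F : Fin 4 → Fin 4 → Coord → ℝ) (a b c : Fin 4) :
    covDiv G (fun a b c d y => if b = d then F a c y else 0) a b c x = cov2 G F b a c x := by
  have e : ∀ d, pd d (fun y => if b = d then F a c y else 0) x
      = if b = d then pd b (F a c) x else 0 := by
    intro d
    by_cases hd : b = d
    · subst hd; simp
    · simp [hd, pd_const hx]
  simp only [covDiv, e, cov2, Finset.sum_sub_distrib, Finset.sum_add_distrib, mul_ite, mul_zero,
    Finset.sum_ite_eq, Finset.sum_ite_eq', Finset.mem_univ, if_true]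
  rw [Finset.sum_comm (f := fun d e => if b = d then christoffel G e d a x * F e c x else 0),
    Finset.sum_comm (f := fun d e => if b = d then christoffel G e d c x * F a e x else 0)]
  simp only [Finset.sum_ite_eq, Finset.mem_univ, if_true]
  ring

end covDiv

namespace MetricOn

variable {U : Set Coord} {G : MetricComp} {x : Coord} (h : MetricOn U G) (hx : x ∈ U)
include h hx

lemma pd_metric (i a b : Fin 4) : pd i (fun y => G y a b) x =
    ∑ e, (christoffel G e i a x * G x e b + christoffel G e i b x * G x a e) := by
  have := congrFun (congrFun (h.pdM_metric hx i) a) b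
  simp only [pdM, Matrix.of_apply, conn, Matrix.add_apply, Matrix.mul_apply,
    Matrix.transpose_apply] at this
  rw [this, Finset.sum_add_distrib]
  congr 1
  exact Finset.sum_congr rfl fun e _ => by ring

lemma cov2_metric (a b c : Fin 4) : cov2 G (fun b c y => G y b c) a b c x = 0 := by
  rw [cov2, sub_eq_zero]; exact h.pd_metric hx a b c

lemma covDiv_metric_left {V : Fin 4 → Fin 4 → Coord → ℝ} (hV : ∀ a b, DAt (V a b) x)
    (a b c : Fin 4) : covDiv G (fun a b c d y => G y a c * V b d y) a b c x = G x a c *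
      ∑ d, (pd d (V b d) x - ∑ e, (christoffel G e d b x * V e d x
        - christoffel G d d e x * V b e x)) := by
  simp only [covDiv, Finset.mul_sum, mul_sub]
  refine Finset.sum_congr rfl fun d _ => ?_
  rw [pd_mul (h.hs hx) d (h.sm x hx a c).dAt (hV b d), h.pd_metric hx d a c]
  simp only [add_mul, Finset.sum_mul, Finset.sum_add_distrib, Finset.sum_sub_distrib, mul_assoc,
    mul_left_comm (G x a c)]
  ring

lemma covDiv_metric_right {V : Fin 4 → Fin 4 → Coord → ℝ} (hV : ∀ a b, DAt (V a b) x)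
    (a b c : Fin 4) : covDiv G (fun a b c d y => G y b c * V a d y) a b c x = G x b c *
      ∑ d, (pd d (V a d) x - ∑ e, (christoffel G e d a x * V e d x
        - christoffel G d d e x * V a e x)) := by
  simp only [covDiv, Finset.mul_sum, mul_sub]
  refine Finset.sum_congr rfl fun d _ => ?_
  rw [pd_mul (h.hs hx) d (h.sm x hx b c).dAt (hV a d), h.pd_metric hx d b c]
  simp only [add_mul, Finset.sum_mul, Finset.sum_add_distrib, Finset.sum_sub_distrib, mul_assoc,
    mul_left_comm (G x b c)]
  ring

/-- `∇_d R_b{}^d = (1/2) ∂_b R`. -/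
lemma div_ricci_raised (b : Fin 4) :
    ∑ d, (pd d (fun y => ∑ e, ginv G y d e * ricci G b e y) x
      - ∑ e, (christoffel G e d b x * (∑ k, ginv G x d k * ricci G e k x)
        - christoffel G d d e x * (∑ k, ginv G x e k * ricci G b k x)))
      = (1 / 2) * pd b (scalarCurv G) x := by
  have hs := h.hs hx
  have hr : SmM (ricM G) x := fun b c => h.sm_ricci hx b c
  rw [← h.contracted_bianchi hx b]
  refine Finset.sum_congr rfl fun d _ => ?_
  have e3 : Matrix.of (fun b c => cov2 G (ricci G) d b c x) =
      pdM d (ricM G) x - conn G d x * ricM G x - ricM G x * (conn G d x).transpose := by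
    ext b c
    simp [cov2, pdM, ricM, conn, Matrix.mul_apply, Finset.sum_add_distrib, mul_comm]
    rw [sub_sub]
  have e1 : ∑ c, ginv G x d c * cov2 G (ricci G) d b c x =
      (Matrix.of (fun b c => cov2 G (ricci G) d b c x) * (G x)⁻¹) b d := by
    simp only [Matrix.mul_apply, Matrix.of_apply]
    exact Finset.sum_congr rfl fun c _ => by rw [h.ginv_symm hx d c]; exact mul_comm _ _
  have e2 : pd d (fun y => ∑ e, ginv G y d e * ricci G b e y) x
      = (pdM d (fun y => ricM G y * (G y)⁻¹) x) b d := by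
    refine pd_congr hs (h.eventually hx fun y hy => ?_) d
    simp only [Matrix.mul_apply, ricM, Matrix.of_apply]
    exact Finset.sum_congr rfl fun c _ => by rw [h.ginv_symm hy d c]; exact mul_comm _ _
  have e4 : ∀ b d, ∑ k, ginv G x d k * ricci G b k x = (ricM G x * (G x)⁻¹) b d := by
    intro b d
    simp only [Matrix.mul_apply, ricM, Matrix.of_apply]
    exact Finset.sum_congr rfl fun c _ => by rw [h.ginv_symm hx d c]; exact mul_comm _ _
  rw [e1, e2, e3, pdM_mul hs d hr (h.smM_inv hx), h.pdM_metricInv hx, Finset.sum_sub_distrib]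
  simp only [e4]
  have e5 : ∑ e, christoffel G e d b x * (ricM G x * (G x)⁻¹) e d
      = (conn G d x * (ricM G x * (G x)⁻¹)) b d := by simp [Matrix.mul_apply, conn]
  have e6 : ∑ e, christoffel G d d e x * (ricM G x * (G x)⁻¹) b e
      = ((ricM G x * (G x)⁻¹) * conn G d x) b d := by
    rw [Matrix.mul_apply]
    simp only [conn, Matrix.of_apply]
    exact Finset.sum_congr rfl fun c _ => mul_comm _ _
  have e7 : pdM d (ricM G) x * (G x)⁻¹
      + ricM G x * -((G x)⁻¹ * conn G d x + (conn G d x).transpose * (G x)⁻¹)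
      - (conn G d x * (ricM G x * (G x)⁻¹) - (ricM G x * (G x)⁻¹) * conn G d x)
      = (pdM d (ricM G) x - conn G d x * ricM G x - ricM G x * (conn G d x).transpose)
        * (G x)⁻¹ := by
    noncomm_ring
  rw [e5, e6, ← e7]
  rfl

/-- In dimension four the divergence of the Weyl tensor is half the Cotton tensor. The divergence of
the Riemann tensor gives the antisymmetrised derivative of the Ricci tensor, and the correction
terms halve it and add gradients of the scalar curvature. -/
lemma covDiv_weyl (a b c : Fin 4) : covDiv G (weyl G) a b c x =
    (1 / 2) * (cov2 G (ricci G) b a c x - cov2 G (ricci G) a b c x)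
      - (1 / 12) * (G x a c * pd b (scalarCurv G) x - G x b c * pd a (scalarCurv G) x) := by
  have hs := h.hs hx
  -- `F` collects the coefficient of δ_b^d in the Weyl tensor; that of δ_a^d is its negative. `V` is
  -- the Ricci tensor with its last index raised, which multiplies the metric.
  set F : Fin 4 → Fin 4 → Coord → ℝ := fun b c y =>
    (fun _ => (-1 / 2 : ℝ)) y * ricci G b c y + (fun y => (1 / 6) * scalarCurv G y) y * G y b c
  set V : Fin 4 → Fin 4 → Coord → ℝ := fun b d y => ∑ e, ginv G y d e * ricci G b e y
  have hV : ∀ a b, SmAt (V a b) x := fun a b =>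
    SmAt.sum fun e _ => (h.sm_ginv hx b e).mul (h.sm_ricci hx a e)
  have hR : SmAt (fun y => (1 / 6) * scalarCurv G y) x := (SmAt.const _).mul (h.sm_scalarCurv hx)
  have hF : ∀ a b, SmAt (F a b) x := fun a b =>
    ((SmAt.const _).mul (h.sm_ricci hx a b)).add (hR.mul (h.sm x hx a b))
  have hW : ∀ a b c d, weyl G a b c d =ᶠ[𝓝[HS] x] fun y =>
      ((riemann G a b c d y + (if b = d then F a c y else 0)) + (-1) * (if a = d then F b c y else 0))
        + ((-1 / 2) * (G y a c * V b d y) + (1 / 2) * (G y b c * V a d y)) := by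
    intro a b c d
    refine h.eventually hx fun y hy => ?_
    rw [h.weyl_eq hy]
    simp only [F, V]
    split_ifs <;> ring
  have d1 : ∀ a b c d, DAt (riemann G a b c d) x := fun a b c d => (h.sm_riemann hx a b c d).dAt
  have d2 : ∀ a b c d : Fin 4, DAt (fun y => if b = d then F a c y else 0) x := by
    intro a b c d; split_ifs
    · exact (hF a c).dAt
    · exact differentiableWithinAt_const _
  have d3 : ∀ a b c d : Fin 4, DAt (fun y => if a = d then F b c y else 0) x :=
    fun a b c d => d2 b a c d
  have d4 : ∀ a b c d : Fin 4, DAt (fun y => G y a c * V b d y) x :=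
    fun a b c d => ((h.sm x hx a c).mul (hV b d)).dAt
  have dc : ∀ {f : Coord → ℝ} (k : ℝ), DAt f x → DAt (fun y => k * f y) x :=
    fun k hf => hf.const_mul k
  rw [covDiv_congr hs hW, covDiv_add (W := fun a b c d y => (riemann G a b c d y
      + (if b = d then F a c y else 0)) + (-1) * (if a = d then F b c y else 0))
    (W' := fun a b c d y => (-1 / 2) * (G y a c * V b d y) + (1 / 2) * (G y b c * V a d y)) hs
    (fun a b c d => ((d1 a b c d).add (d2 a b c d)).add (dc _ (d3 a b c d)))
    (fun a b c d => (dc _ (d4 a b c d)).add (dc _ (d4 b a c d))),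
    covDiv_add (W := fun a b c d y => riemann G a b c d y + (if b = d then F a c y else 0))
      (W' := fun a b c d y => (-1) * (if a = d then F b c y else 0)) hs
      (fun a b c d => (d1 a b c d).add (d2 a b c d)) (fun a b c d => dc _ (d3 a b c d)),
    covDiv_add hs d1 d2, covDiv_add (W := fun a b c d y => (-1 / 2) * (G y a c * V b d y))
      (W' := fun a b c d y => (1 / 2) * (G y b c * V a d y)) hs (fun a b c d => dc _ (d4 a b c d))
      (fun a b c d => dc _ (d4 b a c d)),
    covDiv_smul hs (differentiableWithinAt_const _) d3,
    covDiv_smul hs (differentiableWithinAt_const _) d4,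
    covDiv_smul hs (differentiableWithinAt_const _) (fun a b c d => d4 b a c d),
    covDiv_delta_left hs, covDiv_delta_right hs, h.covDiv_metric_left hx (fun a b => (hV a b).dAt),
    h.covDiv_metric_right hx (fun a b => (hV a b).dAt), h.div_ricci_raised hx,
    h.div_ricci_raised hx, h.covDiv_riemann_eq hx]
  have cF : ∀ a b c, cov2 G F a b c x = (-1 / 2) * cov2 G (ricci G) a b c x
      + (1 / 6) * pd a (scalarCurv G) x * G x b c := by
    intro a b c
    rw [cov2_add hs (fun a b => dc _ (h.sm_ricci hx a b).dAt)
      (fun a b => (hR.mul (h.sm x hx a b)).dAt),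
      cov2_smul hs (differentiableWithinAt_const _) (fun a b => (h.sm_ricci hx a b).dAt),
      cov2_smul hs hR.dAt (fun a b => (h.sm x hx a b).dAt), h.cov2_metric hx,
      pd_const hs, pd_const_mul hs a _ (h.sm_scalarCurv hx).dAt]
    ring
  simp only [cF, pd_const hs]
  simp
  ring

lemma weyl_lower (a b c d : Fin 4) :
    ∑ e, weyl G a b c e x * G x e d = weylLow G a b c d x := by
  simp only [weyl, Finset.sum_mul, mul_assoc]
  rw [Finset.sum_comm]
  simp only [← Finset.mul_sum, h.sum_ginv_mul hx]
  simp

omit h hx in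
lemma weylLow_antisymm_left (a b c d : Fin 4) : weylLow G a b c d x = -weylLow G b a c d x := by
  simp only [weylLow, riemannLow_antisymm_left a b]; ring

lemma weylLow_antisymm_right (a b c d : Fin 4) :
    weylLow G a b c d x = -weylLow G a b d c x := by
  simp only [weylLow, h.riemannLow_antisymm_right hx a b c d]; ring

lemma weylLow_cyclic (a b c d : Fin 4) :
    weylLow G a b c d x + weylLow G b c a d x + weylLow G c a b d x = 0 := by
  have := h.riemannLow_cyclic hx a b c d
  simp only [weylLow, h.symm_apply hx b a, h.symm_apply hx c a, h.symm_apply hx c b,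
    h.ricci_symm hx b a, h.ricci_symm hx c a, h.ricci_symm hx c b]
  linarith

lemma weyl_trace (a c : Fin 4) : ∑ b, weyl G a b c b x = 0 := by
  have e1 : ∑ b, G x b c * ∑ e, ginv G x b e * ricci G a e x = ricci G a c x := by
    simp only [Finset.mul_sum]
    rw [Finset.sum_comm]
    have : ∀ e b, G x b c * (ginv G x b e * ricci G a e x)
        = (ginv G x e b * G x b c) * ricci G a e x := fun e b => by
      rw [h.ginv_symm hx b e]; ring
    simp only [this, ← Finset.sum_mul, h.sum_ginv_mul hx]
    simp
  have e2 : ∑ b, ∑ e, ginv G x b e * ricci G b e x = scalarCurv G x := rfl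
  simp only [h.weyl_eq hx, Finset.sum_add_distrib, Finset.sum_sub_distrib, ← Finset.mul_sum, e1, e2]
  simp only [if_true, Finset.sum_ite_eq, Finset.mem_univ, ite_mul, zero_mul, one_mul,
    Finset.sum_const, Finset.card_univ, Fintype.card_fin]
  rw [show ∑ b, riemann G a b c b x = ricci G a c x from rfl]
  simp
  ring

end MetricOn
end Scri

namespace Scri

/-! ### Conformal rescaling -/

/-- The rescaled metric `φ² g`. -/
def rescale (φ : Coord → ℝ) (G : MetricComp) : MetricComp := fun y => φ y ^ 2 • G y

/-- `u_a = ∂_a log φ`. -/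
noncomputable def dlog (φ : Coord → ℝ) (a : Fin 4) (x : Coord) : ℝ := (φ x)⁻¹ * pd a φ x

/-- `u^a`. -/
noncomputable def dlogUp (φ : Coord → ℝ) (G : MetricComp) (a : Fin 4) (x : Coord) : ℝ :=
  ∑ e, ginv G x a e * dlog φ e x

/-- `u_a u^a`. -/
noncomputable def dlogSq (φ : Coord → ℝ) (G : MetricComp) (x : Coord) : ℝ :=
  ∑ e, dlog φ e x * dlogUp φ G e x

/-- `X_{bc} = ∇_b u_c - u_b u_c + (1/2) u² g_{bc}`, which governs the change of the curvature. -/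
noncomputable def confX (φ : Coord → ℝ) (G : MetricComp) (b c : Fin 4) (x : Coord) : ℝ :=
  pd b (dlog φ c) x - ∑ e, christoffel G e b c x * dlog φ e x - dlog φ b x * dlog φ c x
    + (1 / 2) * dlogSq φ G x * G x b c

/-- `X_b{}^d`. -/
noncomputable def confXUp (φ : Coord → ℝ) (G : MetricComp) (b d : Fin 4) (x : Coord) : ℝ :=
  ∑ e, ginv G x d e * confX φ G b e x

/-- Kronecker delta. -/
abbrev kd (a b : Fin 4) : ℝ := if a = b then 1 else 0

/-- Change of the connection `δ^d_a u_c + δ^d_c u_a - g_{ac} u^d`. -/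
noncomputable def confK (φ : Coord → ℝ) (G : MetricComp) (d a c : Fin 4) (x : Coord) : ℝ :=
  kd d a * dlog φ c x + kd d c * dlog φ a x - G x a c * dlogUp φ G d x

namespace MetricOn

variable {U : Set Coord} {G : MetricComp} {x : Coord} (h : MetricOn U G) {φ : Coord → ℝ}
  (hφ : ∀ y ∈ U, SmAt φ y) (h0 : ∀ y ∈ U, φ y ≠ 0) (hx : x ∈ U)
include h hφ h0

lemma rescale : MetricOn U (rescale φ G) where
  toRelOpen := h.toRelOpen
  sm x hx a b := by
    simp only [Scri.rescale, Matrix.smul_apply, smul_eq_mul]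
    exact ((hφ x hx).pow 2).mul (h.sm x hx a b)
  symm x hx := by simp [Scri.rescale, h.symm x hx]
  det x hx := by
    simp only [Scri.rescale, Matrix.det_smul]
    exact mul_ne_zero (pow_ne_zero _ (pow_ne_zero _ (h0 x hx))) (h.det x hx)

include hx

lemma ginv_rescale (a b : Fin 4) :
    ginv (Scri.rescale φ G) x a b = (φ x ^ 2)⁻¹ * ginv G x a b := by
  have hd := h.det x hx
  have : (Scri.rescale φ G x)⁻¹ = (φ x ^ 2)⁻¹ • (G x)⁻¹ := by
    refine Matrix.inv_eq_left_inv ?_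
    simp only [Scri.rescale, Matrix.smul_mul, Matrix.mul_smul, h.inv_mul hx, smul_smul]
    rw [mul_inv_cancel₀ (pow_ne_zero _ (h0 x hx)), one_smul]
  rw [ginv, this]; rfl

lemma sm_dlog (a : Fin 4) : SmAt (dlog φ a) x :=
  ((hφ x hx).inv (h0 x hx)).mul ((hφ x hx).pd (h.hs hx) a)

lemma sm_dlogUp (a : Fin 4) : SmAt (dlogUp φ G a) x :=
  SmAt.sum fun e _ => (h.sm_ginv hx a e).mul (h.sm_dlog hφ h0 hx e)

lemma pd_dlog_symm (a b : Fin 4) : pd a (dlog φ b) x = pd b (dlog φ a) x := by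
  have hs := h.hs hx
  have e : ∀ a b, pd a (dlog φ b) x
      = -pd a φ x * ((φ x)⁻¹) ^ 2 * pd b φ x + (φ x)⁻¹ * pd a (pd b φ) x := by
    intro a b
    unfold dlog
    rw [pd_mul hs a ((hφ x hx).inv (h0 x hx)).dAt ((hφ x hx).pd hs b).dAt,
      pd_inv hs a (hφ x hx).dAt (h0 x hx)]
  rw [e, e, pd_comm hs (hφ x hx) a b]; ring

omit hφ h0 in
lemma sum_metric_dlogUp (a : Fin 4) : ∑ e, G x a e * dlogUp φ G e x = dlog φ a x := by
  simp only [dlogUp, Finset.mul_sum, ← mul_assoc]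
  rw [Finset.sum_comm]
  simp only [← Finset.sum_mul, h.sum_mul_ginv hx]
  simp

lemma christoffel_rescale (c a b : Fin 4) : christoffel (Scri.rescale φ G) c a b x =
    christoffel G c a b x + confK φ G c a b x := by
  have hs := h.hs hx
  have p : ∀ i l b, pd i (fun y => Scri.rescale φ G y l b) x =
      2 * φ x ^ 2 * dlog φ i x * G x l b + φ x ^ 2 * pd i (fun y => G y l b) x := by
    intro i l b
    simp only [Scri.rescale, Matrix.smul_apply, smul_eq_mul]
    rw [pd_mul hs i ((hφ x hx).pow 2).dAt (h.sm x hx l b).dAt, pd_pow hs i 2 (hφ x hx).dAt, dlog]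
    have := h0 x hx
    field_simp
    simp
    ring
  have e : ∀ l, ginv (Scri.rescale φ G) x c l * (pd a (fun y => Scri.rescale φ G y l b) x
      + pd b (fun y => Scri.rescale φ G y l a) x - pd l (fun y => Scri.rescale φ G y a b) x)
      = ginv G x c l * (pd a (fun y => G y l b) x + pd b (fun y => G y l a) x
      - pd l (fun y => G y a b) x) + 2 * (dlog φ a x * (ginv G x c l * G x l b)
      + dlog φ b x * (ginv G x c l * G x l a) - G x a b * (ginv G x c l * dlog φ l x)) := by
    intro l
    rw [h.ginv_rescale hφ h0 hx, p, p, p]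
    have := h0 x hx
    field_simp
    ring
  simp only [christoffel, e, Finset.sum_add_distrib, Finset.sum_sub_distrib, ← Finset.mul_sum,
    h.sum_ginv_mul hx, confK, dlogUp]
  ring

/-- Raising an index commutes with covariant differentiation. -/
lemma pd_dlogUp (b d : Fin 4) : pd b (dlogUp φ G d) x + ∑ e, christoffel G d b e x * dlogUp φ G e x
    = ∑ e, ginv G x d e * (pd b (dlog φ e) x - ∑ k, christoffel G k b e x * dlog φ k x) := by
  have hs := h.hs hx
  have e1 : ∀ e, pd b (fun y => ginv G y d e) x = -∑ k, (ginv G x d k * christoffel G e b k x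
      + christoffel G d b k x * ginv G x k e) := by
    intro e
    have := congrFun (congrFun (h.pdM_metricInv hx b) d) e
    rw [Finset.sum_add_distrib]
    simpa [pdM, conn, Matrix.mul_apply, ginv] using this
  have e2 : pd b (dlogUp φ G d) x = ∑ e, (pd b (fun y => ginv G y d e) x * dlog φ e x
      + ginv G x d e * pd b (dlog φ e) x) := by
    unfold dlogUp
    rw [pd_sum hs b fun e _ => ((h.sm_ginv hx d e).mul (h.sm_dlog hφ h0 hx e)).dAt]
    exact Finset.sum_congr rfl fun e _ =>
      pd_mul hs b (h.sm_ginv hx d e).dAt (h.sm_dlog hφ h0 hx e).dAt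
  rw [e2]
  simp only [e1, dlogUp, Finset.sum_add_distrib, neg_mul, Finset.sum_neg_distrib, add_mul,
    Finset.sum_mul, mul_sub, Finset.sum_sub_distrib, Finset.mul_sum]
  rw [Finset.sum_comm (f := fun e k => ginv G x d k * christoffel G e b k x * dlog φ e x),
    Finset.sum_comm (f := fun e k => christoffel G d b k x * ginv G x k e * dlog φ e x)]
  simp only [mul_assoc]
  ring

lemma confXUp_eq (b d : Fin 4) : confXUp φ G b d x = pd b (dlogUp φ G d) x
    + ∑ e, christoffel G d b e x * dlogUp φ G e x - dlog φ b x * dlogUp φ G d x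
    + (1 / 2) * dlogSq φ G x * kd d b := by
  rw [h.pd_dlogUp hφ h0 hx]
  have e : ∀ e, ginv G x d e * confX φ G b e x = ginv G x d e * (pd b (dlog φ e) x
      - ∑ k, christoffel G k b e x * dlog φ k x) - dlog φ b x * (ginv G x d e * dlog φ e x)
      + (1 / 2) * dlogSq φ G x * (ginv G x d e * G x e b) := by
    intro e; rw [confX, h.symm_apply hx b e]; ring
  simp only [confXUp, e, Finset.sum_add_distrib, Finset.sum_sub_distrib, ← Finset.mul_sum,
    h.sum_ginv_mul hx, dlogUp]

/-- The connection changes by the tensor `confK`. The terms linear in it assemble into ∇u and the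
quadratic ones into u ⊗ u and u² g, the ingredients of `confX`. -/
lemma riemann_rescale (a b c d : Fin 4) : riemann (Scri.rescale φ G) a b c d x =
    riemann G a b c d x + kd d a * confX φ G b c x - kd d b * confX φ G a c x
      - G x a c * confXUp φ G b d x + G x b c * confXUp φ G a d x := by
  have hs := h.hs hx
  have su := fun a => h.sm_dlog hφ h0 hx a
  have sv := fun a => h.sm_dlogUp hφ h0 hx a
  have sK : ∀ d a c, SmAt (confK φ G d a c) x := fun d a c =>
    (((SmAt.const _).mul (su c)).add ((SmAt.const _).mul (su a))).sub ((h.sm x hx a c).mul (sv d))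
  have dK : ∀ i d a c, pd i (christoffel (Scri.rescale φ G) d a c) x =
      pd i (christoffel G d a c) x + (kd d a * pd i (dlog φ c) x + kd d c * pd i (dlog φ a) x
      - (pd i (fun y => G y a c) x * dlogUp φ G d x + G x a c * pd i (dlogUp φ G d) x)) := by
    intro i d a c
    rw [pd_congr hs (h.eventually hx fun y hy => h.christoffel_rescale hφ h0 hy d a c),
      pd_add hs i (h.sm_christoffel hx d a c).dAt (sK d a c).dAt]
    unfold confK
    rw [pd_sub hs i (((SmAt.const _).mul (su c)).add ((SmAt.const _).mul (su a))).dAt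
      ((h.sm x hx a c).mul (sv d)).dAt, pd_add hs i ((SmAt.const _).mul (su c)).dAt
      ((SmAt.const _).mul (su a)).dAt, pd_const_mul hs i _ (su c).dAt,
      pd_const_mul hs i _ (su a).dAt, pd_mul hs i (h.sm x hx a c).dAt (sv d).dAt]
  -- Christoffel symbols with the upper index lowered. Each derivative of the metric is a sum of two
  -- of them, and after antisymmetrisation these cancel the ones produced in `S1`.
  set L : Fin 4 → Fin 4 → Fin 4 → ℝ := fun a b c => ∑ e, G x a e * christoffel G e b c x with hL
  have Ls : ∀ a b c, L a b c = L a c b := fun a b c =>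
    Finset.sum_congr rfl fun e _ => by rw [h.christoffel_symm hx e b c]
  have dG : ∀ i a c, pd i (fun y => G y a c) x = L c i a + L a i c := by
    intro i a c
    rw [h.pd_metric hx, Finset.sum_add_distrib]
    congr 1 <;> refine Finset.sum_congr rfl fun e _ => ?_
    · rw [h.symm_apply hx c e]; ring
    · ring
  have k1 : ∀ (f : Fin 4 → ℝ) a, ∑ e, kd e a * f e = f a := by intro f a; simp
  have k2 : ∀ (f : Fin 4 → ℝ) a, ∑ e, kd a e * f e = f a := by intro f a; simp
  -- `S1`, `S2` and `S3` are the products Γ·K, K·Γ and K·K in the quadratic part of the new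
  -- curvature.
  have S1 : ∀ a b, ∑ e, christoffel G e a c x * confK φ G d b e x =
      kd d b * (∑ e, christoffel G e a c x * dlog φ e x) + christoffel G d a c x * dlog φ b x
        - L b a c * dlogUp φ G d x := by
    intro a b
    have : ∀ e, christoffel G e a c x * confK φ G d b e x = kd d b * (christoffel G e a c x
      * dlog φ e x) + dlog φ b x * (kd d e * christoffel G e a c x)
      - (G x b e * christoffel G e a c x) * dlogUp φ G d x := fun e => by rw [confK]; ring
    simp only [this, Finset.sum_add_distrib, Finset.sum_sub_distrib, ← Finset.mul_sum, k2,
      ← Finset.sum_mul, hL]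
    ring
  have S2 : ∀ a b, ∑ e, confK φ G e a c x * christoffel G d b e x = dlog φ c x *
      christoffel G d b a x + dlog φ a x * christoffel G d b c x
      - G x a c * ∑ e, christoffel G d b e x * dlogUp φ G e x := by
    intro a b
    have : ∀ e, confK φ G e a c x * christoffel G d b e x = dlog φ c x * (kd e a *
      christoffel G d b e x) + dlog φ a x * (kd e c * christoffel G d b e x)
      - G x a c * (christoffel G d b e x * dlogUp φ G e x) := fun e => by rw [confK]; ring
    simp only [this, Finset.sum_add_distrib, Finset.sum_sub_distrib, ← Finset.mul_sum, k1]
  have S3 : ∀ a b, ∑ e, confK φ G e a c x * confK φ G d b e x =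
      kd d b * (2 * dlog φ a x * dlog φ c x - G x a c * dlogSq φ G x)
      + dlog φ b x * (kd d a * dlog φ c x + kd d c * dlog φ a x - G x a c * dlogUp φ G d x)
      - dlogUp φ G d x * (G x b a * dlog φ c x + G x b c * dlog φ a x
        - G x a c * dlog φ b x) := by
    intro a b
    have : ∀ e, confK φ G e a c x * confK φ G d b e x =
      kd d b * (dlog φ c x * (kd e a * dlog φ e x) + dlog φ a x * (kd e c * dlog φ e x)
        - G x a c * (dlog φ e x * dlogUp φ G e x))
      + dlog φ b x * (dlog φ c x * (kd e a * kd d e) + dlog φ a x * (kd e c * kd d e)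
        - G x a c * (kd d e * dlogUp φ G e x))
      - dlogUp φ G d x * (dlog φ c x * (kd e a * G x b e) + dlog φ a x * (kd e c * G x b e)
        - G x a c * (G x b e * dlogUp φ G e x)) := fun e => by simp only [confK]; ring
    simp only [this, Finset.sum_add_distrib, Finset.sum_sub_distrib, ← Finset.mul_sum, k1, k2,
      h.sum_metric_dlogUp hx, dlogSq]
    ring
  have S : ∀ a b, ∑ e, christoffel (Scri.rescale φ G) e a c x
      * christoffel (Scri.rescale φ G) d b e x =
      (∑ e, christoffel G e a c x * christoffel G d b e x)
      + (∑ e, christoffel G e a c x * confK φ G d b e x)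
      + (∑ e, confK φ G e a c x * christoffel G d b e x)
      + ∑ e, confK φ G e a c x * confK φ G d b e x := by
    intro a b
    simp only [← Finset.sum_add_distrib, h.christoffel_rescale hφ h0 hx]
    exact Finset.sum_congr rfl fun e _ => by ring
  simp only [riemann, Finset.sum_sub_distrib, S, S1, S2, S3, dK, dG, h.confXUp_eq hφ h0 hx, confX]
  rw [h.pd_dlog_symm hφ h0 hx a b, h.christoffel_symm hx d b a, h.symm_apply hx b a, Ls c a b]
  ring

lemma ricci_rescale (a c : Fin 4) : ricci (Scri.rescale φ G) a c x =
    ricci G a c x - 2 * confX φ G a c x - G x a c * ∑ b, confXUp φ G b b x := by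
  have e1 : ∑ b, G x b c * confXUp φ G a b x = confX φ G a c x := by
    simp only [confXUp, Finset.mul_sum, ← mul_assoc]
    rw [Finset.sum_comm]
    have : ∀ e b, G x b c * ginv G x b e = G x c b * ginv G x b e := fun e b => by
      rw [h.symm_apply hx b c]
    simp only [this, ← Finset.sum_mul, h.sum_mul_ginv hx]
    simp
  simp only [ricci, h.riemann_rescale hφ h0 hx, Finset.sum_add_distrib, Finset.sum_sub_distrib,
    ← Finset.mul_sum, e1]
  simp
  ring

lemma scalarCurv_rescale : scalarCurv (Scri.rescale φ G) x =
    (φ x ^ 2)⁻¹ * (scalarCurv G x - 6 * ∑ b, confXUp φ G b b x) := by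
  have e1 : ∑ a, ∑ c, ginv G x a c * G x a c = 4 := by
    have : ∀ a c, ginv G x a c * G x a c = ginv G x a c * G x c a := fun a c => by
      rw [h.symm_apply hx a c]
    rw [Finset.sum_congr rfl fun a _ => Finset.sum_congr rfl fun c _ => this a c]
    simp only [h.sum_ginv_mul hx]
    simp
  have e2 : ∑ a, ∑ c, ginv G x a c * confX φ G a c x = ∑ b, confXUp φ G b b x := rfl
  have e3 : ∀ a c, ginv (Scri.rescale φ G) x a c * ricci (Scri.rescale φ G) a c x =
      (φ x ^ 2)⁻¹ * (ginv G x a c * ricci G a c x - 2 * (ginv G x a c * confX φ G a c x)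
        - (∑ b, confXUp φ G b b x) * (ginv G x a c * G x a c)) := fun a c => by
    rw [h.ginv_rescale hφ h0 hx, h.ricci_rescale hφ h0 hx]; ring
  simp only [scalarCurv, e3, ← Finset.mul_sum, Finset.sum_sub_distrib, e1, e2]
  ring

/-- Conformal invariance of the Weyl tensor. -/
lemma weyl_rescale (a b c d : Fin 4) : weyl (Scri.rescale φ G) a b c d x = weyl G a b c d x := by
  have h0x := h0 x hx
  have e1 : ∀ b, ∑ e, ginv (Scri.rescale φ G) x d e * ricci (Scri.rescale φ G) b e x =
      (φ x ^ 2)⁻¹ * ((∑ e, ginv G x d e * ricci G b e x) - 2 * confXUp φ G b d x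
        - (∑ b, confXUp φ G b b x) * kd d b) := by
    intro b
    have : ∀ e, ginv (Scri.rescale φ G) x d e * ricci (Scri.rescale φ G) b e x =
      (φ x ^ 2)⁻¹ * (ginv G x d e * ricci G b e x - 2 * (ginv G x d e * confX φ G b e x)
        - (∑ b, confXUp φ G b b x) * (ginv G x d e * G x e b)) := fun e => by
      rw [h.ginv_rescale hφ h0 hx, h.ricci_rescale hφ h0 hx, h.symm_apply hx b e]; ring
    simp only [this, ← Finset.mul_sum, Finset.sum_sub_distrib, h.sum_ginv_mul hx, confXUp]
  have e2 : ∀ a c, Scri.rescale φ G x a c = φ x ^ 2 * G x a c := fun a c => rfl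
  rw [(h.rescale hφ h0).weyl_eq hx, h.weyl_eq hx, e1, e1, h.riemann_rescale hφ h0 hx,
    h.scalarCurv_rescale hφ h0 hx, h.ricci_rescale hφ h0 hx, h.ricci_rescale hφ h0 hx]
  simp only [e2, kd, eq_comm (a := d)]
  generalize hm : ∑ b, confXUp φ G b b x = tr
  split_ifs <;> field_simp <;> ring

end MetricOn
end Scri

namespace Scri

/-! ### Smooth division by a boundary defining function -/

section parametric

open MeasureTheory

variable {X : Type} [NormedAddCommGroup X] [NormedSpace ℝ X]

/-- Differentiation under the integral over a convex set that need not be open. The mean value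
inequality on a small convex piece bounds the remainder of the integrand by ε‖z - y‖, uniformly in
t. -/
lemma hasFDerivWithinAt_parametric_integral {E : Type} [NormedAddCommGroup E] [NormedSpace ℝ E]
    {B : Set X} (hB : Convex ℝ B) {f : ℝ → X → E} {f' : ℝ → X → X →L[ℝ] E}
    (hf : ContinuousOn (Function.uncurry f) (Icc 0 1 ×ˢ B))
    (hf' : ContinuousOn (Function.uncurry f') (Icc 0 1 ×ˢ B))
    (hd : ∀ t ∈ Icc (0 : ℝ) 1, ∀ y ∈ B, HasFDerivWithinAt (f t) (f' t y) B y)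
    {y : X} (hy : y ∈ B) :
    HasFDerivWithinAt (fun z => ∫ t in (0 : ℝ)..1, f t z) (∫ t in (0 : ℝ)..1, f' t y) B y := by
  have slice : ∀ {Z : Type} [NormedAddCommGroup Z] {F : ℝ → X → Z},
      ContinuousOn (Function.uncurry F) (Icc 0 1 ×ˢ B) → ∀ z ∈ B,
      IntervalIntegrable (fun t => F t z) volume 0 1 := by
    intro Z _ F hF z hz
    refine ContinuousOn.intervalIntegrable_of_Icc zero_le_one ?_
    exact hF.comp (f := fun t : ℝ => (t, z)) (by fun_prop) fun t ht => ⟨ht, hz⟩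
  rw [hasFDerivWithinAt_iff_isLittleO, isLittleO_iff]
  intro ε hε
  have hswap : ContinuousOn (Function.uncurry fun z t => f' t z) (B ×ˢ Icc 0 1) :=
    hf'.comp (f := fun p : X × ℝ => (p.2, p.1)) (by fun_prop) fun p hp => ⟨hp.2, hp.1⟩
  -- Compactness of [0, 1] makes the derivative at nearby points ε-close to the one at `y`
  -- simultaneously for all t.
  obtain ⟨v, hv, hvt⟩ := isCompact_Icc.mem_uniformity_of_prod hswap hy
    (Metric.dist_mem_uniformity hε)
  obtain ⟨r, hr, hrv⟩ := Metric.mem_nhdsWithin_iff.1 hv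
  filter_upwards [inter_mem_nhdsWithin B (Metric.ball_mem_nhds y hr)] with z hz
  have hC : Convex ℝ (B ∩ Metric.ball y r) := hB.inter (convex_ball y r)
  have hyB : y ∈ B ∩ Metric.ball y r := ⟨hy, Metric.mem_ball_self hr⟩
  have bound : ∀ t ∈ uIoc (0 : ℝ) 1, ‖f t z - f t y - f' t y (z - y)‖ ≤ ε * ‖z - y‖ := by
    intro t ht
    rw [uIoc_of_le zero_le_one] at ht
    have ht' : t ∈ Icc (0 : ℝ) 1 := ⟨ht.1.le, ht.2⟩
    refine hC.norm_image_sub_le_of_norm_hasFDerivWithin_le'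
      (fun w hw => (hd t ht' w hw.1).mono inter_subset_left) (fun w hw => ?_) hyB hz
    have := hvt w (hrv ⟨hw.2, hw.1⟩) t ht'
    rw [mem_ofPred_eq, dist_eq_norm] at this
    exact this.le
  have key := intervalIntegral.norm_integral_le_of_norm_le_const bound
  have i1 := slice hf z hz.1
  have i2 := slice hf y hy
  have i3 := slice hf' y hy
  have i4 := slice (F := fun t w => f' t w (z - y)) (hf'.clm_apply continuousOn_const) y hy
  rw [intervalIntegral.integral_sub (i1.sub i2)
    i4,
    intervalIntegral.integral_sub i1 i2, ← ContinuousLinearMap.intervalIntegral_apply i3] at key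
  simpa using key

/-- Induction on the order. The target space has to vary, because the derivative is again a
parametric integral, with values in X →L[ℝ] E. -/
lemma contDiffOn_parametric_integral {B : Set X} (hB : Convex ℝ B) (hu : UniqueDiffOn ℝ B) (n : ℕ) :
    ∀ {E : Type} [NormedAddCommGroup E] [NormedSpace ℝ E] {f : ℝ × X → E},
      ContDiffOn ℝ ∞ f (Icc 0 1 ×ˢ B) →
      ContDiffOn ℝ n (fun y => ∫ t in (0 : ℝ)..1, f (t, y)) B := by
  have hU : UniqueDiffOn ℝ (Icc (0 : ℝ) 1 ×ˢ B) := (uniqueDiffOn_Icc zero_lt_one).prod hu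
  have main : ∀ {E : Type} [NormedAddCommGroup E] [NormedSpace ℝ E] {f : ℝ × X → E},
      ContDiffOn ℝ ∞ f (Icc 0 1 ×ˢ B) → ∃ f' : ℝ × X → X →L[ℝ] E,
      ContDiffOn ℝ ∞ f' (Icc 0 1 ×ˢ B) ∧ ∀ y ∈ B, HasFDerivWithinAt
        (fun z => ∫ t in (0 : ℝ)..1, f (t, z)) (∫ t in (0 : ℝ)..1, f' (t, y)) B y := by
    intro E _ _ f hf
    have hf1 : ContDiffOn ℝ ∞ (fun p => (fderivWithin ℝ f (Icc (0 : ℝ) 1 ×ˢ B) p).comp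
        (ContinuousLinearMap.inr ℝ ℝ X)) (Icc (0 : ℝ) 1 ×ˢ B) :=
      (hf.fderivWithin hU (by simp)).clm_comp contDiffOn_const
    refine ⟨_, hf1, fun y hy => ?_⟩
    refine hasFDerivWithinAt_parametric_integral (f := fun t z => f (t, z))
      (f' := fun t z => (fderivWithin ℝ f (Icc (0 : ℝ) 1 ×ˢ B) (t, z)).comp
        (ContinuousLinearMap.inr ℝ ℝ X)) hB hf.continuousOn hf1.continuousOn ?_ hy
    intro t ht z hz
    have h1 := ((hf.differentiableOn (by simp)) (t, z) ⟨ht, hz⟩).hasFDerivWithinAt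
    exact h1.comp z (hasFDerivAt_prodMk_right t z).hasFDerivWithinAt fun w hw => ⟨ht, hw⟩
  induction n with
  | zero =>
    intro E _ _ f hf
    obtain ⟨f', -, h⟩ := main hf
    rw [Nat.cast_zero, contDiffOn_zero]
    exact fun y hy => (h y hy).continuousWithinAt
  | succ n ih =>
    intro E _ _ f hf
    obtain ⟨f', hf', h⟩ := main hf
    rw [Nat.cast_succ]
    refine contDiffOn_succ_of_fderivWithin (fun y hy => (h y hy).differentiableWithinAt)
      (by simp) ((ih hf').congr fun y hy => (h y hy).fderivWithin (hu y hy))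

end parametric

/-- Hadamard's lemma on a half-ball. -/
lemma exists_eq_coord_mul {x : Coord} (hx : x 0 = 0) {r : ℝ} {F : Coord → ℝ}
    (hF : ContDiffOn ℝ ∞ F (Metric.ball x r ∩ HS))
    (h0 : ∀ y ∈ Metric.ball x r, y 0 = 0 → F y = 0) :
    ∃ H : Coord → ℝ, ContDiffOn ℝ ∞ H (Metric.ball x r ∩ HS) ∧
      ∀ y ∈ Metric.ball x r ∩ HS, F y = y 0 * H y := by
  set B := Metric.ball x r ∩ HS with hBdef
  have hB : Convex ℝ B := (convex_ball x r).inter convex_HS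
  have hu : UniqueDiffOn ℝ B := by
    rw [hBdef, inter_comm]; exact uniqueDiffOn_HS.inter Metric.isOpen_ball
  set e0 : Coord := EuclideanSpace.single 0 1 with he0
  -- `A (t, y)` multiplies the zeroth coordinate by t and keeps the others. The quotient is the
  -- integral over t of ∂₀F along this segment, by the fundamental theorem of calculus.
  set A : ℝ × Coord → Coord := fun p => p.2 + ((p.1 - 1) * p.2 0) • e0 with hA
  have hAs : ContDiff ℝ ∞ A := by
    have : ContDiff ℝ ∞ fun p : ℝ × Coord => p.2 0 :=
      (EuclideanSpace.proj (𝕜 := ℝ) (0 : Fin 4)).contDiff.comp contDiff_snd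
    exact contDiff_snd.add (((contDiff_fst.sub contDiff_const).mul this).smul contDiff_const)
  have hA0 : ∀ p, A p 0 = p.1 * p.2 0 := by
    intro p; simp [hA, he0]; ring
  have hAi : ∀ p, ∀ i, i ≠ 0 → A p i = p.2 i := by
    intro p i hi; simp [hA, he0, hi]
  -- Since `x 0 = 0`, shrinking the zeroth coordinate does not increase the distance to `x`, so the
  -- segment stays in the half-ball.
  have hAB : MapsTo A (Icc 0 1 ×ˢ B) B := by
    rintro ⟨t, y⟩ ⟨ht, hy⟩
    have hy0 : 0 ≤ y 0 := mem_HS.1 hy.2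
    refine ⟨?_, mem_HS.2 (by rw [hA0]; exact mul_nonneg ht.1 hy0)⟩
    have hd := hy.1
    rw [Metric.mem_ball, EuclideanSpace.dist_eq] at hd ⊢
    refine lt_of_le_of_lt (Real.sqrt_le_sqrt (Finset.sum_le_sum fun i _ => ?_)) hd
    refine pow_le_pow_left₀ dist_nonneg ?_ 2
    by_cases hi : i = 0
    · subst hi
      rw [hA0, hx, Real.dist_eq, Real.dist_eq, sub_zero, sub_zero, abs_mul]
      exact mul_le_of_le_one_left (abs_nonneg _) (abs_le.2 ⟨by linarith [ht.1], ht.2⟩)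
    · rw [hAi _ i hi]
  have hdF : ContDiffOn ℝ ∞ (fun y => fderivWithin ℝ F B y e0) B :=
    (hF.fderivWithin hu (by simp)).clm_apply contDiffOn_const
  have hcomp : ContDiffOn ℝ ∞ (fun p => fderivWithin ℝ F B (A p) e0) (Icc 0 1 ×ˢ B) :=
    hdF.comp hAs.contDiffOn hAB
  refine ⟨fun y => ∫ t in (0 : ℝ)..1, fderivWithin ℝ F B (A (t, y)) e0,
    contDiffOn_infty.2 fun n => contDiffOn_parametric_integral hB hu n hcomp, fun y hy => ?_⟩
  have hmaps : MapsTo (fun t : ℝ => A (t, y)) (Icc 0 1) B := fun t ht => hAB ⟨ht, hy⟩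
  have hAc : ∀ t : ℝ, HasDerivAt (fun t : ℝ => A (t, y)) (y 0 • e0) t := by
    intro t
    have := ((((hasDerivAt_id t).sub_const 1).mul_const (y 0)).smul_const e0).const_add y
    simpa [hA] using this
  have hderiv : ∀ t ∈ Icc (0 : ℝ) 1, HasDerivWithinAt (fun t : ℝ => F (A (t, y)))
      (y 0 * fderivWithin ℝ F B (A (t, y)) e0) (Icc 0 1) t := by
    intro t ht
    have h1 := ((hF.differentiableOn (by simp)) _ (hmaps ht)).hasFDerivWithinAt
    have h2 := h1.comp_hasDerivWithinAt t (hAc t).hasDerivWithinAt hmaps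
    exact h2.congr_deriv (by simp)
  have hint : IntervalIntegrable (fun t => y 0 * fderivWithin ℝ F B (A (t, y)) e0)
      MeasureTheory.volume 0 1 := by
    refine ContinuousOn.intervalIntegrable_of_Icc zero_le_one (continuousOn_const.mul ?_)
    exact hcomp.continuousOn.comp (f := fun t : ℝ => (t, y)) (by fun_prop) fun t ht => ⟨ht, hy⟩
  have ftc := intervalIntegral.integral_eq_sub_of_hasDerivAt_of_le zero_le_one
    (fun t ht => (hderiv t ht).continuousWithinAt)
    (fun t ht => (hderiv t ⟨ht.1.le, ht.2.le⟩).hasDerivAt (Icc_mem_nhds ht.1 ht.2)) hint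
  have hA1 : A (1, y) = y := by simp [hA]
  have hF0 : F (A (0, y)) = 0 := by
    refine h0 _ (hmaps ⟨le_rfl, zero_le_one⟩).1 ?_
    rw [hA0]; simp
  rw [hA1, hF0, sub_zero, intervalIntegral.integral_const_mul] at ftc
  exact ftc.symm

end Scri

namespace Scri

/-! ### Pointwise algebra of Weyl candidates -/

/-- Arrays with four indices, read as `w_{abc}{}^d`. -/
abbrev Arr : Type := Fin 4 → Fin 4 → Fin 4 → Fin 4 → ℝ

/-- The Hodge dual at a point with metric `A`. -/
noncomputable def hodgeAt (A : Mat) (w : Arr) : Arr := fun a b c d =>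
  (1 / 2) * ∑ e, ∑ f, ∑ p, ∑ q,
    (Real.sqrt |A.det| * altSymbol a b e f) * A⁻¹ e p * A⁻¹ f q * w p q c d

/-- The matrix `X^a Z^c w_{abc}{}^d` in the indices `b, d`. -/
def slotMat (w : Arr) (X Z : Fin 4 → ℝ) : Mat :=
  Matrix.of fun b d => ∑ a, ∑ c, X a * Z c * w a b c d

/-- The covector `v^m v^n v^r 𝒟_{emnr}`. -/
noncomputable def brCovector (A : Mat) (w : Arr) (v : Fin 4 → ℝ) (e : Fin 4) : ℝ :=
  (slotMat w (Pi.single e 1) v * slotMat w v v).trace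
    + (slotMat (hodgeAt A w) (Pi.single e 1) v * slotMat (hodgeAt A w) v v).trace

/-- Writing the Bel-Robinson contraction as traces of products of 4×4 matrices turns a change of
frame into multiplication by the frame and dual frame matrices, which cancel inside the trace. -/
lemma supermomentum_eq (G : MetricComp) (Ω : Coord → ℝ) (v : Coord → Fin 4 → ℝ) (x : Coord)
    (a : Fin 4) : supermomentum G Ω v x a = -∑ e, ginv G x a e *
      brCovector (G x) (fun a b c d => rescaledWeyl G Ω a b c d x) (v x) e := by
  have key : ∀ (w : Arr) (v : Fin 4 → ℝ) (e : Fin 4),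
      ∑ m, ∑ n, ∑ r, v m * v n * v r * ∑ p, ∑ q, w e p n q * w r q m p =
      (slotMat w (Pi.single e 1) v * slotMat w v v).trace := by
    intro w v e
    have h1 : ∀ p q, slotMat w (Pi.single e 1) v p q = ∑ n, v n * w e p n q := by
      intro p q
      simp [slotMat, Pi.single_apply]
    have h2 : ∀ q p, slotMat w v v q p = ∑ m, ∑ r, v r * v m * w r q m p := by
      intro q p
      simp only [slotMat, Matrix.of_apply]
      exact Finset.sum_comm
    simp only [Matrix.trace, Matrix.diag, Matrix.mul_apply, h1, h2, Finset.mul_sum, Finset.sum_mul]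
    have e1 : ∀ m n, ∑ r, ∑ p, ∑ q, v m * v n * v r * (w e p n q * w r q m p)
        = ∑ p, ∑ q, ∑ r, v m * v n * v r * (w e p n q * w r q m p) := by
      intro m n
      rw [Finset.sum_comm]
      exact Finset.sum_congr rfl fun p _ => Finset.sum_comm
    simp only [e1]
    have e2 : ∀ m, ∑ n, ∑ p, ∑ q, ∑ r, v m * v n * v r * (w e p n q * w r q m p)
        = ∑ p, ∑ q, ∑ r, ∑ n, v m * v n * v r * (w e p n q * w r q m p) := by
      intro m
      rw [Finset.sum_comm]
      refine Finset.sum_congr rfl fun p _ => ?_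
      rw [Finset.sum_comm]
      exact Finset.sum_congr rfl fun q _ => Finset.sum_comm
    simp only [e2]
    rw [Finset.sum_comm]
    refine Finset.sum_congr rfl fun p _ => ?_
    rw [Finset.sum_comm]
    refine Finset.sum_congr rfl fun q _ => Finset.sum_congr rfl fun m _ =>
      Finset.sum_congr rfl fun r _ => Finset.sum_congr rfl fun n _ => by ring
  rw [supermomentum]
  congr 1
  refine Finset.sum_congr rfl fun e _ => ?_
  rw [brCovector, ← key, ← key]
  simp only [← Finset.sum_add_distrib, Finset.mul_sum, ← mul_add]
  refine Finset.sum_congr rfl fun m _ => Finset.sum_congr rfl fun n _ =>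
    Finset.sum_congr rfl fun r _ => ?_
  rw [rescaledBR, belRobinson]
  simp only [Finset.mul_sum]
  refine Finset.sum_congr rfl fun p _ => Finset.sum_congr rfl fun q _ => ?_
  have : ∀ a b c d, hodgeAt (G x) (fun a b c d => rescaledWeyl G Ω a b c d x) a b c d
      = hodge G (rescaledWeyl G Ω) a b c d x := fun a b c d => rfl
  rw [this, this]
  ring

/-- Components with respect to the frame `L` with dual frame `M`. -/
def frameArr (L M : Mat) (w : Arr) : Arr := fun a b c d =>
  ∑ p, ∑ q, ∑ r, ∑ s, L p a * L q b * L r c * M d s * w p q r s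

lemma slotMat_frameArr (L M : Mat) (w : Arr) (X Z : Fin 4 → ℝ) :
    slotMat (frameArr L M w) X Z = L.transpose * slotMat w (L.mulVec X) (L.mulVec Z)
      * M.transpose := by
  ext b d
  simp only [slotMat, frameArr, Matrix.of_apply, Matrix.mul_apply, Matrix.transpose_apply,
    Matrix.mulVec, dotProduct, Finset.mul_sum, Finset.sum_mul]
  have e1 : ∀ a, ∑ c, ∑ p, ∑ q, ∑ r, ∑ s, X a * Z c * (L p a * L q b * L r c * M d s * w p q r s)
      = ∑ p, ∑ q, ∑ r, ∑ s, ∑ c, X a * Z c * (L p a * L q b * L r c * M d s * w p q r s) := by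
    intro a
    rw [Finset.sum_comm]; refine Finset.sum_congr rfl fun p _ => ?_
    rw [Finset.sum_comm]; refine Finset.sum_congr rfl fun q _ => ?_
    rw [Finset.sum_comm]; refine Finset.sum_congr rfl fun r _ => ?_
    exact Finset.sum_comm
  simp only [e1]
  rw [Finset.sum_comm]
  have e2 : ∀ p, ∑ a, ∑ q, ∑ r, ∑ s, ∑ c,
      X a * Z c * (L p a * L q b * L r c * M d s * w p q r s)
      = ∑ s, ∑ q, ∑ r, ∑ c, ∑ a, X a * Z c * (L p a * L q b * L r c * M d s * w p q r s) := by
    intro p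
    rw [Finset.sum_comm]
    have : ∀ q, ∑ a, ∑ r, ∑ s, ∑ c, X a * Z c * (L p a * L q b * L r c * M d s * w p q r s)
      = ∑ s, ∑ r, ∑ c, ∑ a, X a * Z c * (L p a * L q b * L r c * M d s * w p q r s) := by
      intro q
      rw [Finset.sum_comm]
      have : ∀ r, ∑ a, ∑ s, ∑ c, X a * Z c * (L p a * L q b * L r c * M d s * w p q r s)
        = ∑ s, ∑ c, ∑ a, X a * Z c * (L p a * L q b * L r c * M d s * w p q r s) := by
        intro r
        rw [Finset.sum_comm]
        exact Finset.sum_congr rfl fun s _ => Finset.sum_comm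
      simp only [this]
      exact Finset.sum_comm
    simp only [this]
    exact Finset.sum_comm
  simp only [e2]
  rw [Finset.sum_comm]
  refine Finset.sum_congr rfl fun s _ => ?_
  rw [Finset.sum_comm]
  refine Finset.sum_congr rfl fun q _ => Finset.sum_congr rfl fun p _ =>
    Finset.sum_congr rfl fun r _ => Finset.sum_congr rfl fun c _ =>
    Finset.sum_congr rfl fun a _ => by ring

lemma altSymbol_eq (p q e f : Fin 4) : altSymbol p q e f = ∑ σ : Equiv.Perm (Fin 4),
    (Equiv.Perm.sign σ : ℝ) * ((if p = σ 0 then 1 else 0) * (if q = σ 1 then 1 else 0)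
      * (if e = σ 2 then 1 else 0) * (if f = σ 3 then 1 else 0)) := by
  rw [altSymbol, ← Matrix.det_transpose, Matrix.det_apply']
  refine Finset.sum_congr rfl fun σ _ => ?_
  rw [Fin.prod_univ_four]
  rfl

/-- Both sides are determinants: the left one is the Leibniz expansion for the matrix whose rows are
the columns a, b, c, d of `L`. -/
lemma sum_altSymbol_mul (L : Mat) (a b c d : Fin 4) :
    ∑ p, ∑ q, ∑ e, ∑ f, altSymbol p q e f * (L p a * L q b * L e c * L f d)
      = L.det * altSymbol a b c d := by
  have h1 : ((Matrix.of fun i j : Fin 4 => if ![a, b, c, d] i = j then (1 : ℝ) else 0)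
      * L.transpose).det = L.det * altSymbol a b c d := by
    rw [Matrix.det_mul, Matrix.det_transpose, mul_comm]; rfl
  rw [← h1, ← Matrix.det_transpose, Matrix.det_apply']
  simp only [altSymbol_eq, Finset.sum_mul]
  have e1 : ∀ F : Fin 4 → Fin 4 → Fin 4 → Fin 4 → Equiv.Perm (Fin 4) → ℝ,
      ∑ p, ∑ q, ∑ e, ∑ f, ∑ σ, F p q e f σ = ∑ σ, ∑ p, ∑ q, ∑ e, ∑ f, F p q e f σ := by
    intro F
    rw [Finset.sum_comm (s := Finset.univ (α := Equiv.Perm (Fin 4)))]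
    refine Finset.sum_congr rfl fun p _ => ?_
    rw [Finset.sum_comm (s := Finset.univ (α := Equiv.Perm (Fin 4)))]
    refine Finset.sum_congr rfl fun q _ => ?_
    rw [Finset.sum_comm (s := Finset.univ (α := Equiv.Perm (Fin 4)))]
    refine Finset.sum_congr rfl fun e _ => ?_
    rw [Finset.sum_comm (s := Finset.univ (α := Equiv.Perm (Fin 4)))]
  rw [e1]
  refine Finset.sum_congr rfl fun σ _ => ?_
  rw [Fin.prod_univ_four]
  simp only [mul_ite, ite_mul, mul_one, mul_zero, zero_mul, Finset.sum_ite_eq',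
    Finset.mem_univ, if_true, Matrix.transpose_apply, Matrix.mul_apply, Matrix.of_apply, one_mul,
    Finset.sum_ite_eq]
  simp

end Scri

/-! ### Changes of frame: matrix actions on arrays, the Hodge dual, the Bel-Robinson covector -/

namespace Scri

/-- Matrix action on the first index. -/
def act1 (N : Mat) (w : Arr) : Arr := fun a b c d => ∑ p, N a p * w p b c d
/-- Matrix action on the second index. -/
def act2 (N : Mat) (w : Arr) : Arr := fun a b c d => ∑ p, N b p * w a p c d
/-- Matrix action on the third index. -/
def act3 (N : Mat) (w : Arr) : Arr := fun a b c d => ∑ p, N c p * w a b p d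
/-- Matrix action on the fourth index. -/
def act4 (N : Mat) (w : Arr) : Arr := fun a b c d => ∑ p, N d p * w a b c p

section act

variable (N N' : Mat) (w : Arr)

lemma sum_mul_assoc_aux (f : Fin 4 → ℝ) (a : Fin 4) :
    ∑ p, N a p * ∑ q, N' p q * f q = ∑ q, (N * N') a q * f q := by
  simp only [Matrix.mul_apply, Finset.mul_sum, Finset.sum_mul]
  rw [Finset.sum_comm]
  exact Finset.sum_congr rfl fun q _ => Finset.sum_congr rfl fun p _ => by ring

lemma act1_act1 : act1 N (act1 N' w) = act1 (N * N') w := by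
  funext a b c d; exact sum_mul_assoc_aux N N' (fun q => w q b c d) a

lemma act2_act2 : act2 N (act2 N' w) = act2 (N * N') w := by
  funext a b c d; exact sum_mul_assoc_aux N N' (fun q => w a q c d) b

lemma act4_act4 : act4 N (act4 N' w) = act4 (N * N') w := by
  funext a b c d; exact sum_mul_assoc_aux N N' (fun q => w a b c q) d

lemma sum_mul_comm_aux (f : Fin 4 → Fin 4 → ℝ) (a b : Fin 4) :
    ∑ p, N a p * ∑ q, N' b q * f p q = ∑ q, N' b q * ∑ p, N a p * f p q := by
  simp only [Finset.mul_sum]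
  rw [Finset.sum_comm]
  exact Finset.sum_congr rfl fun q _ => Finset.sum_congr rfl fun p _ => by ring

lemma act1_act2 : act1 N (act2 N' w) = act2 N' (act1 N w) := by
  funext a b c d; exact sum_mul_comm_aux N N' (fun p q => w p q c d) a b

lemma act1_act3 : act1 N (act3 N' w) = act3 N' (act1 N w) := by
  funext a b c d; exact sum_mul_comm_aux N N' (fun p q => w p b q d) a c

lemma act1_act4 : act1 N (act4 N' w) = act4 N' (act1 N w) := by
  funext a b c d; exact sum_mul_comm_aux N N' (fun p q => w p b c q) a d

lemma act2_act3 : act2 N (act3 N' w) = act3 N' (act2 N w) := by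
  funext a b c d; exact sum_mul_comm_aux N N' (fun p q => w a p q d) b c

lemma act2_act4 : act2 N (act4 N' w) = act4 N' (act2 N w) := by
  funext a b c d; exact sum_mul_comm_aux N N' (fun p q => w a p c q) b d

lemma act3_act4 : act3 N (act4 N' w) = act4 N' (act3 N w) := by
  funext a b c d; exact sum_mul_comm_aux N N' (fun p q => w a b p q) c d

lemma act1_one : act1 1 w = w := by funext a b c d; simp [act1, Matrix.one_apply]
lemma act2_one : act2 1 w = w := by funext a b c d; simp [act2, Matrix.one_apply]
lemma act4_one : act4 1 w = w := by funext a b c d; simp [act4, Matrix.one_apply]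

end act

lemma frameArr_eq (L M : Mat) (w : Arr) : frameArr L M w =
    act1 L.transpose (act2 L.transpose (act3 L.transpose (act4 M w))) := by
  funext a b c d
  simp only [frameArr, act1, act2, act3, act4, Matrix.transpose_apply, Finset.mul_sum, mul_assoc]

/-- Contraction of the first two indices with the alternating symbol. -/
noncomputable def altDual (w : Arr) : Arr := fun a b c d => ∑ e, ∑ f, altSymbol a b e f * w e f c d

lemma hodgeAt_eq (A : Mat) (w : Arr) : hodgeAt A w = fun a b c d =>
    (1 / 2 * Real.sqrt |A.det|) * altDual (act1 A⁻¹ (act2 A⁻¹ w)) a b c d := by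
  funext a b c d
  simp only [hodgeAt, altDual, act1, act2, Finset.mul_sum]
  exact Finset.sum_congr rfl fun e _ => Finset.sum_congr rfl fun f _ =>
    Finset.sum_congr rfl fun p _ => Finset.sum_congr rfl fun q _ => by ring

lemma act3_altDual (N : Mat) (w : Arr) : act3 N (altDual w) = altDual (act3 N w) := by
  funext a b c d
  simp only [act3, altDual, Finset.mul_sum]
  rw [Finset.sum_comm]
  refine Finset.sum_congr rfl fun e _ => ?_
  rw [Finset.sum_comm]
  exact Finset.sum_congr rfl fun f _ => Finset.sum_congr rfl fun p _ => by ring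

lemma act4_altDual (N : Mat) (w : Arr) : act4 N (altDual w) = altDual (act4 N w) := by
  funext a b c d
  simp only [act4, altDual, Finset.mul_sum]
  rw [Finset.sum_comm]
  refine Finset.sum_congr rfl fun e _ => ?_
  rw [Finset.sum_comm]
  exact Finset.sum_congr rfl fun f _ => Finset.sum_congr rfl fun p _ => by ring

/-- The alternating symbol is invariant up to the determinant: of its four copies of `L`, two act
outside the contraction and two inside it. -/
lemma act12_altDual (L : Mat) (w : Arr) :
    act1 L.transpose (act2 L.transpose (altDual (act1 L (act2 L w))))
      = fun a b c d => L.det * altDual w a b c d := by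
  funext a b c d
  simp only [act1, act2, altDual, Matrix.transpose_apply, Finset.mul_sum]
  have e0 : ∀ F : Fin 4 → Fin 4 → Fin 4 → Fin 4 → Fin 4 → Fin 4 → ℝ,
      ∑ p, ∑ q, ∑ e, ∑ f, ∑ g, ∑ k, F p q e f g k = ∑ g, ∑ k, ∑ p, ∑ q, ∑ e, ∑ f, F p q e f g k := by
    intro F
    have e1 : ∀ H : Fin 4 → Fin 4 → Fin 4 → Fin 4 → Fin 4 → ℝ,
        ∑ p, ∑ q, ∑ e, ∑ f, ∑ g, H p q e f g = ∑ g, ∑ p, ∑ q, ∑ e, ∑ f, H p q e f g := by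
      intro H
      rw [Finset.sum_comm]
      have : ∀ q, ∑ p, ∑ e, ∑ f, ∑ g, H p q e f g = ∑ g, ∑ p, ∑ e, ∑ f, H p q e f g := by
        intro q
        rw [Finset.sum_comm (s := Finset.univ) (t := Finset.univ)
          (f := fun g p => ∑ e, ∑ f, H p q e f g)]
        refine Finset.sum_congr rfl fun p _ => ?_
        rw [Finset.sum_comm (f := fun g e => ∑ f, H p q e f g)]
        exact Finset.sum_congr rfl fun e _ => Finset.sum_comm
      simp only [this]
      rw [Finset.sum_comm]
      exact Finset.sum_congr rfl fun g _ => Finset.sum_comm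
    rw [e1]
    refine Finset.sum_congr rfl fun g _ => ?_
    exact e1 fun p q e f k => F p q e f g k
  rw [e0]
  refine Finset.sum_congr rfl fun g _ => Finset.sum_congr rfl fun k _ => ?_
  rw [← mul_assoc, ← sum_altSymbol_mul L a b g k]
  simp only [Finset.sum_mul]
  exact Finset.sum_congr rfl fun p _ => Finset.sum_congr rfl fun q _ =>
      Finset.sum_congr rfl fun e _ => Finset.sum_congr rfl fun f _ => by ring

section frame

variable {L M : Mat} (hLM : L * M = 1)
include hLM

lemma inv_frame_metric (A : Mat) (hA : A.det ≠ 0) : (L.transpose * A * L)⁻¹ * L.transpose = M * A⁻¹ := by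
  have hML : M * L = 1 := mul_eq_one_comm.1 hLM
  have hT : M.transpose * L.transpose = 1 := by rw [← Matrix.transpose_mul, hLM, Matrix.transpose_one]
  have hT' : L.transpose * M.transpose = 1 := mul_eq_one_comm.1 hT
  have : (L.transpose * A * L)⁻¹ = M * A⁻¹ * M.transpose := by
    refine Matrix.inv_eq_left_inv ?_
    calc M * A⁻¹ * M.transpose * (L.transpose * A * L)
        = M * A⁻¹ * (M.transpose * L.transpose) * A * L := by noncomm_ring
      _ = M * (A⁻¹ * A) * L := by rw [hT]; noncomm_ring
      _ = 1 := by rw [Matrix.nonsing_inv_mul _ (isUnit_iff_ne_zero.2 hA), mul_one, hML]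
  rw [this, Matrix.mul_assoc, hT, Matrix.mul_one]

/-- The volume form changes by |det L| and the alternating symbol by det L, so the dual commutes
with the change of frame up to the sign of det L. The sign is immaterial afterwards because the dual
enters quadratically. -/
lemma frameArr_hodgeAt (A : Mat) (hA : A.det ≠ 0) (w : Arr) :
    ∃ s : ℝ, s * s = 1 ∧ hodgeAt (L.transpose * A * L) (frameArr L M w)
      = fun a b c d => s * frameArr L M (hodgeAt A w) a b c d := by
  have hdet : L.det ≠ 0 := by
    intro h0
    have := congrArg Matrix.det hLM
    rw [Matrix.det_mul, h0] at this
    simp at this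
  set R := act1 A⁻¹ (act2 A⁻¹ w) with hR
  set Q := act1 M (act2 M (act3 L.transpose (act4 M R))) with hQ
  have h1 : act1 (L.transpose * A * L)⁻¹ (act2 (L.transpose * A * L)⁻¹ (frameArr L M w)) = Q := by
    rw [frameArr_eq, ← act1_act2, act1_act1, act2_act2, inv_frame_metric hLM A hA, ← act1_act1,
      ← act2_act2, hQ, hR]
    simp only [act1_act2, act1_act3, act1_act4, act2_act3, act2_act4, act3_act4]
  have h2 : act1 L (act2 L Q) = act3 L.transpose (act4 M R) := by
    rw [hQ, ← act1_act2, act1_act1, act2_act2, hLM, act1_one, act2_one]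
  have h3 : frameArr L M (hodgeAt A w)
      = fun a b c d => (1 / 2 * Real.sqrt |A.det|) * (L.det * altDual Q a b c d) := by
    have lin : ∀ (k : ℝ) (u : Arr), frameArr L M (fun a b c d => k * u a b c d)
        = fun a b c d => k * frameArr L M u a b c d := by
      intro k u
      funext a b c d
      simp only [frameArr, Finset.mul_sum]
      exact Finset.sum_congr rfl fun e _ => Finset.sum_congr rfl fun f _ =>
        Finset.sum_congr rfl fun p _ => Finset.sum_congr rfl fun q _ => by ring
    rw [hodgeAt_eq, lin, frameArr_eq, act4_altDual, act3_altDual, ← hR, ← h2, act12_altDual]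
  refine ⟨|L.det| / L.det, ?_, ?_⟩
  · field_simp; exact sq_abs _
  · rw [hodgeAt_eq, h1, h3]
    funext a b c d
    have : |(L.transpose * A * L).det| = |A.det| * |L.det| ^ 2 := by
      rw [Matrix.det_mul, Matrix.det_mul, Matrix.det_transpose, abs_mul, abs_mul]; ring
    rw [this, Real.sqrt_mul (abs_nonneg _), Real.sqrt_sq (abs_nonneg _)]
    field_simp

lemma trace_slotMat_frame (w : Arr) (v : Fin 4 → ℝ) (e : Fin 4) :
    (slotMat (frameArr L M w) (Pi.single e 1) v * slotMat (frameArr L M w) v v).trace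
      = ∑ a, L a e * (slotMat w (Pi.single a 1) (L.mulVec v)
        * slotMat w (L.mulVec v) (L.mulVec v)).trace := by
  have hT : M.transpose * L.transpose = 1 := by rw [← Matrix.transpose_mul, hLM, Matrix.transpose_one]
  have lin : slotMat w (L.mulVec (Pi.single e 1)) (L.mulVec v)
      = ∑ a, L a e • slotMat w (Pi.single a 1) (L.mulVec v) := by
    ext b d
    simp [slotMat, Matrix.sum_apply, Pi.single_apply, Finset.mul_sum, mul_assoc]
  rw [slotMat_frameArr, slotMat_frameArr]
  set P := slotMat w (L.mulVec (Pi.single e 1)) (L.mulVec v) with hP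
  set Q := slotMat w (L.mulVec v) (L.mulVec v) with hQ
  have : L.transpose * P * M.transpose * (L.transpose * Q * M.transpose)
      = L.transpose * (P * (M.transpose * L.transpose) * Q * M.transpose) := by noncomm_ring
  rw [this, Matrix.trace_mul_comm, hT, Matrix.mul_one, Matrix.mul_assoc, hT, Matrix.mul_one, lin,
    Finset.sum_mul, Matrix.trace_sum]
  simp

/-- Frame covariance of the Bel-Robinson covector. -/
lemma brCovector_frame (A : Mat) (hA : A.det ≠ 0) (w : Arr) (v : Fin 4 → ℝ) (e : Fin 4) :
    brCovector (L.transpose * A * L) (frameArr L M w) v e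
      = ∑ a, L a e * brCovector A w (L.mulVec v) a := by
  obtain ⟨s, hs, h⟩ := frameArr_hodgeAt hLM A hA w
  have lin : ∀ (u : Arr) X Z, slotMat (fun a b c d => s * u a b c d) X Z = s • slotMat u X Z := by
    intro u X Z
    ext b d
    simp only [slotMat, Matrix.smul_apply, Matrix.of_apply, smul_eq_mul, Finset.mul_sum]
    exact Finset.sum_congr rfl fun e _ => Finset.sum_congr rfl fun f _ => by ring
  simp only [brCovector, h, lin, Matrix.smul_mul, Matrix.mul_smul, smul_smul, hs, one_smul,
    trace_slotMat_frame hLM, mul_add, Finset.sum_add_distrib]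

end frame

/-- The algebraic symmetries of a Weyl tensor `w_{abc}{}^d` with respect to the metric `A`. -/
structure WeylSym (A : Mat) (w : Arr) : Prop where
  anti_left : ∀ a b c d, w a b c d = -w b a c d
  anti_right : ∀ a b c d, ∑ e, w a b c e * A e d = -∑ e, w a b d e * A e c
  cyclic : ∀ a b c d, w a b c d + w b c a d + w c a b d = 0
  trace : ∀ a c, ∑ b, w a b c b = 0

lemma WeylSym.frame {L M A : Mat} (hLM : L * M = 1) {w : Arr} (h : WeylSym A w) :
    WeylSym (L.transpose * A * L) (frameArr L M w) where
  anti_left a b c d := by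
    simp only [frameArr]
    rw [Finset.sum_comm]
    simp only [← Finset.sum_neg_distrib]
    exact Finset.sum_congr rfl fun e _ => Finset.sum_congr rfl fun f _ =>
      Finset.sum_congr rfl fun p _ => Finset.sum_congr rfl fun q _ => by
        rw [h.anti_left f e]; ring
  anti_right a b c d := by
    have key : ∀ a b c d, ∑ e, frameArr L M w a b c e * (L.transpose * A * L) e d =
        ∑ p, ∑ q, ∑ r, ∑ s, L p a * L q b * L r c * L s d * ∑ e, w p q r e * A e s := by
      intro a b c d
      have h1 : ∑ e, frameArr L M w a b c e * (L.transpose * A * L) e d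
          = act4 (L.transpose * A * L).transpose (frameArr L M w) a b c d := by
        simp only [act4, Matrix.transpose_apply]
        exact Finset.sum_congr rfl fun e _ => mul_comm _ _
      -- Lowering the last index with the frame metric cancels the dual frame `M` against `L`, so
      -- the lowered array is transformed by `L` in all four slots.
      have h2 : (L.transpose * A * L).transpose * M = L.transpose * A.transpose := by
        simp only [Matrix.transpose_mul, Matrix.transpose_transpose, Matrix.mul_assoc, hLM,
          Matrix.mul_one]
      rw [h1, frameArr_eq, ← act1_act4, ← act2_act4, ← act3_act4, act4_act4, h2, ← act4_act4]
      simp only [act1, act2, act3, act4, Matrix.transpose_apply, Finset.mul_sum]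
      exact Finset.sum_congr rfl fun p _ => Finset.sum_congr rfl fun q _ =>
        Finset.sum_congr rfl fun r _ => Finset.sum_congr rfl fun s _ =>
        Finset.sum_congr rfl fun e _ => by ring
    rw [key, key]
    simp only [← Finset.sum_neg_distrib]
    refine Finset.sum_congr rfl fun p _ => Finset.sum_congr rfl fun q _ => ?_
    rw [Finset.sum_comm]
    exact Finset.sum_congr rfl fun r _ => Finset.sum_congr rfl fun s _ => by
      rw [h.anti_right p q s r]; ring
  cyclic a b c d := by
    have key : ∀ a b c d, frameArr L M w a b c d = ∑ s, M d s * ∑ p, ∑ q, ∑ r,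
        L p a * L q b * L r c * w p q r s := by
      intro a b c d
      have : frameArr L M w = act4 M (act1 L.transpose (act2 L.transpose (act3 L.transpose w))) := by
        rw [frameArr_eq]; simp only [act3_act4, act2_act4, act1_act4]
      rw [this]
      simp only [act1, act2, act3, act4, Matrix.transpose_apply, Finset.mul_sum]
      exact Finset.sum_congr rfl fun p _ => Finset.sum_congr rfl fun q _ =>
        Finset.sum_congr rfl fun r _ => Finset.sum_congr rfl fun s _ => by ring
    rw [key, key, key, ← Finset.sum_add_distrib, ← Finset.sum_add_distrib]
    refine Finset.sum_eq_zero fun s _ => ?_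
    rw [← mul_add, ← mul_add]
    have e1 : ∑ p, ∑ q, ∑ r, L p b * L q c * L r a * w p q r s
        = ∑ p, ∑ q, ∑ r, L p a * L q b * L r c * w q r p s := by
      have : ∀ p, ∑ q, ∑ r, L p b * L q c * L r a * w p q r s
        = ∑ r, ∑ q, L p b * L q c * L r a * w p q r s := fun p => Finset.sum_comm
      simp only [this]
      rw [Finset.sum_comm]
      exact Finset.sum_congr rfl fun p _ => Finset.sum_congr rfl fun q _ =>
        Finset.sum_congr rfl fun r _ => by ring
    have e2 : ∑ p, ∑ q, ∑ r, L p c * L q a * L r b * w p q r s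
        = ∑ p, ∑ q, ∑ r, L p a * L q b * L r c * w r p q s := by
      rw [Finset.sum_comm]
      refine Finset.sum_congr rfl fun p _ => ?_
      rw [Finset.sum_comm]
      exact Finset.sum_congr rfl fun q _ =>
        Finset.sum_congr rfl fun r _ => by ring
    rw [e1, e2]
    simp only [← Finset.sum_add_distrib]
    have : ∑ p, ∑ q, ∑ r, (L p a * L q b * L r c * w p q r s + L p a * L q b * L r c * w q r p s
        + L p a * L q b * L r c * w r p q s) = 0 :=
      Finset.sum_eq_zero fun p _ => Finset.sum_eq_zero fun q _ => Finset.sum_eq_zero fun r _ => by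
        rw [← mul_add, ← mul_add, h.cyclic, mul_zero]
    rw [this, mul_zero]
  trace a c := by
    have key : ∀ b, frameArr L M w a b c b = ∑ p, ∑ r, ∑ q, ∑ s,
        L p a * L r c * (w p q r s * (L q b * M b s)) := by
      intro b
      simp only [frameArr]
      refine Finset.sum_congr rfl fun p _ => ?_
      rw [Finset.sum_comm]
      exact Finset.sum_congr rfl fun q _ => Finset.sum_congr rfl fun r _ =>
        Finset.sum_congr rfl fun s _ => by ring
    simp only [key]
    rw [Finset.sum_comm]
    refine Finset.sum_eq_zero fun p _ => ?_
    rw [Finset.sum_comm]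
    refine Finset.sum_eq_zero fun r _ => ?_
    have e1 : ∑ b, ∑ q, ∑ s, L p a * L r c * (w p q r s * (L q b * M b s))
        = ∑ q, ∑ s, L p a * L r c * (w p q r s * (1 : Mat) q s) := by
      rw [Finset.sum_comm]
      refine Finset.sum_congr rfl fun q _ => ?_
      rw [Finset.sum_comm]
      refine Finset.sum_congr rfl fun s _ => ?_
      rw [← hLM, Matrix.mul_apply]
      simp only [Finset.mul_sum]
    rw [e1]
    simp only [Matrix.one_apply, mul_ite, mul_one, mul_zero, Finset.sum_ite_eq, Finset.mem_univ,
      if_true, ← Finset.mul_sum, h.trace]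

end Scri

/-! ### The Hodge dual in an orthonormal frame -/

namespace Scri

/-- The Minkowski matrix. -/
def mink : Mat := Matrix.diagonal ![-1, 1, 1, 1]

lemma sum_mink_mul (f : Fin 4 → ℝ) (a : Fin 4) :
    ∑ p, mink a p * f p = (![-1, 1, 1, 1] : Fin 4 → ℝ) a * f a := by
  simp only [mink, Matrix.diagonal_apply, ite_mul, zero_mul, Finset.sum_ite_eq, Finset.mem_univ,
    if_true]

lemma det_mink : mink.det = -1 := by
  simp [mink, Matrix.det_diagonal, Fin.prod_univ_four]

lemma mink_inv : mink⁻¹ = mink := by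
  refine Matrix.inv_eq_left_inv ?_
  rw [mink, Matrix.diagonal_mul_diagonal, ← Matrix.diagonal_one]
  congr 1
  funext i; fin_cases i <;> simp

lemma altSymbol_sign (σ : Equiv.Perm (Fin 4)) :
    altSymbol (σ 0) (σ 1) (σ 2) (σ 3) = (Equiv.Perm.sign σ : ℤ) := by
  have h := Matrix.det_permute σ (1 : Mat)
  rw [Matrix.det_one, mul_one] at h
  rw [← h, altSymbol]
  congr 1
  ext i j
  rw [Matrix.submatrix_apply, Matrix.one_apply, Matrix.of_apply]
  fin_cases i <;> rfl

/-- Only these values enter the duals of the six independent index pairs; each is the sign of an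
explicit product of transpositions. -/
lemma altSymbol_perm :
    altSymbol 0 1 2 3 = 1 ∧ altSymbol 0 1 3 2 = -1 ∧ altSymbol 0 2 3 1 = 1 ∧
    altSymbol 0 2 1 3 = -1 ∧ altSymbol 0 3 1 2 = 1 ∧ altSymbol 0 3 2 1 = -1 ∧
    altSymbol 2 3 0 1 = 1 ∧ altSymbol 2 3 1 0 = -1 ∧ altSymbol 3 1 0 2 = 1 ∧
    altSymbol 3 1 2 0 = -1 ∧ altSymbol 1 2 0 3 = 1 ∧ altSymbol 1 2 3 0 = -1 := by
  have key : ∀ (s : ℤ) (a b c d : Fin 4) (σ : Equiv.Perm (Fin 4)), Equiv.Perm.sign σ = s →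
      (σ 0 = a ∧ σ 1 = b ∧ σ 2 = c ∧ σ 3 = d) → altSymbol a b c d = s := by
    rintro s a b c d σ hs ⟨rfl, rfl, rfl, rfl⟩
    rw [altSymbol_sign, hs]
  refine ⟨?_, ?_, ?_, ?_, ?_, ?_, ?_, ?_, ?_, ?_, ?_, ?_⟩
  · simpa using key 1 _ _ _ _ 1 (by decide) (by decide)
  · simpa using key (-1) _ _ _ _ (Equiv.swap 2 3) (by decide) (by decide)
  · simpa using key 1 _ _ _ _ (Equiv.swap 1 2 * Equiv.swap 2 3) (by decide) (by decide)
  · simpa using key (-1) _ _ _ _ (Equiv.swap 1 2) (by decide) (by decide)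
  · simpa using key 1 _ _ _ _ (Equiv.swap 2 3 * Equiv.swap 1 2) (by decide) (by decide)
  · simpa using key (-1) _ _ _ _ (Equiv.swap 1 3) (by decide) (by decide)
  · simpa using key 1 _ _ _ _ (Equiv.swap 0 2 * Equiv.swap 1 3) (by decide) (by decide)
  · simpa using key (-1) 2 3 1 0 (Equiv.swap 0 1 * Equiv.swap 0 2 * Equiv.swap 1 3) (by decide) (by decide)
  · simpa using key 1 3 1 0 2 (Equiv.swap 0 2 * Equiv.swap 0 3) (by decide) (by decide)
  · simpa using key (-1) 3 1 2 0 (Equiv.swap 0 3) (by decide) (by decide)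
  · simpa using key 1 1 2 0 3 (Equiv.swap 0 1 * Equiv.swap 1 2) (by decide) (by decide)
  · simpa using key (-1) 1 2 3 0 (Equiv.swap 0 1 * Equiv.swap 1 2 * Equiv.swap 2 3) (by decide) (by decide)

lemma altSymbol_zero {a b c d : Fin 4} (h : ∃ i j : Fin 4, i ≠ j ∧ ![a, b, c, d] i = ![a, b, c, d] j) :
    altSymbol a b c d = 0 := by
  obtain ⟨i, j, hij, h⟩ := h
  refine Matrix.det_zero_of_row_eq hij ?_
  funext k
  simp [h]

/-- With the first two indices fixed, only the two orderings of the complementary pair contribute.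
-/
lemma sum_altSymbol_eq {a b c d : Fin 4} (hnd : [a, b, c, d].Nodup) (F : Fin 4 → Fin 4 → ℝ) :
    ∑ e, ∑ f, altSymbol a b e f * F e f
      = altSymbol a b c d * F c d + altSymbol a b d c * F d c := by
  have h0 : ∀ e f, ¬ (e = c ∧ f = d) → ¬ (e = d ∧ f = c) → altSymbol a b e f * F e f = 0 := by
    intro e f h1 h2
    rw [altSymbol_zero, zero_mul]
    clear F
    revert a b c d e f
    decide
  have hcd : c ≠ d := by rintro rfl; simp at hnd
  have e1 : ∀ e f, altSymbol a b e f * F e f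
      = (if e = c then (if f = d then altSymbol a b c d * F c d else 0) else 0)
        + (if e = d then (if f = c then altSymbol a b d c * F d c else 0) else 0) := by
    intro e f
    by_cases h1 : e = c ∧ f = d
    · obtain ⟨rfl, rfl⟩ := h1; simp [hcd]
    by_cases h2 : e = d ∧ f = c
    · obtain ⟨rfl, rfl⟩ := h2; simp [hcd.symm]
    rw [h0 e f h1 h2]
    by_cases h3 : e = c
    · have h4 : f ≠ d := fun h => h1 ⟨h3, h⟩
      subst h3; simp [h4, hcd]
    · by_cases h5 : e = d
      · have h4 : f ≠ c := fun h => h2 ⟨h5, h⟩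
        subst h5; simp [h3, h4]
      · simp [h3, h5]
  rw [Finset.sum_congr rfl fun e _ => Finset.sum_congr rfl fun f _ => e1 e f]
  simp only [Finset.sum_add_distrib, Finset.sum_ite_eq', Finset.mem_univ, if_true,
    Finset.sum_ite_irrel, Finset.sum_const_zero]

/-- The dual exchanges the pairs 01, 02, 03 with 23, 31, 12, up to a sign on the spatial pairs. The
spatial pairs are taken in cyclic order so that no other signs occur. -/
lemma hodgeAt_mink {w : Arr} (ha : ∀ a b c d, w a b c d = -w b a c d) (c d : Fin 4) :
    hodgeAt mink w 0 1 c d = w 2 3 c d ∧ hodgeAt mink w 0 2 c d = w 3 1 c d ∧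
    hodgeAt mink w 0 3 c d = w 1 2 c d ∧ hodgeAt mink w 2 3 c d = -w 0 1 c d ∧
    hodgeAt mink w 3 1 c d = -w 0 2 c d ∧ hodgeAt mink w 1 2 c d = -w 0 3 c d := by
  have r : ∀ e f, act1 mink⁻¹ (act2 mink⁻¹ w) e f c d
      = ![-1, 1, 1, 1] e * (![-1, 1, 1, 1] f * w e f c d) := by
    intro e f
    rw [mink_inv]
    simp only [act1, act2, sum_mink_mul]
  have key : ∀ a b e f : Fin 4, [a, b, e, f].Nodup → hodgeAt mink w a b c d = (1 / 2) *
      (altSymbol a b e f * (![-1, 1, 1, 1] e * (![-1, 1, 1, 1] f * w e f c d))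
      + altSymbol a b f e * (![-1, 1, 1, 1] f * (![-1, 1, 1, 1] e * w f e c d))) := by
    intro a b e f hnd
    simp only [hodgeAt_eq, altDual, r]
    rw [sum_altSymbol_eq hnd fun e f => ![-1, 1, 1, 1] e * (![-1, 1, 1, 1] f * w e f c d), det_mink]
    simp
  obtain ⟨p1, p2, p3, p4, p5, p6, p7, p8, p9, p10, p11, p12⟩ := altSymbol_perm
  refine ⟨?_, ?_, ?_, ?_, ?_, ?_⟩
  · rw [key 0 1 2 3 (by decide), p1, p2, ha 3 2]; simp; ring
  · rw [key 0 2 3 1 (by decide), p3, p4, ha 1 3]; simp; ring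
  · rw [key 0 3 1 2 (by decide), p5, p6, ha 2 1]; simp; ring
  · rw [key 2 3 0 1 (by decide), p7, p8, ha 1 0]; simp; ring
  · rw [key 3 1 0 2 (by decide), p9, p10, ha 2 0]; simp; ring
  · rw [key 1 2 0 3 (by decide), p11, p12, ha 3 0]; simp; ring

lemma hodgeAt_antisymm (A : Mat) (w : Arr) (a b c d : Fin 4) :
    hodgeAt A w a b c d = -hodgeAt A w b a c d := by
  have : ∀ e f, altSymbol a b e f = -altSymbol b a e f := by
    intro e f
    rw [altSymbol, altSymbol, ← neg_one_mul, ← Int.cast_one, ← Int.cast_neg,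
      ← Units.val_one, ← Units.val_neg, ← Equiv.Perm.sign_swap (show (0 : Fin 4) ≠ 1 by decide),
      ← Matrix.det_permute]
    congr 1
    ext i j
    fin_cases i <;> rfl
  simp only [hodgeAt, this]
  simp

end Scri

/-! ### Electric and magnetic parts of a Weyl candidate -/

namespace Scri

namespace WeylSym

variable {w : Arr} (h : WeylSym mink w)
include h

omit h in
lemma sum_mul_mink (f : Fin 4 → ℝ) (d : Fin 4) :
    ∑ e, f e * mink e d = f d * (![-1, 1, 1, 1] : Fin 4 → ℝ) d := by
  simp [mink, Matrix.diagonal_apply]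

lemma right (a b c d : Fin 4) : w a b c d * (![-1, 1, 1, 1] : Fin 4 → ℝ) d
    = -(w a b d c * (![-1, 1, 1, 1] : Fin 4 → ℝ) c) := by
  have := h.anti_right a b c d
  rwa [sum_mul_mink (fun e => w a b c e), sum_mul_mink (fun e => w a b d e)] at this

lemma left_self (a c d : Fin 4) : w a a c d = 0 := by linarith [h.anti_left a a c d]

lemma right_zero (a b : Fin 4) (i : Fin 3) : w a b i.succ 0 = w a b 0 i.succ := by
  have := h.right a b i.succ 0
  fin_cases i <;> simpa using this

lemma right_succ (a b : Fin 4) (i j : Fin 3) : w a b i.succ j.succ = -w a b j.succ i.succ := by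
  have := h.right a b i.succ j.succ
  fin_cases i <;> fin_cases j <;> simpa using this

lemma right_self (a b c : Fin 4) : w a b c c = 0 := by
  have := h.right a b c c
  fin_cases c <;> simp at this ⊢ <;> linarith

/-- The classical octahedron argument: the sum of four cyclic identities, reduced by the
antisymmetry in both pairs. The vector (-1, 1, 1, 1) lowers the last index. -/
lemma pair (a b c d : Fin 4) : w a b c d * (![-1, 1, 1, 1] : Fin 4 → ℝ) d
    = w c d a b * (![-1, 1, 1, 1] : Fin 4 → ℝ) b := by
  have c1 := congrArg (· * (![-1, 1, 1, 1] : Fin 4 → ℝ) d) (h.cyclic a b c d)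
  have c2 := congrArg (· * (![-1, 1, 1, 1] : Fin 4 → ℝ) a) (h.cyclic b c d a)
  have c3 := congrArg (· * (![-1, 1, 1, 1] : Fin 4 → ℝ) b) (h.cyclic c d a b)
  have c4 := congrArg (· * (![-1, 1, 1, 1] : Fin 4 → ℝ) c) (h.cyclic d a b c)
  simp only [zero_mul, add_mul] at c1 c2 c3 c4
  have l : ∀ a b c d, w a b c d * (![-1, 1, 1, 1] : Fin 4 → ℝ) d
      = -(w b a c d * (![-1, 1, 1, 1] : Fin 4 → ℝ) d) := fun a b c d => by
    rw [h.anti_left a b]; ring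
  have r := h.right
  linarith [l a b c d, r a b c d, l b c a d, r b c a d, l c a b d, r c a b d, l b c d a, l c d b a,
    r c d b a, l d b c a, r d b c a, l c d a b, r c d a b, l d a c b, r d a c b, l a c d b,
    r a c d b, l d a b c, r d a b c, l a b d c, r b d a c, l b d a c, l b a d c, r a d b c]

/-- The electric and magnetic parts of a Weyl candidate in an orthonormal frame are symmetric and
trace-free. -/
lemma electromagnetic :
    (w 0 2 0 1 = w 0 1 0 2 ∧ w 0 3 0 1 = w 0 1 0 3 ∧ w 0 3 0 2 = w 0 2 0 3 ∧
      w 0 3 0 3 = -w 0 1 0 1 - w 0 2 0 2) ∧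
    (w 3 1 0 1 = w 2 3 0 2 ∧ w 1 2 0 1 = w 2 3 0 3 ∧ w 1 2 0 2 = w 3 1 0 3 ∧
      w 1 2 0 3 = -w 2 3 0 1 - w 3 1 0 2) := by
  have p := h.pair
  have r0 := h.right_zero
  have rs := h.right_succ
  have l := h.anti_left
  have tr := fun a c => h.trace a c
  simp only [Fin.sum_univ_four] at tr
  refine ⟨⟨?_, ?_, ?_, ?_⟩, ?_, ?_, ?_, ?_⟩
  · simpa using p 0 2 0 1
  · simpa using p 0 3 0 1
  · simpa using p 0 3 0 2
  · have := tr 0 0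
    rw [h.right_self] at this
    linarith
  -- For the magnetic part the roles are exchanged: its symmetry comes from the trace conditions
  -- with one time index, and its tracelessness, in the last case, from the cyclic identity on 0 1 2
  -- 3.
  · have t := tr 0 3
    have e1 := p 0 1 3 1
    have e2 := p 0 2 3 2
    have e3 := l 3 2 0 2
    rw [h.left_self, h.right_self] at t
    simp at e1 e2
    linarith
  · have t := tr 0 2
    have e1 := p 0 1 2 1
    have e2 := p 0 3 2 3
    have e3 := l 2 1 0 1
    rw [h.left_self, h.right_self] at t
    simp at e1 e2
    linarith
  · have t := tr 0 1
    have e1 := p 0 2 1 2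
    have e2 := p 0 3 1 3
    have e3 := l 1 3 0 3
    rw [h.left_self, h.right_self] at t
    simp at e1 e2
    linarith
  · have c := h.cyclic 0 1 2 3
    have e1 := p 0 1 2 3
    have e2 := p 2 0 1 3
    have e3 := r0 1 3 1
    have e4 := l 1 3 0 2
    simp at e1 e2 e3
    linarith

/-- The electric and magnetic parts determine all other components: pair symmetry gives the mixed
ones, and the spatial trace conditions identify the purely spatial block with minus the electric
part. -/
lemma electric_of_spatial :
    (w 0 1 2 3 = w 2 3 0 1 ∧ w 0 1 3 1 = w 2 3 0 2 ∧ w 0 1 1 2 = w 2 3 0 3) ∧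
    (w 0 2 2 3 = w 2 3 0 2 ∧ w 0 2 3 1 = w 3 1 0 2 ∧ w 0 2 1 2 = w 3 1 0 3) ∧
    (w 0 3 2 3 = w 2 3 0 3 ∧ w 0 3 3 1 = w 3 1 0 3 ∧ w 0 3 1 2 = -w 2 3 0 1 - w 3 1 0 2) ∧
    (w 2 3 2 3 = -w 0 1 0 1 ∧ w 2 3 3 1 = -w 0 1 0 2 ∧ w 2 3 1 2 = -w 0 1 0 3) ∧
    (w 3 1 2 3 = -w 0 1 0 2 ∧ w 3 1 3 1 = -w 0 2 0 2 ∧ w 3 1 1 2 = -w 0 2 0 3) ∧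
    (w 1 2 2 3 = -w 0 1 0 3 ∧ w 1 2 3 1 = -w 0 2 0 3 ∧ w 1 2 1 2 = w 0 1 0 1 + w 0 2 0 2) := by
  obtain ⟨⟨s1, s2, s3, s4⟩, m1, m2, m3, m4⟩ := h.electromagnetic
  have p := h.pair
  have r0 := h.right_zero
  have rs := h.right_succ
  have l := h.anti_left
  have tr := fun a c => h.trace a c
  simp only [Fin.sum_univ_four] at tr
  have q : ∀ a b (i j : Fin 3), w a b 0 0 = 0 := fun a b i j => h.right_self a b 0
  have g11 := tr 1 1
  have g22 := tr 2 2
  have g33 := tr 3 3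
  have g12 := tr 1 2
  have g13 := tr 1 3
  have g23 := tr 2 3
  simp only [h.left_self, h.right_self, add_zero] at g11 g22 g33 g12 g13 g23
  have z1 := r0 1 0 0
  have z2 := r0 2 0 1
  have z3 := r0 3 0 2
  have z4 := r0 1 0 1
  have z5 := r0 1 0 2
  have z6 := r0 2 0 2
  have R : ∀ a b, w a b 2 1 = -w a b 1 2 ∧ w a b 1 3 = -w a b 3 1 ∧ w a b 3 2 = -w a b 2 3 :=
    fun a b => ⟨by simpa using rs a b 1 0, by simpa using rs a b 0 2, by simpa using rs a b 2 1⟩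
  -- For spatial indices the lowering signs are all +1, so pair symmetry holds for the mixed
  -- components as they stand.
  have P : ∀ i j k l : Fin 3, w i.succ j.succ k.succ l.succ = w k.succ l.succ i.succ j.succ := by
    intro i j k l
    have := p i.succ j.succ k.succ l.succ
    fin_cases j <;> fin_cases l <;> simpa using this
  have P1 := P 1 2 2 0
  have P2 := P 1 2 0 1
  have P3 := P 2 0 0 1
  have Q : ∀ i k l : Fin 3, w 0 i.succ k.succ l.succ = w k.succ l.succ 0 i.succ := by
    intro i k l
    have := p 0 i.succ k.succ l.succ
    fin_cases i <;> fin_cases l <;> simpa using this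
  have l1 := l 1 0 0
  have l2 := l 2 0 0
  have l3 := l 3 0 0
  have l4 := l 2 1
  have l5 := l 1 3
  have l6 := l 3 2
  simp only [l 1 0, l 2 0, l 3 0, l 2 1, l 1 3, l 3 2, (R _ _).1, (R _ _).2.1, (R _ _).2.2]
    at g11 g22 g33 g12 g13 g23 z1 z2 z3 z4 z5 z6
  simp at z1 z2 z3 z4 z5 z6 P1 P2 P3
  refine ⟨⟨?_, ?_, ?_⟩, ⟨?_, ?_, ?_⟩, ⟨?_, ?_, ?_⟩, ⟨?_, ?_, ?_⟩, ⟨?_, ?_, ?_⟩, ?_, ?_, ?_⟩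
  · exact Q 0 1 2
  · rw [← m1]; exact Q 0 2 0
  · rw [← m2]; exact Q 0 0 1
  · exact Q 1 1 2
  · exact Q 1 2 0
  · rw [← m3]; exact Q 1 0 1
  · exact Q 2 1 2
  · exact Q 2 2 0
  · rw [← m4]; exact Q 2 0 1
  all_goals linarith

end WeylSym

end Scri

/-! ### The Bel-Robinson covector in terms of the electric and magnetic parts -/

namespace Scri

/-- The bilinear form underlying `brCovector`. -/
noncomputable def brForm (A : Mat) (w w' : Arr) (v : Fin 4 → ℝ) (e : Fin 4) : ℝ :=
  (slotMat w (Pi.single e 1) v * slotMat w' v v).trace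
    + (slotMat (hodgeAt A w) (Pi.single e 1) v * slotMat (hodgeAt A w') v v).trace

lemma trace_slotMat_single (w w' : Arr) (l : ℝ) (e : Fin 4) :
    (slotMat w (Pi.single e 1) (Pi.single 0 l) * slotMat w' (Pi.single 0 l) (Pi.single 0 l)).trace
      = l ^ 3 * ∑ b, ∑ d, w e b 0 d * w' 0 d 0 b := by
  have h1 : ∀ w : Arr, ∀ e b d (k : ℝ), slotMat w (Pi.single e k) (Pi.single 0 l) b d
      = k * l * w e b 0 d := by
    intro w e b d k
    simp [slotMat, Pi.single_apply]
  simp only [Matrix.trace, Matrix.diag, Matrix.mul_apply, h1, Finset.mul_sum]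
  exact Finset.sum_congr rfl fun b _ => Finset.sum_congr rfl fun d _ => by ring

/-- With E_{ij} = w_{0i0j}, and H the matrix whose rows belong to the pairs 23, 31, 12, the time
component is the inner product E·E' + H·H', and the spatial components are sums of cross products of
rows of E and H. The polarised form is needed because its derivative occurs in the divergence. -/
lemma brForm_mink {w w' : Arr} (h : WeylSym mink w) (h' : WeylSym mink w') (l : ℝ) :
    brForm mink w w' (Pi.single 0 l) 0 = l ^ 3 *
      (w 0 1 0 1 * w' 0 1 0 1 + w 0 2 0 2 * w' 0 2 0 2 + w 0 3 0 3 * w' 0 3 0 3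
        + 2 * (w 0 1 0 2 * w' 0 1 0 2 + w 0 1 0 3 * w' 0 1 0 3 + w 0 2 0 3 * w' 0 2 0 3)
        + (w 2 3 0 1 * w' 2 3 0 1 + w 3 1 0 2 * w' 3 1 0 2 + w 1 2 0 3 * w' 1 2 0 3)
        + 2 * (w 2 3 0 2 * w' 2 3 0 2 + w 2 3 0 3 * w' 2 3 0 3 + w 3 1 0 3 * w' 3 1 0 3)) ∧
    brForm mink w w' (Pi.single 0 l) 1 = l ^ 3 *
      (w 2 3 0 3 * w' 0 1 0 2 + w 3 1 0 3 * w' 0 2 0 2 + w 1 2 0 3 * w' 0 2 0 3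
        - w 2 3 0 2 * w' 0 1 0 3 - w 3 1 0 2 * w' 0 2 0 3 - w 3 1 0 3 * w' 0 3 0 3
        - w 0 1 0 3 * w' 2 3 0 2 - w 0 2 0 3 * w' 3 1 0 2 - w 0 3 0 3 * w' 3 1 0 3
        + w 0 1 0 2 * w' 2 3 0 3 + w 0 2 0 2 * w' 3 1 0 3 + w 0 2 0 3 * w' 1 2 0 3) ∧
    brForm mink w w' (Pi.single 0 l) 2 = l ^ 3 *
      (w 2 3 0 1 * w' 0 1 0 3 + w 2 3 0 2 * w' 0 2 0 3 + w 2 3 0 3 * w' 0 3 0 3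
        - w 2 3 0 3 * w' 0 1 0 1 - w 3 1 0 3 * w' 0 1 0 2 - w 1 2 0 3 * w' 0 1 0 3
        - w 0 1 0 1 * w' 2 3 0 3 - w 0 1 0 2 * w' 3 1 0 3 - w 0 1 0 3 * w' 1 2 0 3
        + w 0 1 0 3 * w' 2 3 0 1 + w 0 2 0 3 * w' 2 3 0 2 + w 0 3 0 3 * w' 2 3 0 3) ∧
    brForm mink w w' (Pi.single 0 l) 3 = l ^ 3 *
      (w 2 3 0 2 * w' 0 1 0 1 + w 3 1 0 2 * w' 0 1 0 2 + w 3 1 0 3 * w' 0 1 0 3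
        - w 2 3 0 1 * w' 0 1 0 2 - w 2 3 0 2 * w' 0 2 0 2 - w 2 3 0 3 * w' 0 2 0 3
        - w 0 1 0 2 * w' 2 3 0 1 - w 0 2 0 2 * w' 2 3 0 2 - w 0 2 0 3 * w' 2 3 0 3
        + w 0 1 0 1 * w' 2 3 0 2 + w 0 1 0 2 * w' 3 1 0 2 + w 0 1 0 3 * w' 3 1 0 3) := by
  obtain ⟨⟨s1, s2, s3, -⟩, m1, m2, m3, -⟩ := h.electromagnetic
  obtain ⟨⟨s1', s2', s3', -⟩, m1', m2', m3', -⟩ := h'.electromagnetic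
  have hd := fun d => hodgeAt_mink h.anti_left 0 d
  have hd' := fun d => hodgeAt_mink h'.anti_left 0 d
  have l1 := h.anti_left
  have l1' := h'.anti_left
  have A : ∀ (u : Arr), (∀ a b c d, u a b c d = -u b a c d) → ∀ d,
      u 1 0 0 d = -u 0 1 0 d ∧ u 2 0 0 d = -u 0 2 0 d ∧ u 3 0 0 d = -u 0 3 0 d ∧
      u 2 1 0 d = -u 1 2 0 d ∧ u 1 3 0 d = -u 3 1 0 d ∧ u 3 2 0 d = -u 2 3 0 d ∧
      u 0 0 0 d = 0 ∧ u 1 1 0 d = 0 ∧ u 2 2 0 d = 0 ∧ u 3 3 0 d = 0 := by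
    intro u hu d
    refine ⟨hu _ _ _ _, hu _ _ _ _, hu _ _ _ _, hu _ _ _ _, hu _ _ _ _, hu _ _ _ _,
      ?_, ?_, ?_, ?_⟩ <;> linarith [hu 0 0 0 d, hu 1 1 0 d, hu 2 2 0 d, hu 3 3 0 d]
  have Aw := A w l1
  have Aw' := A w' l1'
  have Ah := A (hodgeAt mink w) (hodgeAt_antisymm mink w)
  have Ah' := A (hodgeAt mink w') (hodgeAt_antisymm mink w')
  have z := fun a b => h.right_self a b 0
  have z' := fun a b => h'.right_self a b 0
  simp only [brForm, trace_slotMat_single, Fin.sum_univ_four]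
  refine ⟨?_, ?_, ?_, ?_⟩
  all_goals
    simp only [(Aw _).1, (Aw _).2.1, (Aw _).2.2.1, (Aw _).2.2.2.1, (Aw _).2.2.2.2.1,
      (Aw _).2.2.2.2.2.1, (Aw _).2.2.2.2.2.2.1, (Aw _).2.2.2.2.2.2.2.1, (Aw _).2.2.2.2.2.2.2.2.1,
      (Aw _).2.2.2.2.2.2.2.2.2, (Aw' _).2.2.2.2.2.2.1,
      (Ah _).1, (Ah _).2.1, (Ah _).2.2.1, (Ah _).2.2.2.1, (Ah _).2.2.2.2.1,
      (Ah _).2.2.2.2.2.1, (Ah _).2.2.2.2.2.2.1, (Ah _).2.2.2.2.2.2.2.1, (Ah _).2.2.2.2.2.2.2.2.1,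
      (Ah _).2.2.2.2.2.2.2.2.2, (Ah' _).2.2.2.2.2.2.1,
      (hd _).1, (hd _).2.1, (hd _).2.2.1, (hd _).2.2.2.1, (hd _).2.2.2.2.1, (hd _).2.2.2.2.2,
      (hd' _).1, (hd' _).2.1, (hd' _).2.2.1, z, z', s1, s2, s3, m1, m2, m3, s1', s2', s3', m1', m2',
      m3']
    ring

lemma sq_dot_le (x y : Fin 3 → ℝ) {a b : ℝ} (ha : 0 ≤ a) (hb : 0 ≤ b)
    (hx : ∑ i, x i ^ 2 ≤ a ^ 2) (hy : ∑ i, y i ^ 2 ≤ b ^ 2) : |∑ i, x i * y i| ≤ a * b := by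
  refine abs_le_of_sq_le_sq ?_ (mul_nonneg ha hb)
  calc (∑ i, x i * y i) ^ 2 ≤ (∑ i, x i ^ 2) * ∑ i, y i ^ 2 := Finset.sum_mul_sq_le_sq_mul_sq _ _ _
    _ ≤ a ^ 2 * b ^ 2 := mul_le_mul hx hy (Finset.sum_nonneg fun i _ => sq_nonneg _) (sq_nonneg _)
    _ = (a * b) ^ 2 := by ring

/-- The Euclidean triangle inequality, stated with sums of squares. -/
lemma sq_add_le (x y : Fin 3 → ℝ) {a b : ℝ} (ha : 0 ≤ a) (hb : 0 ≤ b)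
    (hx : ∑ i, x i ^ 2 ≤ a ^ 2) (hy : ∑ i, y i ^ 2 ≤ b ^ 2) :
    ∑ i, (x i + y i) ^ 2 ≤ (a + b) ^ 2 := by
  have h1 := (abs_le.1 (sq_dot_le x y ha hb hx hy)).2
  have h2 : ∑ i, (x i + y i) ^ 2 = ∑ i, x i ^ 2 + 2 * ∑ i, x i * y i + ∑ i, y i ^ 2 := by
    rw [Finset.mul_sum, ← Finset.sum_add_distrib, ← Finset.sum_add_distrib]
    exact Finset.sum_congr rfl fun i _ => by ring
  rw [h2]; nlinarith

/-- This is |2 e × f| ≤ |e|² + |f|². By Lagrange's identity the difference of the squares is (|e|² -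
|f|²)² + 4 (e·f)². -/
lemma sq_cross_le (e f : Fin 3 → ℝ) :
    ∑ i, (![2 * (e 1 * f 2 - e 2 * f 1), 2 * (e 2 * f 0 - e 0 * f 2),
      2 * (e 0 * f 1 - e 1 * f 0)] : Fin 3 → ℝ) i ^ 2
      ≤ (∑ i, (e i ^ 2 + f i ^ 2)) ^ 2 := by
  simp only [Fin.sum_univ_three]
  simp
  nlinarith [sq_nonneg (e 0 * f 0 + e 1 * f 1 + e 2 * f 2),
    sq_nonneg (e 0 ^ 2 + e 1 ^ 2 + e 2 ^ 2 - (f 0 ^ 2 + f 1 ^ 2 + f 2 ^ 2))]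

lemma brForm_self (A : Mat) (w : Arr) (v : Fin 4 → ℝ) (e : Fin 4) :
    brForm A w w v e = brCovector A w v e := rfl

/-- Dominance property of the Bel-Robinson covector in an adapted orthonormal frame. -/
lemma brCovector_mink_dominant {w : Arr} (h : WeylSym mink w) {l : ℝ} (hl : 0 < l) :
    0 ≤ brCovector mink w (Pi.single 0 l) 0 ∧
    ∑ i : Fin 3, brCovector mink w (Pi.single 0 l) i.succ ^ 2
      ≤ brCovector mink w (Pi.single 0 l) 0 ^ 2 := by
  obtain ⟨q0, q1, q2, q3⟩ := brForm_mink h h l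
  simp only [brForm_self] at q0 q1 q2 q3
  set e : Fin 3 → Fin 3 → ℝ := ![![w 0 1 0 1, w 0 1 0 2, w 0 1 0 3],
    ![w 0 1 0 2, w 0 2 0 2, w 0 2 0 3], ![w 0 1 0 3, w 0 2 0 3, w 0 3 0 3]] with he
  set f : Fin 3 → Fin 3 → ℝ := ![![w 2 3 0 1, w 2 3 0 2, w 2 3 0 3],
    ![w 2 3 0 2, w 3 1 0 2, w 3 1 0 3], ![w 2 3 0 3, w 3 1 0 3, w 1 2 0 3]] with hf
  -- The energy is the sum over the rows n of `a n`, and the momentum the sum of the cross products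
  -- `c n`. Each row obeys the previous inequality, and the triangle inequality adds the three.
  set a : Fin 3 → ℝ := fun n => ∑ i, (e n i ^ 2 + f n i ^ 2) with ha
  set c : Fin 3 → Fin 3 → ℝ := fun n => ![2 * (e n 1 * f n 2 - e n 2 * f n 1),
    2 * (e n 2 * f n 0 - e n 0 * f n 2), 2 * (e n 0 * f n 1 - e n 1 * f n 0)] with hcc
  have ha0 : ∀ n, 0 ≤ a n := fun n => Finset.sum_nonneg fun i _ => by positivity
  have hca : ∀ n, ∑ i, c n i ^ 2 ≤ a n ^ 2 := fun n => sq_cross_le (e n) (f n)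
  have k := sq_add_le _ _ (add_nonneg (ha0 0) (ha0 1)) (ha0 2)
    (sq_add_le _ _ (ha0 0) (ha0 1) (hca 0) (hca 1)) (hca 2)
  have r0 : brCovector mink w (Pi.single 0 l) 0 = l ^ 3 * (a 0 + a 1 + a 2) := by
    rw [q0]
    simp [ha, he, hf, Fin.sum_univ_three]
    left; ring
  have rs : ∀ i : Fin 3, brCovector mink w (Pi.single 0 l) i.succ
      = l ^ 3 * (c 0 i + c 1 i + c 2 i) := by
    intro i
    fin_cases i
    · change brCovector mink w (Pi.single 0 l) 1 = _
      rw [q1]; simp [hcc, he, hf]; left; ring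
    · change brCovector mink w (Pi.single 0 l) 2 = _
      rw [q2]; simp [hcc, he, hf]; left; ring
    · change brCovector mink w (Pi.single 0 l) 3 = _
      rw [q3]; simp [hcc, he, hf]; left; ring
  refine ⟨?_, ?_⟩
  · rw [r0]
    have := ha0 0; have := ha0 1; have := ha0 2
    positivity
  · simp only [r0, rs, mul_pow, ← Finset.mul_sum]
    exact mul_le_mul_of_nonneg_left k (by positivity)

/-- A divergence-free Weyl field has a divergence-free supermomentum with respect to a parallel
vector field: first-order version in an orthonormal frame. -/
lemma sum_brForm_mink_eq_zero {w : Arr} (h : WeylSym mink w) {D : Fin 4 → Arr}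
    (hD : ∀ e, WeylSym mink (D e)) (hdiv : ∀ a b c, ∑ d, D d a b c d = 0) (l : ℝ) :
    ∑ e, mink e e * (brForm mink (D e) w (Pi.single 0 l) e + brForm mink w (D e) (Pi.single 0 l) e)
      = 0 := by
  have e0 := brForm_mink h (hD 0) l
  have e1 := brForm_mink h (hD 1) l
  have e2 := brForm_mink h (hD 2) l
  have e3 := brForm_mink h (hD 3) l
  have f0 := brForm_mink (hD 0) h l
  have f1 := brForm_mink (hD 1) h l
  have f2 := brForm_mink (hD 2) h l
  have f3 := brForm_mink (hD 3) h l
  simp only [Fin.sum_univ_four] at hdiv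
  have r0 : ∀ e a b, D e a b 1 0 = D e a b 0 1 ∧ D e a b 2 0 = D e a b 0 2
      ∧ D e a b 3 0 = D e a b 0 3 := fun e a b =>
    ⟨by simpa using (hD e).right_zero a b 0, by simpa using (hD e).right_zero a b 1,
      by simpa using (hD e).right_zero a b 2⟩
  have R : ∀ e a b, D e a b 2 1 = -D e a b 1 2 ∧ D e a b 1 3 = -D e a b 3 1
      ∧ D e a b 3 2 = -D e a b 2 3 := fun e a b =>
    ⟨by simpa using (hD e).right_succ a b 1 0, by simpa using (hD e).right_succ a b 0 2,
      by simpa using (hD e).right_succ a b 2 1⟩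
  have z := fun e a b c => (hD e).right_self a b c
  rw [Fin.sum_univ_four, e0.1, f0.1, e1.2.1, f1.2.1, e2.2.2.1, f2.2.2.1, e3.2.2.2, f3.2.2.2]
  obtain ⟨⟨-, -, -, w33⟩, -, -, -, v33⟩ := h.electromagnetic
  have s := fun e => (hD e).electromagnetic
  have t := fun e => (hD e).electric_of_spatial
  have m : mink 0 0 = -1 ∧ mink 1 1 = 1 ∧ mink 2 2 = 1 ∧ mink 3 3 = 1 := by simp [mink]
  rw [m.1, m.2.1, m.2.2.1, m.2.2.2, w33, v33]
  clear e0 e1 e2 e3 f0 f1 f2 f3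
  -- The first index pair 0i gives the evolution and constraint equations of the electric part, and
  -- the pairs 23, 31, 12 those of the magnetic part, as in Maxwell's equations.
  have d := fun b c => hdiv 0 b c
  have d1 := fun c => hdiv 2 3 c
  have d2 := fun c => hdiv 3 1 c
  have d3 := fun c => hdiv 1 2 c
  have g01 := d 1 1; have g02 := d 1 2; have g03 := d 1 3
  have g12 := d 2 2; have g13 := d 2 3; have g23 := d 3 3
  have g21 := d 2 1; have g31 := d 3 1; have g32 := d 3 2
  have k11 := d1 1; have k12 := d1 2; have k13 := d1 3
  have k21 := d2 1; have k22 := d2 2; have k23 := d2 3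
  have k31 := d3 1; have k32 := d3 2; have k33 := d3 3
  clear d d1 d2 d3 hdiv
  simp only [(r0 _ _ _).1, (r0 _ _ _).2.1, (r0 _ _ _).2.2, (R _ _ _).1, (R _ _ _).2.1,
    (R _ _ _).2.2, z, (s _).1.1, (s _).1.2.1, (s _).1.2.2.1, (s _).1.2.2.2, (s _).2.1,
    (s _).2.2.1, (s _).2.2.2.1, (s _).2.2.2.2, (t _).1.1, (t _).1.2.1, (t _).1.2.2,
    (t _).2.1.1, (t _).2.1.2.1, (t _).2.1.2.2, (t _).2.2.1.1, (t _).2.2.1.2.1, (t _).2.2.1.2.2,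
    (t _).2.2.2.1.1, (t _).2.2.2.1.2.1, (t _).2.2.2.1.2.2, (t _).2.2.2.2.1.1,
    (t _).2.2.2.2.1.2.1, (t _).2.2.2.2.1.2.2, (t _).2.2.2.2.2.1, (t _).2.2.2.2.2.2.1,
    (t _).2.2.2.2.2.2.2]
    at g01 g02 g03 g12 g13 g23 g21 g31 g32 k11 k12 k13 k21 k22 k23 k31 k32 k33 ⊢
  clear s t r0 R z hD h m
  generalize w 0 1 0 1 = E11, w 0 1 0 2 = E12, w 0 1 0 3 = E13, w 0 2 0 2 = E22, w 0 2 0 3 = E23,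
    w 2 3 0 1 = H11, w 2 3 0 2 = H12, w 2 3 0 3 = H13, w 3 1 0 2 = H22, w 3 1 0 3 = H23 at *
  -- As in Poynting's theorem, the electric equations are contracted with E and the magnetic ones
  -- with H. The entries E33 and H33 are expressed by tracelessness.
  linear_combination (-2 * l ^ 3) * (E11 * g01 + E12 * (g02 + g21) + E13 * (g03 + g31) + E22 * g12
    + E23 * (g13 + g32) + (-E11 - E22) * g23
    + H11 * k11 + H12 * (k12 + k21) + H13 * (k13 + k31) + H22 * k22 + H23 * (k23 + k32) +
      (-H11 - H22) * k33)

end Scri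

/-! ### Lorentzian matrices, adapted frames and causality -/

namespace Scri

/-- The value `A(v, w)` of the bilinear form with matrix `A`. -/
def bil (A : Mat) (v w : Fin 4 → ℝ) : ℝ := v ⬝ᵥ A.mulVec w

/-- The hypothesis kills the electric and magnetic parts, and these determine the whole array. -/
lemma WeylSym.eq_zero {w : Arr} (h : WeylSym mink w) (h0 : ∀ a b c, w a b c 0 = 0)
    (a b c d : Fin 4) : w a b c d = 0 := by
  have h1 : ∀ a b d, w a b 0 d = 0 := by
    intro a b d
    refine Fin.cases (h.right_self a b 0) (fun i => ?_) d
    rw [← h.right_zero, h0]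
  have h2 : ∀ b c d, w 0 b c d = 0 := by
    intro b c d
    have := h.pair 0 b c d
    have h3 := h.right c d 0 b
    rw [h1] at h3
    fin_cases d <;> fin_cases b <;> simp_all [h.left_self]
  have h3 : ∀ a c d, w a 0 c d = 0 := fun a c d => by rw [h.anti_left, h2, neg_zero]
  obtain ⟨-, -, -, ⟨k1, k2, k3⟩, ⟨k4, k5, k6⟩, k7, k8, k9⟩ := h.electric_of_spatial
  simp only [h2, neg_zero, add_zero] at k1 k2 k3 k4 k5 k6 k7 k8 k9
  have R : ∀ a b, w a b 2 1 = -w a b 1 2 ∧ w a b 1 3 = -w a b 3 1 ∧ w a b 3 2 = -w a b 2 3 :=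
    fun a b => ⟨by simpa using h.right_succ a b 1 0, by simpa using h.right_succ a b 0 2,
      by simpa using h.right_succ a b 2 1⟩
  have key : ∀ a b, (w a b 2 3 = 0 ∧ w a b 3 1 = 0 ∧ w a b 1 2 = 0) → w a b c d = 0 := by
    rintro a b ⟨p, q, r⟩
    obtain ⟨p', q', r'⟩ := R a b
    rw [r, neg_zero] at p'; rw [q, neg_zero] at q'; rw [p, neg_zero] at r'
    fin_cases c <;> fin_cases d <;> first | exact h.right_self _ _ _ | exact h1 _ _ _ | exact h0 _ _ _ | assumption
  have key' : ∀ a b, (w b a 2 3 = 0 ∧ w b a 3 1 = 0 ∧ w b a 1 2 = 0) → w a b c d = 0 := by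
    intro a b hh
    rw [h.anti_left, key b a hh, neg_zero]
  fin_cases a <;> fin_cases b <;> first | exact h.left_self _ _ _ | exact h2 _ _ _ | exact h3 _ _ _ |
    exact key _ _ ⟨by assumption, by assumption, by assumption⟩ |
    exact key' _ _ ⟨by assumption, by assumption, by assumption⟩

lemma bil_mulVec (A L : Mat) (v w : Fin 4 → ℝ) :
    bil A (L.mulVec v) (L.mulVec w) = bil (L.transpose * A * L) v w := by
  rw [bil, bil, ← Matrix.vecMul_transpose, ← Matrix.dotProduct_mulVec, Matrix.mulVec_mulVec,
    Matrix.mulVec_mulVec, Matrix.mul_assoc]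

lemma bil_comm {A : Mat} (hA : A.transpose = A) (v w : Fin 4 → ℝ) : bil A v w = bil A w v := by
  rw [bil, bil, Matrix.dotProduct_mulVec, ← Matrix.mulVec_transpose, hA, dotProduct_comm]

lemma bil_mink (v w : Fin 4 → ℝ) :
    bil mink v w = -(v 0 * w 0) + ∑ i : Fin 3, v i.succ * w i.succ := by
  simp [bil, mink, dotProduct, Matrix.mulVec_diagonal, Fin.sum_univ_four, Fin.sum_univ_three]
  ring

/-- A matrix congruent to the Minkowski matrix. -/
def Lorentzian (A : Mat) : Prop := ∃ S : Mat, S.transpose * A * S = mink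

lemma Lorentzian.symm {A : Mat} (h : Lorentzian A) : A.transpose = A := by
  obtain ⟨S, hS⟩ := h
  have hd : S.det ≠ 0 := by
    intro h0
    have := congrArg Matrix.det hS
    rw [Matrix.det_mul, Matrix.det_mul, h0, det_mink] at this
    simp at this
  have hu : IsUnit S := (Matrix.isUnit_iff_isUnit_det S).2 (isUnit_iff_ne_zero.2 hd)
  have hu' : IsUnit S.transpose := by
    rw [Matrix.isUnit_iff_isUnit_det, Matrix.det_transpose]; exact isUnit_iff_ne_zero.2 hd
  have : S.transpose * A.transpose * S = S.transpose * A * S := by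
    rw [hS]
    have := congrArg Matrix.transpose hS
    rw [Matrix.transpose_mul, Matrix.transpose_mul, Matrix.transpose_transpose] at this
    rw [Matrix.mul_assoc, this, mink, Matrix.diagonal_transpose]
  exact hu'.mul_left_cancel (hu.mul_right_cancel this)

lemma det_ne_zero_of_frame {A L : Mat} (h : L.transpose * A * L = mink) : L.det ≠ 0 ∧ A.det ≠ 0 := by
  have := congrArg Matrix.det h
  rw [Matrix.det_mul, Matrix.det_mul, det_mink] at this
  constructor <;> intro h0 <;> rw [h0] at this <;> simp at this

/-- `R` is the reflection in the `A`-orthogonal hyperplane of a non-null vector. -/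
lemma reflection_congr {A : Mat} (hA : A.transpose = A) {x : Fin 4 → ℝ} (hx : bil A x x ≠ 0) :
    let R : Mat := 1 - (2 / bil A x x) • Matrix.vecMulVec x (A.mulVec x)
    R.transpose * A * R = A ∧
      ∀ y, R.mulVec y = y - (2 * bil A x y / bil A x x) • x := by
  intro R
  have h1 : ∀ y, R.mulVec y = y - (2 * bil A x y / bil A x x) • x := by
    intro y
    rw [bil_comm hA x y]
    simp only [R, Matrix.sub_mulVec, Matrix.one_mulVec, Matrix.smul_mulVec, Matrix.vecMulVec_mulVec]
    congr 1
    funext i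
    simp [bil, dotProduct_comm (A.mulVec x) y]
    ring
  refine ⟨?_, h1⟩
  have : ∀ y z, bil (R.transpose * A * R) y z = bil A y z := by
    intro y z
    rw [← bil_mulVec, h1, h1]
    have hz := bil_comm hA y x
    simp only [bil, Matrix.mulVec_sub, Matrix.mulVec_smul, sub_dotProduct, dotProduct_sub,
      smul_dotProduct, dotProduct_smul, smul_eq_mul] at hz hx ⊢
    rw [hz]
    field_simp
    ring
  ext i j
  have := this (Pi.single i 1) (Pi.single j 1)
  simpa [bil] using this

/-- A timelike vector is the first leg of an orthonormal frame, up to a factor. -/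
lemma Lorentzian.exists_frame {A : Mat} (h : Lorentzian A) {v : Fin 4 → ℝ} (hv : bil A v v < 0) :
    ∃ L M : Mat, L * M = 1 ∧ L.transpose * A * L = mink ∧ ∃ l : ℝ, 0 < l ∧
      L.mulVec (Pi.single 0 l) = v := by
  have hA := h.symm
  obtain ⟨S, hS⟩ := h
  set l := Real.sqrt (-bil A v v) with hl
  have hl0 : 0 < l := Real.sqrt_pos.2 (by linarith)
  have hl2 : l ^ 2 = -bil A v v := Real.sq_sqrt (by linarith)
  set e := S.mulVec (Pi.single 0 1) with he
  set u := l⁻¹ • v with hu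
  have hee : bil A e e = -1 := by rw [he, bil_mulVec, hS, bil_mink]; simp
  have huu : bil A u u = -1 := by
    have : bil A u u = l⁻¹ * (l⁻¹ * bil A v v) := by
      simp [hu, bil, Matrix.mulVec_smul]
    rw [this]; field_simp; linarith
  suffices H : ∃ L : Mat, L.transpose * A * L = mink ∧ L.mulVec (Pi.single 0 1) = u by
    obtain ⟨L, hL, hLu⟩ := H
    refine ⟨L, L⁻¹, Matrix.mul_nonsing_inv _ (isUnit_iff_ne_zero.2 (det_ne_zero_of_frame hL).1),
      hL, l, hl0, ?_⟩
    have : (Pi.single 0 l : Fin 4 → ℝ) = l • Pi.single 0 1 := by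
      rw [← Pi.single_smul]; simp
    rw [this, Matrix.mulVec_smul, hLu, hu, smul_smul, mul_inv_cancel₀ hl0.ne', one_smul]
  have hue := bil_comm hA u e
  have ex : ∀ s : ℝ, bil A (e + s • u) (e + s • u)
      = bil A e e + s * bil A e u + s * (bil A u e + s * bil A u u) := by
    intro s
    simp only [bil, Matrix.mulVec_add, Matrix.mulVec_smul, add_dotProduct, dotProduct_add,
      smul_dotProduct, dotProduct_smul, smul_eq_mul]
    ring
  have exe : ∀ s : ℝ, bil A (e + s • u) e = bil A e e + s * bil A u e := by
    intro s
    simp only [bil, add_dotProduct, smul_dotProduct, smul_eq_mul]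
  -- For unit timelike e and u, the reflection along e + s u with s = ±1 takes e to -s u, and the
  -- factor -s corrects the sign. The square of e + s u is -2 + 2 s A(e, u), so at least one of the
  -- two signs gives a non-null vector.
  have key : ∀ s : ℝ, s * s = 1 → bil A (e + s • u) (e + s • u) ≠ 0 →
      ∃ L : Mat, L.transpose * A * L = mink ∧ L.mulVec (Pi.single 0 1) = u := by
    intro s hs hx
    obtain ⟨r1, r2⟩ := reflection_congr hA hx
    set R := 1 - (2 / bil A (e + s • u) (e + s • u)) • Matrix.vecMulVec (e + s • u)
      (A.mulVec (e + s • u)) with hR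
    refine ⟨(-s) • (R * S), ?_, ?_⟩
    · rw [Matrix.transpose_smul, Matrix.smul_mul, Matrix.smul_mul, Matrix.mul_smul, smul_smul,
        Matrix.transpose_mul]
      have : S.transpose * R.transpose * A * (R * S) = S.transpose * (R.transpose * A * R) * S := by
        noncomm_ring
      rw [this, r1, hS, show -s * -s = 1 by linarith, one_smul]
    · rw [Matrix.smul_mulVec, ← Matrix.mulVec_mulVec, ← he, r2]
      have h2 : 2 * bil A (e + s • u) e / bil A (e + s • u) (e + s • u) = 1 := by
        rw [div_eq_one_iff_eq hx, exe, ex, hee, huu, hue]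
        linear_combination hs
      rw [h2, one_smul]
      have : e - (e + s • u) = (-s) • u := by rw [neg_smul]; abel
      rw [this, smul_smul, show -s * -s = 1 by linarith, one_smul]
  by_cases h0 : bil A e u = 1
  · refine key (-1) (by norm_num) ?_
    rw [ex, hee, huu, hue, h0]; norm_num
  · refine key 1 (by norm_num) ?_
    rw [ex, hee, huu, hue]
    intro h3; apply h0; linarith

lemma bil_mulVec_inv {A L : Mat} (hL : L.transpose * A * L = mink) :
    A⁻¹ = L * mink * L.transpose := by
  obtain ⟨hd, hA⟩ := det_ne_zero_of_frame hL
  have e1 : mink * mink = 1 := by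
    conv_lhs => rw [← mink_inv]
    rw [mink_inv]
    have := Matrix.nonsing_inv_mul mink (by rw [det_mink]; norm_num)
    rwa [mink_inv] at this
  refine Matrix.inv_eq_right_inv ?_
  have hu : IsUnit L.transpose := by
    rw [Matrix.isUnit_iff_isUnit_det, Matrix.det_transpose]; exact isUnit_iff_ne_zero.2 hd
  refine hu.mul_left_cancel ?_
  calc L.transpose * (A * (L * mink * L.transpose))
      = (L.transpose * A * L) * mink * L.transpose := by noncomm_ring
    _ = L.transpose * 1 := by rw [hL, e1]; simp

/-- The supermomentum of a Weyl candidate with respect to a timelike vector is causal, with the same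
time orientation. -/
lemma brCovector_causal {A : Mat} (hA : Lorentzian A) {w : Arr} (hw : WeylSym A w)
    {t v : Fin 4 → ℝ} (ht : bil A t t < 0) (hv : bil A v v < 0) (htv : bil A t v < 0) :
    let P : Fin 4 → ℝ := fun a => -∑ e, A⁻¹ a e * brCovector A w v e
    bil A P P ≤ 0 ∧ (P = 0 ∨ bil A t P < 0) := by
  intro P
  obtain ⟨L, M, hLM, hL, l, hl, hlv⟩ := hA.exists_frame hv
  have hdA := (det_ne_zero_of_frame hL).2
  set q := brCovector mink (frameArr L M w) (Pi.single 0 l) with hq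
  have hw' : WeylSym mink (frameArr L M w) := by rw [← hL]; exact hw.frame hLM
  have hqe : q = L.transpose.mulVec (brCovector A w v) := by
    funext e
    rw [hq, ← hL, brCovector_frame hLM A hdA, hlv]
    rfl
  obtain ⟨q0, q1⟩ := brCovector_mink_dominant hw' hl
  rw [← hq] at q0 q1
  -- In the frame, the supermomentum has components (q 0, -q i): the overall minus sign and the
  -- Minkowski metric together make its time component the nonnegative energy.
  have hP : P = L.mulVec (-mink.mulVec q) := by
    have : P = -(A⁻¹.mulVec (brCovector A w v)) := rfl
    rw [this, bil_mulVec_inv hL, ← Matrix.mulVec_mulVec, ← hqe, ← Matrix.mulVec_mulVec,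
      Matrix.mulVec_neg]
  have hM : ∀ i, (mink.mulVec q) i = (![-1, 1, 1, 1] : Fin 4 → ℝ) i * q i := by
    intro i; simp [mink, Matrix.mulVec_diagonal]
  set t' := M.mulVec t with ht'
  have htt : t = L.mulVec t' := by rw [ht', Matrix.mulVec_mulVec, hLM, Matrix.one_mulVec]
  rw [htt, bil_mulVec, hL, bil_mink] at ht
  rw [htt, ← hlv, bil_mulVec, hL, bil_mink] at htv
  simp at htv
  have ht0 : 0 < t' 0 := by nlinarith
  have hts : ∑ i : Fin 3, t' i.succ ^ 2 < t' 0 ^ 2 := by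
    have : ∑ i : Fin 3, t' i.succ ^ 2 = ∑ i : Fin 3, t' i.succ * t' i.succ :=
      Finset.sum_congr rfl fun i _ => sq _
    rw [this]; nlinarith
  constructor
  · rw [hP, bil_mulVec, hL, bil_mink]
    have : ∀ i : Fin 3, (-mink.mulVec q) i.succ * (-mink.mulVec q) i.succ = q i.succ ^ 2 := by
      intro i
      rw [Pi.neg_apply, hM]
      fin_cases i <;> simp <;> ring
    rw [Finset.sum_congr rfl fun i _ => this i, Pi.neg_apply, hM]
    simp
    nlinarith
  · by_cases h0 : q 0 = 0
    · left
      have hz : q = 0 := by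
        rw [h0] at q1
        have h2 := (Finset.sum_eq_zero_iff_of_nonneg (fun i _ => sq_nonneg (q (Fin.succ i)))).1
          (le_antisymm (by simpa using q1) (Finset.sum_nonneg fun i _ => sq_nonneg _))
        funext i
        refine Fin.cases h0 (fun j => ?_) i
        simpa using h2 j (Finset.mem_univ _)
      rw [hP, hz]; simp
    · right
      have hq0 : 0 < q 0 := lt_of_le_of_ne q0 (Ne.symm h0)
      rw [hP, htt, bil_mulVec, hL, bil_mink]
      have h1 : ∑ i : Fin 3, t' i.succ * (-mink.mulVec q) i.succ
          = -∑ i : Fin 3, t' i.succ * q i.succ := by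
        rw [← Finset.sum_neg_distrib]
        refine Finset.sum_congr rfl fun i _ => ?_
        rw [Pi.neg_apply, hM]
        fin_cases i <;> simp
      rw [h1, Pi.neg_apply, hM]
      simp
      -- Cauchy-Schwarz for the spatial parts; strictness comes from `t` being timelike and q 0
      -- positive.
      have h3 : (∑ i : Fin 3, t' i.succ * q i.succ) ^ 2 < (t' 0 * q 0) ^ 2 := by
        calc _ ≤ (∑ i : Fin 3, t' i.succ ^ 2) * ∑ i : Fin 3, q i.succ ^ 2 :=
              Finset.sum_mul_sq_le_sq_mul_sq _ _ _
          _ ≤ (∑ i : Fin 3, t' i.succ ^ 2) * q 0 ^ 2 := by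
              gcongr
          _ < t' 0 ^ 2 * q 0 ^ 2 := by gcongr
          _ = _ := by ring
      have := abs_lt_of_sq_lt_sq h3 (by positivity)
      linarith [(abs_lt.1 this).1]

/-- Two timelike vectors are not orthogonal. -/
lemma Lorentzian.bil_ne_zero {A : Mat} (hA : Lorentzian A) {t v : Fin 4 → ℝ} (ht : bil A t t < 0)
    (hv : bil A v v < 0) : bil A t v ≠ 0 := by
  obtain ⟨L, M, hLM, hL, l, hl, hlv⟩ := hA.exists_frame hv
  have htt : t = L.mulVec (M.mulVec t) := by rw [Matrix.mulVec_mulVec, hLM, Matrix.one_mulVec]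
  rw [htt, bil_mulVec, hL, bil_mink] at ht
  rw [htt, ← hlv, bil_mulVec, hL, bil_mink]
  intro h0
  simp at h0
  rcases h0 with h0 | h0
  · rw [h0] at ht
    have : 0 ≤ ∑ i : Fin 3, M.mulVec t i.succ * M.mulVec t i.succ :=
      Finset.sum_nonneg fun i _ => mul_self_nonneg _
    linarith
  · exact hl.ne' h0

/-- A Weyl candidate annihilated by a timelike vector vanishes. -/
lemma WeylSym.eq_zero_of_timelike {A : Mat} (hA : Lorentzian A) {w : Arr} (hw : WeylSym A w)
    {v : Fin 4 → ℝ} (hv : bil A v v < 0)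
    (h0 : ∀ a b c, ∑ d, w a b c d * A.mulVec v d = 0) (a b c d : Fin 4) : w a b c d = 0 := by
  obtain ⟨L, M, hLM, hL, l, hl, hlv⟩ := hA.exists_frame hv
  have hML : M * L = 1 := mul_eq_one_comm.1 hLM
  have hw' : WeylSym mink (frameArr L M w) := by rw [← hL]; exact hw.frame hLM
  have hT : M.transpose * L.transpose = 1 := by
    rw [← Matrix.transpose_mul, hLM, Matrix.transpose_one]
  -- Lowering the index of v, which is l times the first leg, gives -l times the first dual leg. The
  -- hypothesis thus says that the frame components with last index 0 vanish.
  have hAv : ∀ s, A.mulVec v s = -l * M 0 s := by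
    intro s
    have e1 : A.mulVec v = (M.transpose * mink).mulVec (Pi.single 0 l) := by
      rw [← hlv, Matrix.mulVec_mulVec, ← hL]
      congr 1
      calc A * L = (M.transpose * L.transpose) * (A * L) := by rw [hT, Matrix.one_mul]
        _ = _ := by noncomm_ring
    rw [e1]
    simp [mink]
    ring
  have hz : ∀ a b c, frameArr L M w a b c 0 = 0 := by
    intro a b c
    simp only [frameArr]
    refine Finset.sum_eq_zero fun p _ => Finset.sum_eq_zero fun q _ => Finset.sum_eq_zero fun r _ => ?_
    have h1 := h0 p q r
    simp only [hAv] at h1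
    have h2 : ∑ s, L p a * L q b * L r c * M 0 s * w p q r s
        = L p a * L q b * L r c * (-l)⁻¹ * ∑ s, w p q r s * (-l * M 0 s) := by
      rw [Finset.mul_sum]
      exact Finset.sum_congr rfl fun s _ => by field_simp
    rw [h2, h1, mul_zero]
  have hall := hw'.eq_zero hz
  -- The inverse change of frame recovers the array, so its vanishing in the frame is enough.
  have hback : frameArr M L (frameArr L M w) = w := by
    have hT' : M.transpose * L.transpose = 1 := hT
    rw [frameArr_eq M L, frameArr_eq L M]
    simp only [act3_act4, act2_act4, act1_act4]
    simp only [← act1_act4, ← act2_act4, ← act3_act4, act4_act4, hLM, act4_one]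
    simp only [act2_act3, act1_act3]
    simp only [← act1_act3, ← act2_act3]
    have h3 : ∀ u : Arr, act3 M.transpose (act3 L.transpose u) = u := by
      intro u; funext a b c d
      have := sum_mul_assoc_aux M.transpose L.transpose (fun q => u a b q d) c
      rw [hT] at this
      simpa [act3, Matrix.one_apply] using this
    rw [h3, ← act1_act2, act2_act2, hT, act2_one, act1_act1, hT, act1_one]
  rw [← hback]
  simp only [frameArr] at hall ⊢
  simp [hall]

end Scri

/-! ### Conformal change of the divergence of a Weyl candidate -/

namespace Scri

/-- An array antisymmetric in both pairs and with the cyclic identity has pair symmetry. -/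
lemma pair_symm_of {V : Arr} (hl : ∀ a b c d, V a b c d = -V b a c d)
    (hr : ∀ a b c d, V a b c d = -V a b d c)
    (hc : ∀ a b c d, V a b c d + V b c a d + V c a b d = 0) (a b c d : Fin 4) :
    V a b c d = V c d a b := by
  linarith [hc a b c d, hc b c d a, hc c d a b, hc d a b c, hl a b c d, hr a b c d, hl b c a d,
    hr b c a d, hl c a b d, hr c a b d, hl b c d a, hl c d b a,
    hr c d b a, hl d b c a, hr d b c a, hl c d a b, hr c d a b, hl d a c b, hr d a c b, hl a c d b,
    hr a c d b, hl d a b c, hr d a b c, hl a b d c, hr b d a c, hl b d a c, hl b a d c, hr a d b c]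

namespace MetricOn

variable {U : Set Coord} {G : MetricComp} {x : Coord}

lemma mono {V : Set Coord} (h : MetricOn U G) (hV : RelOpen V) (hVU : V ⊆ U) : MetricOn V G where
  toRelOpen := hV
  sm x hx := h.sm x (hVU hx)
  symm x hx := h.symm x (hVU hx)
  det x hx := h.det x (hVU hx)

lemma weylSym (h : MetricOn U G) (hx : x ∈ U) :
    WeylSym (G x) (fun a b c d => weyl G a b c d x) where
  anti_left a b c d := by
    simp only [weyl]
    rw [← Finset.sum_neg_distrib]
    exact Finset.sum_congr rfl fun e _ => by rw [weylLow_antisymm_left]; ring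
  anti_right a b c d := by
    rw [h.weyl_lower hx, h.weyl_lower hx, h.weylLow_antisymm_right hx]
  cyclic a b c d := by
    simp only [weyl]
    rw [← Finset.sum_add_distrib, ← Finset.sum_add_distrib]
    refine Finset.sum_eq_zero fun e _ => ?_
    rw [← add_mul, ← add_mul, h.weylLow_cyclic hx, zero_mul]
  trace a c := h.weyl_trace hx a c

/-- Change of the divergence of a Weyl candidate under a conformal rescaling in dimension four. -/
lemma covDiv_rescale (h : MetricOn U G) {φ : Coord → ℝ} (hφ : ∀ y ∈ U, SmAt φ y)
    (h0 : ∀ y ∈ U, φ y ≠ 0) (hx : x ∈ U) {W : Fin 4 → Fin 4 → Fin 4 → Fin 4 → Coord → ℝ}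
    (hW : WeylSym (G x) (fun a b c d => W a b c d x)) (a b c : Fin 4) :
    covDiv (Scri.rescale φ G) W a b c x = covDiv G W a b c x + ∑ d, dlog φ d x * W a b c d x := by
  set V : Arr := fun a b c d => ∑ e, W a b c e x * G x e d with hV
  have Vl : ∀ a b c d, V a b c d = -V b a c d := by
    intro a b c d
    simp only [hV]
    rw [← Finset.sum_neg_distrib]
    exact Finset.sum_congr rfl fun e _ => by rw [hW.anti_left a b]; ring
  have Vr : ∀ a b c d, V a b c d = -V a b d c := hW.anti_right
  have Vc : ∀ a b c d, V a b c d + V b c a d + V c a b d = 0 := by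
    intro a b c d
    simp only [hV]
    rw [← Finset.sum_add_distrib, ← Finset.sum_add_distrib]
    refine Finset.sum_eq_zero fun e _ => ?_
    rw [← add_mul, ← add_mul, hW.cyclic, zero_mul]
  have Vp := pair_symm_of Vl Vr Vc
  have tr : ∀ a c, ∑ d, W a d c d x = 0 := hW.trace
  have tr' : ∀ b c, ∑ d, W d b c d x = 0 := by
    intro b c
    have : ∑ d, W d b c d x = -∑ d, W b d c d x := by
      rw [← Finset.sum_neg_distrib]
      exact Finset.sum_congr rfl fun d _ => hW.anti_left d b c d
    rw [this, tr, neg_zero]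
  have tr'' : ∑ d, W a b d d x = 0 := by
    have h1 : ∀ d, W a b d d x = -W b d a d x - W d a b d x := fun d => by
      linarith [hW.cyclic a b d d]
    simp only [h1, Finset.sum_sub_distrib, Finset.sum_neg_distrib, tr, tr']
    simp
  have gsym := h.symm_apply hx
  simp only [covDiv, h.christoffel_rescale hφ h0 hx]
  set u : Fin 4 → ℝ := fun d => dlog φ d x with hu
  set v : Fin 4 → ℝ := fun d => dlogUp φ G d x with hv
  -- Each of the three lower indices contributes -u_d W_{abc}^d together with a contraction of the
  -- lowered array `V`, and the upper index contributes +4 u_d W_{abc}^d. The traces of W vanish,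
  -- the three `V` terms cancel by the cyclic identity and pair symmetry, and 4 - 3 = 1 remains.
  have k1 : ∑ d, ∑ e, confK φ G e d a x * W e b c d x
      = u a * ∑ d, W d b c d x + ∑ d, u d * W a b c d x - ∑ e, v e * V e b c a := by
    have : ∀ d, ∑ e, confK φ G e d a x * W e b c d x
        = u a * W d b c d x + u d * W a b c d x - ∑ e, v e * (W e b c d x * G x d a) := by
      intro d
      simp only [confK, kd, sub_mul, add_mul, ite_mul, one_mul, zero_mul, Finset.sum_sub_distrib,
        Finset.sum_add_distrib, Finset.sum_ite_eq', Finset.mem_univ, if_true]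
      congr 1
      exact Finset.sum_congr rfl fun e _ => by ring
    simp only [this, Finset.sum_sub_distrib, Finset.sum_add_distrib, ← Finset.mul_sum]
    congr 1
    rw [Finset.sum_comm]
    exact Finset.sum_congr rfl fun e _ => by rw [hV, Finset.mul_sum]
  have k2 : ∑ d, ∑ e, confK φ G e d b x * W a e c d x
      = u b * ∑ d, W a d c d x + ∑ d, u d * W a b c d x - ∑ e, v e * V a e c b := by
    have : ∀ d, ∑ e, confK φ G e d b x * W a e c d x
        = u b * W a d c d x + u d * W a b c d x - ∑ e, v e * (W a e c d x * G x d b) := by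
      intro d
      simp only [confK, kd, sub_mul, add_mul, ite_mul, one_mul, zero_mul, Finset.sum_sub_distrib,
        Finset.sum_add_distrib, Finset.sum_ite_eq', Finset.mem_univ, if_true]
      congr 1
      exact Finset.sum_congr rfl fun e _ => by ring
    simp only [this, Finset.sum_sub_distrib, Finset.sum_add_distrib, ← Finset.mul_sum]
    congr 1
    rw [Finset.sum_comm]
    exact Finset.sum_congr rfl fun e _ => by rw [hV, Finset.mul_sum]
  have k3 : ∑ d, ∑ e, confK φ G e d c x * W a b e d x
      = u c * ∑ d, W a b d d x + ∑ d, u d * W a b c d x - ∑ e, v e * V a b e c := by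
    have : ∀ d, ∑ e, confK φ G e d c x * W a b e d x
        = u c * W a b d d x + u d * W a b c d x - ∑ e, v e * (W a b e d x * G x d c) := by
      intro d
      simp only [confK, kd, sub_mul, add_mul, ite_mul, one_mul, zero_mul, Finset.sum_sub_distrib,
        Finset.sum_add_distrib, Finset.sum_ite_eq', Finset.mem_univ, if_true]
      congr 1
      exact Finset.sum_congr rfl fun e _ => by ring
    simp only [this, Finset.sum_sub_distrib, Finset.sum_add_distrib, ← Finset.mul_sum]
    congr 1
    rw [Finset.sum_comm]
    exact Finset.sum_congr rfl fun e _ => by rw [hV, Finset.mul_sum]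
  have k4 : ∑ d, ∑ e, confK φ G d d e x * W a b c e x = 4 * ∑ d, u d * W a b c d x := by
    rw [Finset.sum_comm]
    have : ∀ e, ∑ d, confK φ G d d e x * W a b c e x = 4 * (u e * W a b c e x) := by
      intro e
      rw [← Finset.sum_mul]
      have h1 : ∑ d, confK φ G d d e x = 4 * u e := by
        simp only [confK, kd, if_true, one_mul, Finset.sum_sub_distrib, Finset.sum_add_distrib,
          ite_mul, zero_mul, Finset.sum_ite_eq', Finset.mem_univ]
        have h2 : ∑ d, G x d e * dlogUp φ G d x = u e := by
          rw [show u e = dlog φ e x from rfl, ← h.sum_metric_dlogUp hx]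
          exact Finset.sum_congr rfl fun d _ => by rw [gsym]
        rw [h2]
        simp
        ring
      rw [h1]; ring
    simp only [this, Finset.mul_sum]
  have cyc : ∀ e, V e b c a + V a e c b + V a b e c = 0 := by
    intro e
    have h1 := Vp e b c a
    have h2 := Vp a e c b
    have h3 := Vc a b c e
    linarith [Vr c a e b, Vl c b a e, Vr a b e c]
  have cyc' : ∑ e, v e * V e b c a + ∑ e, v e * V a e c b + ∑ e, v e * V a b e c = 0 := by
    rw [← Finset.sum_add_distrib, ← Finset.sum_add_distrib]
    exact Finset.sum_eq_zero fun e _ => by rw [← mul_add, ← mul_add, cyc, mul_zero]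
  rw [tr', mul_zero, zero_add] at k1
  rw [tr, mul_zero, zero_add] at k2
  rw [tr'', mul_zero, zero_add] at k3
  simp only [add_mul, Finset.sum_add_distrib, Finset.sum_sub_distrib]
  simp only [hu] at k1 k2 k3 k4
  linarith

end MetricOn

end Scri

namespace Scri

/-! ### Defining functions of the boundary -/

/-- `Ω` is smooth on `U`, positive inside and zero on the boundary of the half-space. -/
structure DefFn (U : Set Coord) (Ω : Coord → ℝ) : Prop extends RelOpen U where
  smooth : ∀ x ∈ U, SmAt Ω x
  pos : ∀ x ∈ U, 0 < x 0 → 0 < Ω x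
  zero : ∀ x ∈ U, x 0 = 0 → Ω x = 0

lemma smAt_of_contDiffOn {F : Coord → ℝ} {B : Set Coord} (hF : ContDiffOn ℝ ∞ F B) {y : Coord}
    (hy : B ∈ 𝓝[HS] y) (hyB : y ∈ B) : SmAt F y :=
  (hF y hyB).mono_of_mem_nhdsWithin hy

namespace DefFn

variable {U : Set Coord} {Ω : Coord → ℝ} {x : Coord} (hD : DefFn U Ω)
include hD

lemma eq_zero_iff (hx : x ∈ U) : Ω x = 0 ↔ x 0 = 0 := by
  refine ⟨fun h => ?_, hD.zero x hx⟩
  rcases (mem_HS.1 (hD.sub hx)).eq_or_lt with h0 | h0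
  · exact h0.symm
  · exact absurd h (hD.pos x hx h0).ne'

lemma neBot (hx : x ∈ U) : (𝓝[{y | y ∈ HS ∧ 0 < Ω y}] x).NeBot := by
  have h1 : (𝓝[interior HS] x).NeBot :=
    mem_closure_iff_nhdsWithin_neBot.1 (mem_closure_interior_HS (hD.sub hx))
  refine h1.mono (nhdsWithin_le_iff.2 ?_)
  filter_upwards [nhdsWithin_mono x interior_subset (hD.nhd x hx), self_mem_nhdsWithin] with y hy hy'
  rw [interior_HS] at hy'
  exact ⟨hD.sub hy, hD.pos y hy hy'⟩

omit hD in
lemma phys_le : 𝓝[{y | y ∈ HS ∧ 0 < Ω y}] x ≤ 𝓝[HS] x := nhdsWithin_mono x fun _ h => h.1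

lemma eventually_phys (hx : x ∈ U) {p : Coord → Prop} (h : ∀ y ∈ U, 0 < Ω y → p y) :
    ∀ᶠ y in 𝓝[{y | y ∈ HS ∧ 0 < Ω y}] x, p y := by
  filter_upwards [phys_le (hD.nhd x hx), self_mem_nhdsWithin] with y hy hy'
  exact h y hy hy'.2

/-- Continuous functions that agree on `{Ω > 0}` agree. -/
lemma eq_of_eq_pos (hx : x ∈ U) {f g : Coord → ℝ} (hf : ContinuousWithinAt f HS x)
    (hg : ContinuousWithinAt g HS x) (h : ∀ᶠ y in 𝓝[{y | y ∈ HS ∧ 0 < Ω y}] x, f y = g y) :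
    f x = g x := by
  have := hD.neBot hx
  exact tendsto_nhds_unique_of_eventuallyEq (hf.mono_left phys_le) (hg.mono_left phys_le) h

lemma eq_zero_of_isBigO (hx : x ∈ U) (h0 : x 0 = 0) {f : Coord → ℝ} (hf : ContinuousWithinAt f HS x)
    {m : ℕ} (h : f =O[𝓝[{y | y ∈ HS ∧ 0 < Ω y}] x] fun y => Ω y ^ (m + 1)) : f x = 0 := by
  have := hD.neBot hx
  have h1 : Tendsto (fun y => Ω y ^ (m + 1)) (𝓝[{y | y ∈ HS ∧ 0 < Ω y}] x) (𝓝 0) := by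
    have h2 := ((hD.smooth x hx).pow (m + 1)).continuousWithinAt.tendsto.mono_left
      (phys_le (Ω := Ω) (x := x))
    rwa [hD.zero x hx h0, zero_pow (Nat.succ_ne_zero m)] at h2
  exact tendsto_nhds_unique (hf.mono_left phys_le) (h.trans_tendsto h1)

lemma region : RelOpen {y | y ∈ U ∧ 0 < Ω y} where
  sub _ hy := hD.sub hy.1
  nhd y hy := by
    filter_upwards [hD.nhd y hy.1, (hD.smooth y hy.1).continuousWithinAt.eventually_const_lt hy.2]
      with z hz hz' using ⟨hz, hz'⟩

/-- A half-ball inside `U`. -/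
lemma exists_ball (hx : x ∈ U) : ∃ r, 0 < r ∧ Metric.ball x r ∩ HS ⊆ U := by
  obtain ⟨r, hr, h⟩ := Metric.mem_nhdsWithin_iff.1 (hD.nhd x hx)
  exact ⟨r, hr, h⟩

omit hD in
lemma ball_mem {r : ℝ} {y : Coord} (hy : y ∈ Metric.ball x r ∩ HS) :
    Metric.ball x r ∩ HS ∈ 𝓝[HS] y :=
  inter_mem (mem_nhdsWithin_of_mem_nhds (Metric.isOpen_ball.mem_nhds hy.1)) self_mem_nhdsWithin

variable (hN : ∀ y ∈ U, y 0 = 0 → ∃ a, pd a Ω y ≠ 0)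
include hN

/-- Hadamard's lemma gives Ω = y₀ H. A zero of H on the boundary would make the gradient of Ω vanish
there, and one inside would contradict positivity. -/
lemma exists_coord_factor (h0 : x 0 = 0) {r : ℝ} (hB : Metric.ball x r ∩ HS ⊆ U) :
    ∃ H : Coord → ℝ, ContDiffOn ℝ ∞ H (Metric.ball x r ∩ HS) ∧
      ∀ y ∈ Metric.ball x r ∩ HS, H y ≠ 0 ∧ Ω y = y 0 * H y := by
  obtain ⟨H, hH, hΩ⟩ := exists_eq_coord_mul h0 (F := Ω)
    (fun y hy => (hD.smooth y (hB hy)).mono inter_subset_right)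
    (fun y hy hy0 => hD.zero y (hB ⟨hy, mem_HS.2 hy0.ge⟩) hy0)
  refine ⟨H, hH, fun y hy => ⟨fun hz => ?_, hΩ y hy⟩⟩
  rcases (mem_HS.1 hy.2).eq_or_lt with hy0 | hy0
  · obtain ⟨a, ha⟩ := hN y (hB hy) hy0.symm
    apply ha
    have hc : SmAt (fun y : Coord => y 0) y :=
      (EuclideanSpace.proj (𝕜 := ℝ) (0 : Fin 4)).contDiff.contDiffWithinAt
    have hHs := smAt_of_contDiffOn hH (ball_mem hy) hy
    rw [pd_congr hy.2 (g := fun y => y 0 * H y)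
      (by filter_upwards [ball_mem hy] with z hz using hΩ z hz), pd_mul hy.2 a hc.dAt hHs.dAt,
      hz, ← hy0]
    ring
  · have := hD.pos y (hB hy) hy0
    rw [hΩ y hy, hz, mul_zero] at this
    exact lt_irrefl _ this

/-- Induction on the order: the quotient by Ω^m is O(Ω), hence zero on the boundary, hence divisible
once more by the zeroth coordinate. That coordinate is then exchanged for Ω by
`exists_coord_factor`. -/
lemma exists_eq_pow_mul (h0 : x 0 = 0) {r : ℝ} (hB : Metric.ball x r ∩ HS ⊆ U) (m : ℕ)
    {F : Coord → ℝ} (hF : ContDiffOn ℝ ∞ F (Metric.ball x r ∩ HS))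
    (hO : ∀ y ∈ Metric.ball x r ∩ HS, y 0 = 0 →
      F =O[𝓝[{y | y ∈ HS ∧ 0 < Ω y}] y] fun y => Ω y ^ m) :
    ∃ H : Coord → ℝ, ContDiffOn ℝ ∞ H (Metric.ball x r ∩ HS) ∧
      ∀ y ∈ Metric.ball x r ∩ HS, F y = Ω y ^ m * H y := by
  obtain ⟨h, hh, hΩ⟩ := hD.exists_coord_factor hN h0 hB
  induction m with
  | zero => exact ⟨F, hF, fun y _ => by simp⟩
  | succ m ih =>
    obtain ⟨H, hH, hFH⟩ := ih fun y hy hy0 => by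
      refine (hO y hy hy0).trans ?_
      have hb : (fun y => Ω y ^ (m + 1)) = fun y => Ω y ^ m * Ω y := by funext y; ring
      rw [hb]
      have h1 : Ω =O[𝓝[{y | y ∈ HS ∧ 0 < Ω y}] y] fun _ => (1 : ℝ) :=
        ((hD.smooth y (hB hy)).continuousWithinAt.tendsto.mono_left phys_le).isBigO_one ℝ
      simpa using (isBigO_refl (fun y => Ω y ^ m) _).mul h1
    have hz : ∀ y ∈ Metric.ball x r, y 0 = 0 → H y = 0 := by
      intro y hy hy0
      have hyB : y ∈ Metric.ball x r ∩ HS := ⟨hy, mem_HS.2 hy0.ge⟩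
      refine hD.eq_zero_of_isBigO (hB hyB) hy0 (m := 0)
        (smAt_of_contDiffOn hH (ball_mem hyB) hyB).continuousWithinAt ?_
      have h1 := (hO y hyB hy0).mul (isBigO_refl (fun y => (Ω y ^ m)⁻¹) _)
      refine IsBigO.congr' h1 ?_ ?_
      · filter_upwards [phys_le (ball_mem hyB), self_mem_nhdsWithin] with z hz hz'
        have := hz'.2.ne'
        rw [hFH z hz]
        field_simp
      · filter_upwards [self_mem_nhdsWithin] with z hz'
        have := hz'.2.ne'
        field_simp
        ring
    obtain ⟨K, hK, hHK⟩ := exists_eq_coord_mul h0 hH hz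
    refine ⟨fun y => K y * (h y)⁻¹, hK.mul (hh.inv fun y hy => (hΩ y hy).1), fun y hy => ?_⟩
    obtain ⟨hne, hy'⟩ := hΩ y hy
    rw [hFH y hy, hHK y hy]
    have : y 0 = Ω y * (h y)⁻¹ := by rw [hy']; field_simp
    rw [this]; ring

end DefFn

/-! ### The physical metric -/

/-- `-Ω ∇_b N_c + (1/2) N² g_{bc}`. -/
noncomputable def physX (G : MetricComp) (Ω : Coord → ℝ) (b c : Fin 4) (x : Coord) : ℝ :=
  -(Ω x * hessian G Ω b c x) + (1 / 2) * normalSq G Ω x * G x b c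

/-- Trace of `physX`. -/
noncomputable def physTr (G : MetricComp) (Ω : Coord → ℝ) (x : Coord) : ℝ :=
  ∑ b, ∑ c, ginv G x b c * physX G Ω b c x

/-- `Ω²` times the physical energy-momentum tensor. -/
noncomputable def emNum (κ Λ : ℝ) (G : MetricComp) (Ω : Coord → ℝ) (a b : Fin 4) (x : Coord) : ℝ :=
  κ⁻¹ * (Ω x ^ 2 * ricci G a b x - 2 * physX G Ω a b x - G x a b * physTr G Ω x
    - (1 / 2) * (Ω x ^ 2 * scalarCurv G x - 6 * physTr G Ω x) * G x a b + Λ * G x a b)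

lemma physicalMetric_eq (G : MetricComp) (Ω : Coord → ℝ) :
    physicalMetric G Ω = rescale (fun y => (Ω y)⁻¹) G := by
  funext y; simp [physicalMetric, rescale]

section physical

variable {U : Set Coord} {G : MetricComp} {Ω : Coord → ℝ} {x : Coord} (h : MetricOn U G)
  (hΩ : ∀ y ∈ U, SmAt Ω y)
include h hΩ

lemma sm_normal (hx : x ∈ U) (a : Fin 4) : SmAt (fun y => normal G Ω y a) x :=
  SmAt.sum fun b _ => (h.sm_ginv hx a b).mul ((hΩ x hx).pd (h.hs hx) b)

lemma sm_normalSq (hx : x ∈ U) : SmAt (normalSq G Ω) x :=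
  SmAt.sum fun a _ => ((hΩ x hx).pd (h.hs hx) a).mul (sm_normal h hΩ hx a)

lemma sm_hessian (hx : x ∈ U) (a b : Fin 4) : SmAt (hessian G Ω a b) x :=
  (((hΩ x hx).pd (h.hs hx) b).pd (h.hs hx) a).sub
    (SmAt.sum fun c _ => (h.sm_christoffel hx c a b).mul ((hΩ x hx).pd (h.hs hx) c))

lemma sm_physX (hx : x ∈ U) (a b : Fin 4) : SmAt (physX G Ω a b) x :=
  ((hΩ x hx).mul (sm_hessian h hΩ hx a b)).neg.add
    (((SmAt.const _).mul (sm_normalSq h hΩ hx)).mul (h.sm x hx a b))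

lemma sm_physTr (hx : x ∈ U) : SmAt (physTr G Ω) x :=
  SmAt.sum fun a _ => SmAt.sum fun b _ => (h.sm_ginv hx a b).mul (sm_physX h hΩ hx a b)

lemma sm_emNum (κ Λ : ℝ) (hx : x ∈ U) (a b : Fin 4) : SmAt (emNum κ Λ G Ω a b) x :=
  (SmAt.const _).mul ((((((hΩ x hx).pow 2).mul (h.sm_ricci hx a b)).sub
    ((SmAt.const _).mul (sm_physX h hΩ hx a b))).sub
    ((h.sm x hx a b).mul (sm_physTr h hΩ hx))).sub
    (((SmAt.const _).mul ((((hΩ x hx).pow 2).mul (h.sm_scalarCurv hx)).sub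
      ((SmAt.const _).mul (sm_physTr h hΩ hx)))).mul (h.sm x hx a b)) |>.add
    ((SmAt.const _).mul (h.sm x hx a b)))

omit hΩ in
lemma sum_ginv_metric (hx : x ∈ U) : ∑ a, ∑ b, ginv G x a b * G x a b = 4 := by
  have : ∀ a, ∑ b, ginv G x a b * G x a b = 1 := by
    intro a
    have := h.sum_ginv_mul hx a a
    rw [if_pos rfl] at this
    rw [← this]
    exact Finset.sum_congr rfl fun b _ => by rw [h.symm_apply hx]
  simp [this]

omit hΩ in
lemma trace_emNum {κ : ℝ} (hκ : κ ≠ 0) (Λ : ℝ) (hx : x ∈ U) :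
    κ * ∑ a, ∑ b, ginv G x a b * emNum κ Λ G Ω a b x
      = -(Ω x ^ 2 * scalarCurv G x) + 6 * physTr G Ω x + 4 * Λ := by
  have e : ∀ a b, κ * (ginv G x a b * emNum κ Λ G Ω a b x) = Ω x ^ 2 * (ginv G x a b * ricci G a b x)
      - 2 * (ginv G x a b * physX G Ω a b x) + (-physTr G Ω x - (1 / 2) * (Ω x ^ 2 * scalarCurv G x
      - 6 * physTr G Ω x) + Λ) * (ginv G x a b * G x a b) := by
    intro a b
    rw [emNum]; field_simp; ring
  simp only [Finset.mul_sum, e]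
  simp only [Finset.sum_add_distrib, Finset.sum_sub_distrib, ← Finset.mul_sum, sum_ginv_metric h hx]
  simp only [scalarCurv, physTr]
  ring

variable (h0 : ∀ y ∈ U, Ω y ≠ 0)
include h0

lemma dlog_inv (hx : x ∈ U) (a : Fin 4) :
    dlog (fun y => (Ω y)⁻¹) a x = -((Ω x)⁻¹ * pd a Ω x) := by
  have := h0 x hx
  rw [dlog, pd_inv (h.hs hx) a (hΩ x hx).dAt this]
  field_simp

/-- For the factor Ω⁻¹ the terms quadratic in the gradient with free indices cancel between ∂u and u
⊗ u. The pole therefore has order two only, with the coefficient `physX`, smooth up to the boundary.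
-/
lemma confX_inv (hx : x ∈ U) (b c : Fin 4) :
    confX (fun y => (Ω y)⁻¹) G b c x = (Ω x ^ 2)⁻¹ * physX G Ω b c x := by
  have hs := h.hs hx
  have hne := h0 x hx
  have e1 : pd b (dlog (fun y => (Ω y)⁻¹) c) x
      = (Ω x)⁻¹ ^ 2 * pd b Ω x * pd c Ω x - (Ω x)⁻¹ * pd b (pd c Ω) x := by
    rw [pd_congr hs (h.eventually hx fun y hy => dlog_inv h hΩ h0 hy c), pd_neg hs,
      pd_mul hs b ((hΩ x hx).inv hne).dAt ((hΩ x hx).pd hs c).dAt,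
      pd_inv hs b (hΩ x hx).dAt hne]
    ring
  have e2 : dlogSq (fun y => (Ω y)⁻¹) G x = (Ω x)⁻¹ ^ 2 * normalSq G Ω x := by
    simp only [dlogSq, dlogUp, dlog_inv h hΩ h0 hx, normalSq, normal, normalLow, Finset.mul_sum]
    exact Finset.sum_congr rfl fun a _ => Finset.sum_congr rfl fun b _ => by ring
  have e3 : ∑ e, christoffel G e b c x * dlog (fun y => (Ω y)⁻¹) e x
      = -((Ω x)⁻¹ * ∑ e, christoffel G e b c x * pd e Ω x) := by
    simp only [dlog_inv h hΩ h0 hx, Finset.mul_sum, ← Finset.sum_neg_distrib]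
    exact Finset.sum_congr rfl fun a _ => by ring
  rw [confX, e1, e2, e3, dlog_inv h hΩ h0 hx, dlog_inv h hΩ h0 hx, physX, hessian]
  field_simp
  ring

lemma sum_confXUp_inv (hx : x ∈ U) :
    ∑ b, confXUp (fun y => (Ω y)⁻¹) G b b x = (Ω x ^ 2)⁻¹ * physTr G Ω x := by
  simp only [confXUp, confX_inv h hΩ h0 hx, physTr, Finset.mul_sum]
  exact Finset.sum_congr rfl fun a _ => Finset.sum_congr rfl fun b _ => by ring

lemma scalarCurv_physical (hx : x ∈ U) : scalarCurv (physicalMetric G Ω) x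
    = Ω x ^ 2 * scalarCurv G x - 6 * physTr G Ω x := by
  have hne := h0 x hx
  rw [physicalMetric_eq, h.scalarCurv_rescale (fun y hy => (hΩ y hy).inv (h0 y hy))
    (fun y hy => inv_ne_zero (h0 y hy)) hx, sum_confXUp_inv h hΩ h0 hx]
  field_simp

lemma energyMomentum_physical (κ Λ : ℝ) (hx : x ∈ U) (a b : Fin 4) :
    energyMomentum κ Λ (physicalMetric G Ω) a b x = (Ω x ^ 2)⁻¹ * emNum κ Λ G Ω a b x := by
  have hne := h0 x hx
  rw [energyMomentum, scalarCurv_physical h hΩ h0 hx, physicalMetric_eq,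
    h.ricci_rescale (fun y hy => (hΩ y hy).inv (h0 y hy)) (fun y hy => inv_ne_zero (h0 y hy)) hx,
    sum_confXUp_inv h hΩ h0 hx, confX_inv h hΩ h0 hx, emNum]
  simp only [rescale, Matrix.smul_apply, smul_eq_mul]
  field_simp

end physical

end Scri

/-! ### Consequences of the Einstein equations in a coordinate patch -/

namespace Scri

/-- Decay of the physical energy-momentum tensor in a coordinate patch. -/
def DecayOn (κ Λ : ℝ) (U : Set Coord) (G : MetricComp) (Ω : Coord → ℝ) (k : ℕ) : Prop :=
  ∀ x ∈ U, Ω x = 0 → ∀ a b, energyMomentum κ Λ (physicalMetric G Ω) a b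
    =O[𝓝[{y | y ∈ HS ∧ 0 < Ω y}] x] fun y => Ω y ^ k

/-- A conformal completion in a coordinate patch. -/
structure CompletionOn (κ Λ : ℝ) (U : Set Coord) (G : MetricComp) (Ω : Coord → ℝ) : Prop
    extends MetricOn U G, DefFn U Ω where
  kappa : 0 < κ
  lam : 0 < Λ
  lorentz : ∀ x ∈ U, Lorentzian (G x)
  decay : DecayOn κ Λ U G Ω 1

namespace CompletionOn

variable {κ Λ : ℝ} {U : Set Coord} {G : MetricComp} {Ω : Coord → ℝ} {x : Coord}
  (hC : CompletionOn κ Λ U G Ω)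
include hC

lemma smΩ (hx : x ∈ U) : SmAt Ω x := hC.toDefFn.smooth x hx

lemma met : MetricOn U G := hC.toMetricOn

lemma metRegion : MetricOn {y | y ∈ U ∧ 0 < Ω y} G := hC.met.mono hC.toDefFn.region fun _ h => h.1

lemma emNum_isBigO {k : ℕ} (hk : DecayOn κ Λ U G Ω k) (hx : x ∈ U) (h0 : Ω x = 0) (a b : Fin 4) :
    emNum κ Λ G Ω a b =O[𝓝[{y | y ∈ HS ∧ 0 < Ω y}] x] fun y => Ω y ^ (k + 2) := by
  refine ((hk x hx h0 a b).mul (isBigO_refl (fun y => Ω y ^ 2) _)).congr' ?_ ?_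
  · refine hC.toDefFn.eventually_phys hx fun y hy hpos => ?_
    have := hpos.ne'
    change energyMomentum κ Λ (physicalMetric G Ω) a b y * Ω y ^ 2 = _
    rw [energyMomentum_physical hC.metRegion (fun z hz => hC.smΩ hz.1) (fun z hz => hz.2.ne') κ Λ
      (show y ∈ {y | y ∈ U ∧ 0 < Ω y} from ⟨hy, hpos⟩)]
    field_simp
  · exact Eventually.of_forall fun y => by ring

/-- The gradient of `Ω` at the boundary. -/
lemma normalSq_eq (hx : x ∈ U) (h0 : x 0 = 0) : normalSq G Ω x = -Λ / 3 := by
  have hz := hC.zero x hx h0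
  -- Multiplication by Ω² raises the decay order from 1 to 3, so `emNum` vanishes at the boundary.
  -- There `physX` reduces to (1/2) N_a N^a g, its trace is 2 N_a N^a, and the trace of `emNum`
  -- becomes 12 N_a N^a + 4Λ up to the factor κ.
  have he : ∀ a b, emNum κ Λ G Ω a b x = 0 := fun a b =>
    hC.toDefFn.eq_zero_of_isBigO hx h0
      (sm_emNum hC.met (fun y hy => hC.smΩ hy) κ Λ hx a b).continuousWithinAt
      (hC.emNum_isBigO hC.decay hx hz a b)
  have ht := trace_emNum hC.met (Ω := Ω) hC.kappa.ne' Λ hx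
  have htr : physTr G Ω x = 2 * normalSq G Ω x := by
    have e : ∀ a b, ginv G x a b * physX G Ω a b x
        = (1 / 2) * normalSq G Ω x * (ginv G x a b * G x a b) := by
      intro a b; rw [physX, hz]; ring
    simp only [physTr, e, ← Finset.mul_sum, sum_ginv_metric hC.met hx]
    ring
  simp only [he, mul_zero, Finset.sum_const_zero, hz, htr] at ht
  linarith

lemma exists_pd_ne_zero (y : Coord) (hy : y ∈ U) (h0 : y 0 = 0) : ∃ a, pd a Ω y ≠ 0 := by
  by_contra! hcon
  have := hC.normalSq_eq hy h0
  simp only [normalSq, normalLow, hcon, zero_mul, Finset.sum_const_zero] at this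
  have := hC.lam
  linarith

/-- Factorisation of the energy-momentum tensor in a half-ball. -/
lemma exists_emNum_factor {k : ℕ} (hk : DecayOn κ Λ U G Ω k) (h0 : x 0 = 0) {r : ℝ}
    (hB : Metric.ball x r ∩ HS ⊆ U) : ∃ H : Fin 4 → Fin 4 → Coord → ℝ,
      (∀ a b, ∀ y ∈ Metric.ball x r ∩ HS, SmAt (H a b) y) ∧
      ∀ a b, ∀ y ∈ Metric.ball x r ∩ HS, emNum κ Λ G Ω a b y = Ω y ^ (k + 2) * H a b y := by
  have : ∀ a b, ∃ H : Coord → ℝ, ContDiffOn ℝ ∞ H (Metric.ball x r ∩ HS) ∧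
      ∀ y ∈ Metric.ball x r ∩ HS, emNum κ Λ G Ω a b y = Ω y ^ (k + 2) * H y := fun a b =>
    hC.toDefFn.exists_eq_pow_mul hC.exists_pd_ne_zero h0 hB (k + 2)
      (fun y hy => ContDiffWithinAt.mono
        (sm_emNum hC.met (fun y hy => hC.smΩ hy) κ Λ (hB hy) a b) inter_subset_right)
      (fun y hy hy0 => hC.emNum_isBigO hk (hB hy) (hC.zero y (hB hy) hy0) a b)
  choose H hH hH' using this
  exact ⟨H, fun a b y hy => smAt_of_contDiffOn (hH a b) (DefFn.ball_mem hy) hy, hH'⟩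

/-- The contracted Bianchi identity of the physical metric in terms of the unphysical one. -/
lemma exists_weyl_divergence {k : ℕ} (hk : DecayOn κ Λ U G Ω k) (h0 : x 0 = 0) {r : ℝ}
    (hB : Metric.ball x r ∩ HS ⊆ U) : ∃ Z : Fin 4 → Fin 4 → Fin 4 → Coord → ℝ,
      (∀ a b c, ∀ y ∈ Metric.ball x r ∩ HS, SmAt (Z a b c) y) ∧
      ∀ a b c, ∀ y ∈ Metric.ball x r ∩ HS, 0 < Ω y →
        Ω y * covDiv G (weyl G) a b c y - ∑ d, pd d Ω y * weyl G a b c d y = Ω y ^ k * Z a b c y := by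
  obtain ⟨H, hH, hHe⟩ := hC.exists_emNum_factor hk h0 hB
  have hm := hC.met
  have hs : ∀ y ∈ Metric.ball x r ∩ HS, y ∈ HS := fun y hy => hy.2
  set η : Coord → ℝ := fun y => ∑ a, ∑ b, ginv G y a b * H a b y with hη
  have smη : ∀ y ∈ Metric.ball x r ∩ HS, SmAt η y := fun y hy =>
    SmAt.sum fun a _ => SmAt.sum fun b _ => (hm.sm_ginv (hB hy) a b).mul (hH a b y hy)
  -- `K` is Ω times the difference of the physical and unphysical connections, which makes it smooth
  -- up to the boundary (`hKe`).
  set K : Fin 4 → Fin 4 → Fin 4 → Coord → ℝ := fun d a c y =>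
    -(kd d a * pd c Ω y + kd d c * pd a Ω y - G y a c * normal G Ω y d) with hK
  have smN : ∀ y ∈ Metric.ball x r ∩ HS, ∀ a, SmAt (pd a Ω) y := fun y hy a =>
    (hC.smΩ (hB hy)).pd hy.2 a
  have smK : ∀ d a c, ∀ y ∈ Metric.ball x r ∩ HS, SmAt (K d a c) y := fun d a c y hy =>
    ((((SmAt.const _).mul (smN y hy c)).add ((SmAt.const _).mul (smN y hy a))).sub
      ((hm.sm y (hB hy) a c).mul (sm_normal hm (fun y hy => hC.smΩ hy) (hB hy) d))).neg
  -- Ω^k `Y` is Ω times the physical covariant derivative of Ω^k `H`, that is, of the physical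
  -- energy-momentum tensor (`hcov2`).
  set Y : Fin 4 → Fin 4 → Fin 4 → Coord → ℝ := fun b a c y => Ω y * cov2 G H b a c y
    - ∑ e, (K e b a y * H e c y + K e b c y * H a e y) + k * (pd b Ω y * H a c y) with hY
  have smcov : ∀ b a c, ∀ y ∈ Metric.ball x r ∩ HS, SmAt (cov2 G H b a c) y := fun b a c y hy =>
    ((hH a c y hy).pd hy.2 b).sub (SmAt.sum fun e _ =>
      ((hm.sm_christoffel (hB hy) e b a).mul (hH e c y hy)).add
        ((hm.sm_christoffel (hB hy) e b c).mul (hH a e y hy)))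
  have smY : ∀ b a c, ∀ y ∈ Metric.ball x r ∩ HS, SmAt (Y b a c) y := fun b a c y hy =>
    (((hC.smΩ (hB hy)).mul (smcov b a c y hy)).sub (SmAt.sum fun e _ =>
      ((smK e b a y hy).mul (hH e c y hy)).add ((smK e b c y hy).mul (hH a e y hy)))).add
      ((SmAt.const _).mul ((smN y hy b).mul (hH a c y hy)))
  -- The physical scalar curvature is 4Λ - κ Ω^(k+2) `η`, and `Q` is what remains of Ω times its
  -- gradient once -κ Ω^(k+2) is taken out (`hpR`).
  set Q : Fin 4 → Coord → ℝ := fun b y => (k + 2) * (pd b Ω y * η y) + Ω y * pd b η y with hQ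
  have smQ : ∀ b, ∀ y ∈ Metric.ball x r ∩ HS, SmAt (Q b) y := fun b y hy =>
    ((SmAt.const _).mul ((smN y hy b).mul (smη y hy))).add
      ((hC.smΩ (hB hy)).mul ((smη y hy).pd hy.2 b))
  refine ⟨fun a b c y => κ / 2 * (Y b a c y - Y a b c y) - κ / 6 * (G y a c * Q b y - G y b c * Q a y),
    fun a b c y hy => ((SmAt.const _).mul ((smY b a c y hy).sub (smY a b c y hy))).sub
      ((SmAt.const _).mul (((hm.sm y (hB hy) a c).mul (smQ b y hy)).sub
        ((hm.sm y (hB hy) b c).mul (smQ a y hy)))), fun a b c y hy hpos => ?_⟩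
  -- the physical region
  set V := {y | y ∈ Metric.ball x r ∩ HS ∧ 0 < Ω y} with hV
  have hVr : RelOpen V :=
    { sub := fun z hz => hz.1.2
      nhd := fun z hz => by
        filter_upwards [DefFn.ball_mem hz.1,
          (hC.smΩ (hB hz.1)).continuousWithinAt.eventually_const_lt hz.2] with w hw hw' using ⟨hw, hw'⟩ }
  have hmV : MetricOn V G := hm.mono hVr fun z hz => hB hz.1
  have hyV : y ∈ V := ⟨hy, hpos⟩
  have sΩ : ∀ z ∈ V, SmAt Ω z := fun z hz => hC.smΩ (hB hz.1)
  have nΩ : ∀ z ∈ V, Ω z ≠ 0 := fun z hz => hz.2.ne'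
  set φ : Coord → ℝ := fun z => (Ω z)⁻¹ with hφ
  have sφ : ∀ z ∈ V, SmAt φ z := fun z hz => (sΩ z hz).inv (nΩ z hz)
  have nφ : ∀ z ∈ V, φ z ≠ 0 := fun z hz => inv_ne_zero (nΩ z hz)
  have hmP : MetricOn V (rescale φ G) := hmV.rescale sφ nφ
  set P := rescale φ G with hP
  have hPe : physicalMetric G Ω = P := physicalMetric_eq G Ω
  have hyh : y ∈ HS := hy.2
  have hne := nΩ y hyV
  -- scalar curvature
  have hR : ∀ z ∈ V, scalarCurv P z = 4 * Λ - κ * (Ω z ^ (k + 2) * η z) := by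
    intro z hz
    rw [← hPe, scalarCurv_physical hmV sΩ nΩ hz]
    have h1 := trace_emNum hmV (Ω := Ω) hC.kappa.ne' Λ hz
    have h2 : ∑ a, ∑ b, ginv G z a b * emNum κ Λ G Ω a b z = Ω z ^ (k + 2) * η z := by
      simp only [hη, Finset.mul_sum]
      exact Finset.sum_congr rfl fun a _ => Finset.sum_congr rfl fun b _ => by
        rw [hHe a b z hz.1]; ring
    rw [h2] at h1
    linarith
  have hpR : ∀ b, Ω y * pd b (scalarCurv P) y = -κ * Ω y ^ (k + 2) * Q b y := by
    intro b
    rw [pd_congr hyh (hVr.eventually hyV hR), pd_sub hyh b (SmAt.const _).dAt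
      ((SmAt.const κ).mul (((sΩ y hyV).pow _).mul (smη y hy))).dAt, pd_const hyh,
      pd_const_mul hyh b κ (((sΩ y hyV).pow _).mul (smη y hy)).dAt,
      pd_mul hyh b ((sΩ y hyV).pow _).dAt (smη y hy).dAt, pd_pow hyh b _ (sΩ y hyV).dAt]
    simp only [hQ]
    push_cast
    ring
  -- Ricci tensor
  have hT : ∀ a b, ∀ z ∈ V, ricci P a b z
      = κ * (Ω z ^ k * H a b z) + (1 / 2 * scalarCurv P z - Λ) * P z a b := by
    intro a b z hz
    have h1 := energyMomentum_physical hmV sΩ nΩ κ Λ hz a b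
    have := nΩ z hz
    have hk0 := hC.kappa.ne'
    rw [hHe a b z hz.1, hPe, energyMomentum] at h1
    have h2 : ricci P a b z - 1 / 2 * scalarCurv P z * P z a b + Λ * P z a b
        = κ * ((Ω z ^ 2)⁻¹ * (Ω z ^ (k + 2) * H a b z)) := by
      rw [← h1]; field_simp
    have h3 : (Ω z ^ 2)⁻¹ * (Ω z ^ (k + 2) * H a b z) = Ω z ^ k * H a b z := by
      rw [pow_add]; field_simp
    rw [h3] at h2
    linarith
  have smR : SmAt (fun z => 1 / 2 * scalarCurv P z - Λ) y :=
    ((SmAt.const _).mul (hmP.sm_scalarCurv hyV)).sub (SmAt.const _)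
  have hcov : ∀ b a c, cov2 P (ricci P) b a c y
      = κ * cov2 P (fun a c z => Ω z ^ k * H a c z) b a c y
        + 1 / 2 * pd b (scalarCurv P) y * P y a c := by
    intro b a c
    have d1 : ∀ a b, DAt (fun z => Ω z ^ k * H a b z) y := fun a b =>
      (((sΩ y hyV).pow k).mul (hH a b y hy)).dAt
    have d2 : ∀ a b, DAt (fun z => P z a b) y := fun a b => (hmP.sm y hyV a b).dAt
    rw [cov2_congr hyh (fun a b => hVr.eventually hyV (hT a b)),
      cov2_add hyh (F := fun a b z => κ * (Ω z ^ k * H a b z))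
        (F' := fun a b z => (1 / 2 * scalarCurv P z - Λ) * P z a b)
        (fun a b => (SmAt.const κ).dAt.fun_mul (d1 a b)) (fun a b => smR.dAt.fun_mul (d2 a b)),
      cov2_smul hyh (f := fun _ => κ) (SmAt.const κ).dAt d1, cov2_smul hyh smR.dAt d2,
      hmP.cov2_metric hyV, pd_const hyh, pd_sub hyh b ((SmAt.const _).mul
        (hmP.sm_scalarCurv hyV)).dAt (SmAt.const _).dAt, pd_const hyh,
      pd_const_mul hyh b _ (hmP.sm_scalarCurv hyV).dAt]
    ring
  have hcov2 : ∀ b a c, Ω y * cov2 P (fun a c z => Ω z ^ k * H a c z) b a c y = Ω y ^ k * Y b a c y := by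
    intro b a c
    have hKe : ∀ d a c, Ω y * confK φ G d a c y = K d a c y := by
      intro d a c
      have hu : ∀ a, dlog φ a y = -((Ω y)⁻¹ * pd a Ω y) := fun a => dlog_inv hmV sΩ nΩ hyV a
      have hU : dlogUp φ G d y = -((Ω y)⁻¹ * normal G Ω y d) := by
        simp only [dlogUp, hu, normal, normalLow, Finset.mul_sum, ← Finset.sum_neg_distrib]
        exact Finset.sum_congr rfl fun e _ => by ring
      simp only [confK, hu, hU, hK]
      field_simp
      ring
    have hc : Ω y * cov2 P H b a c y = Ω y * cov2 G H b a c y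
        - ∑ e, (K e b a y * H e c y + K e b c y * H a e y) := by
      simp only [cov2, hP, hmV.christoffel_rescale sφ nφ hyV, ← hKe, mul_sub, Finset.mul_sum,
        sub_sub, ← Finset.sum_add_distrib]
      congr 1
      exact Finset.sum_congr rfl fun e _ => by ring
    rw [cov2_smul hyh ((sΩ y hyV).pow k).dAt (fun a b => (hH a b y hy).dAt),
      pd_pow hyh b k (sΩ y hyV).dAt]
    have hkk : Ω y * (k * Ω y ^ (k - 1)) = k * Ω y ^ k := by
      rcases k with _ | k
      · simp
      · simp only [Nat.add_sub_cancel]; ring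
    simp only [hY]
    linear_combination (Ω y ^ k) * hc + (pd b Ω y * H a c y) * hkk
  -- assembling
  have hdiv : covDiv P (weyl P) a b c y = covDiv G (weyl G) a b c y
      - (Ω y)⁻¹ * ∑ d, pd d Ω y * weyl G a b c d y := by
    rw [covDiv_congr hyh (fun a b c d => hVr.eventually hyV fun z hz =>
      hmV.weyl_rescale sφ nφ hz a b c d), hP, hmV.covDiv_rescale sφ nφ hyV (hmV.weylSym hyV)]
    have : ∀ d, dlog φ d y * weyl G a b c d y = -((Ω y)⁻¹ * (pd d Ω y * weyl G a b c d y)) := by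
      intro d
      rw [show dlog φ d y = -((Ω y)⁻¹ * pd d Ω y) from dlog_inv hmV sΩ nΩ hyV d]; ring
    simp only [this, Finset.sum_neg_distrib, ← Finset.mul_sum]
    ring
  have hb := hmP.covDiv_weyl hyV a b c
  rw [hdiv, hcov, hcov] at hb
  have hPg : ∀ a c, P y a c = (Ω y)⁻¹ ^ 2 * G y a c := fun a c => rfl
  have e1 : Ω y * covDiv G (weyl G) a b c y - ∑ d, pd d Ω y * weyl G a b c d y
      = Ω y * (covDiv G (weyl G) a b c y - (Ω y)⁻¹ * ∑ d, pd d Ω y * weyl G a b c d y) := by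
    field_simp
  have hpP : ∀ b a c, Ω y * pd b (scalarCurv P) y * P y a c = -κ * Ω y ^ k * (G y a c * Q b y) := by
    intro b a c
    rw [hpR, hPg, pow_add]
    field_simp
  rw [e1, hb]
  linear_combination (κ / 2) * hcov2 b a c - (κ / 2) * hcov2 a b c + (1 / 6) * hpP b a c
    - (1 / 6) * hpP a b c

end CompletionOn

end Scri

/-! ### Vanishing of the Weyl tensor at the boundary and regularity of the rescaled Weyl tensor -/

namespace Scri

lemma bil_normal {U : Set Coord} {G : MetricComp} {Ω : Coord → ℝ} {x : Coord} (h : MetricOn U G)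
    (hx : x ∈ U) : (∀ a, (G x).mulVec (normal G Ω x) a = pd a Ω x) ∧
      bil (G x) (normal G Ω x) (normal G Ω x) = normalSq G Ω x := by
  have h1 : (G x).mulVec (normal G Ω x) = fun a => pd a Ω x := by
    have : normal G Ω x = (G x)⁻¹.mulVec (fun b => pd b Ω x) := rfl
    rw [this, Matrix.mulVec_mulVec, h.mul_inv hx, Matrix.one_mulVec]
  refine ⟨fun a => congrFun h1 a, ?_⟩
  rw [bil, h1, dotProduct, normalSq]
  exact Finset.sum_congr rfl fun a _ => mul_comm _ _

namespace CompletionOn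

variable {κ Λ : ℝ} {U : Set Coord} {G : MetricComp} {Ω : Coord → ℝ} {x : Coord}
  (hC : CompletionOn κ Λ U G Ω)
include hC

/-- At the boundary the Bianchi equation with k = 1 loses all terms with a factor Ω and leaves N_d
C_{abc}^d = 0 with N timelike. -/
lemma weyl_eq_zero (hx : x ∈ U) (h0 : x 0 = 0) (a b c d : Fin 4) : weyl G a b c d x = 0 := by
  obtain ⟨r, hr, hB⟩ := hC.toDefFn.exists_ball hx
  obtain ⟨Z, hZ, hZe⟩ := hC.exists_weyl_divergence hC.decay h0 hB
  have hxB : x ∈ Metric.ball x r ∩ HS := ⟨Metric.mem_ball_self hr, hC.met.sub hx⟩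
  have hxs := hxB.2
  have hz : Ω x = 0 := hC.zero x hx h0
  obtain ⟨hn1, hn2⟩ := bil_normal (Ω := Ω) hC.met hx
  refine (hC.met.weylSym hx).eq_zero_of_timelike (hC.lorentz x hx) (v := normal G Ω x) ?_ ?_ a b c d
  · rw [hn2, hC.normalSq_eq hx h0]
    have := hC.lam
    linarith
  · intro a b c
    simp only [hn1]
    have smW := fun a b c d => hC.met.sm_weyl hx a b c d
    have sd : SmAt (covDiv G (weyl G) a b c) x :=
      SmAt.sum fun d _ => ((smW a b c d).pd hxs d).sub (SmAt.sum fun e _ =>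
        ((((hC.met.sm_christoffel hx e d a).mul (smW e b c d)).add
        ((hC.met.sm_christoffel hx e d b).mul (smW a e c d))).add
        ((hC.met.sm_christoffel hx e d c).mul (smW a b e d))).sub
        ((hC.met.sm_christoffel hx d d e).mul (smW a b c e)))
    have sL : SmAt (fun y => Ω y * covDiv G (weyl G) a b c y - ∑ d, pd d Ω y * weyl G a b c d y) x :=
      ((hC.smΩ hx).mul sd).sub (SmAt.sum fun d _ => ((hC.smΩ hx).pd hxs d).mul (smW a b c d))
    have := hC.toDefFn.eq_of_eq_pos hx sL.continuousWithinAt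
      (((hC.smΩ hx).pow 1).mul (hZ a b c x hxB)).continuousWithinAt (by
        filter_upwards [DefFn.phys_le (DefFn.ball_mem hxB), self_mem_nhdsWithin] with y hy hy'
        exact hZe a b c y hy hy'.2)
    simp only [hz, zero_mul, zero_sub, pow_one] at this
    rw [neg_eq_zero] at this
    rw [← this]
    exact Finset.sum_congr rfl fun d _ => mul_comm _ _

/-- Near the boundary the rescaled Weyl tensor is smooth. -/
lemma rescaledWeyl_eq_of_pos (hx : x ∈ U) (h0 : 0 < Ω x) (a b c d : Fin 4) :
    rescaledWeyl G Ω a b c d x = (Ω x)⁻¹ * weyl G a b c d x := by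
  have hs : SmAt (fun y => (Ω y)⁻¹ * weyl G a b c d y) x :=
    ((hC.smΩ hx).inv h0.ne').mul (hC.met.sm_weyl hx a b c d)
  exact extendFrom_eq (subset_closure ⟨hC.met.sub hx, h0⟩)
    (hs.continuousWithinAt.tendsto.mono_left DefFn.phys_le)

/-- A smooth function vanishing on the boundary is Ω times a smooth function, and that quotient must
coincide with the extension by continuity. -/
lemma smAt_rescaledWeyl_and_eq (hx : x ∈ U) (a b c d : Fin 4) :
    SmAt (rescaledWeyl G Ω a b c d) x ∧
      Ω x * rescaledWeyl G Ω a b c d x = weyl G a b c d x := by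
  rcases (mem_HS.1 (hC.met.sub hx)).eq_or_lt with h0 | h0
  · obtain ⟨r, hr, hB⟩ := hC.toDefFn.exists_ball hx
    -- The bound O(Ω) required at each boundary point is itself obtained by a first division by the
    -- zeroth coordinate around that point.
    obtain ⟨F, hF, hFe⟩ := hC.toDefFn.exists_eq_pow_mul hC.exists_pd_ne_zero h0.symm hB 1
      (F := weyl G a b c d)
      (fun y hy => ContDiffWithinAt.mono (hC.met.sm_weyl (hB hy) a b c d) inter_subset_right)
      (fun y hy hy0 => by
        obtain ⟨r', hr', hB'⟩ := hC.toDefFn.exists_ball (hB hy)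
        have hyB' : y ∈ Metric.ball y r' ∩ HS := ⟨Metric.mem_ball_self hr', hy.2⟩
        obtain ⟨K, hK, hKe⟩ := exists_eq_coord_mul hy0 (F := weyl G a b c d) (r := r')
          (fun z hz => ContDiffWithinAt.mono (hC.met.sm_weyl (hB' hz) a b c d) inter_subset_right)
          (fun z hz hz0 => hC.weyl_eq_zero (hB' ⟨hz, mem_HS.2 hz0.ge⟩) hz0 a b c d)
        obtain ⟨h, hh, hhe⟩ := hC.toDefFn.exists_coord_factor hC.exists_pd_ne_zero hy0 hB'
        have sm : SmAt (fun z => K z * (h z)⁻¹) y :=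
          (smAt_of_contDiffOn hK (DefFn.ball_mem hyB') hyB').mul
            ((smAt_of_contDiffOn hh (DefFn.ball_mem hyB') hyB').inv (hhe y hyB').1)
        have hb : (fun z => K z * (h z)⁻¹) =O[𝓝[{y | y ∈ HS ∧ 0 < Ω y}] y] fun _ => (1 : ℝ) :=
          (sm.continuousWithinAt.tendsto.mono_left DefFn.phys_le).isBigO_one ℝ
        have := (isBigO_refl (fun z => Ω z ^ 1) (𝓝[{y | y ∈ HS ∧ 0 < Ω y}] y)).mul hb
        refine this.congr' ?_ (Eventually.of_forall fun z => by ring)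
        filter_upwards [DefFn.phys_le (DefFn.ball_mem hyB')] with z hz
        rw [hKe z hz, pow_one]
        have := (hhe z hz).1
        nth_rewrite 1 [(hhe z hz).2]
        field_simp)
    have heq : ∀ y ∈ Metric.ball x r ∩ HS, rescaledWeyl G Ω a b c d y = F y := by
      intro y hy
      have := hC.toDefFn.neBot (hB hy)
      refine extendFrom_eq (mem_closure_iff_nhdsWithin_neBot.2 this) ?_
      have hFc := (smAt_of_contDiffOn hF (DefFn.ball_mem hy) hy).continuousWithinAt
      refine (hFc.tendsto.mono_left DefFn.phys_le).congr' ?_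
      filter_upwards [DefFn.phys_le (DefFn.ball_mem hy), self_mem_nhdsWithin] with z hz hz'
      have := hz'.2.ne'
      rw [hFe z hz]
      field_simp
    have hxB : x ∈ Metric.ball x r ∩ HS := ⟨Metric.mem_ball_self hr, hC.met.sub hx⟩
    refine ⟨(smAt_of_contDiffOn hF (DefFn.ball_mem hxB) hxB).congr hxB.2 ?_, ?_⟩
    · filter_upwards [DefFn.ball_mem hxB] with y hy using heq y hy
    · rw [heq x hxB, hFe x hxB, pow_one]
  · have hp := hC.pos x hx h0
    refine ⟨SmAt.congr (((hC.smΩ hx).inv hp.ne').mul (hC.met.sm_weyl hx a b c d)) (hC.met.sub hx) ?_, ?_⟩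
    · filter_upwards [hC.toDefFn.region.nhd x ⟨hx, hp⟩] with y hy
      exact hC.rescaledWeyl_eq_of_pos hy.1 hy.2 a b c d
    · rw [hC.rescaledWeyl_eq_of_pos hx hp]
      have := hp.ne'
      field_simp

lemma sm_rescaledWeyl (hx : x ∈ U) (a b c d : Fin 4) : SmAt (rescaledWeyl G Ω a b c d) x :=
  (hC.smAt_rescaledWeyl_and_eq hx a b c d).1

lemma mul_rescaledWeyl (hx : x ∈ U) (a b c d : Fin 4) :
    Ω x * rescaledWeyl G Ω a b c d x = weyl G a b c d x :=
  (hC.smAt_rescaledWeyl_and_eq hx a b c d).2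

lemma weylSym_rescaledWeyl (hx : x ∈ U) :
    WeylSym (G x) (fun a b c d => rescaledWeyl G Ω a b c d x) := by
  -- Each symmetry is the vanishing of an expression homogeneous of degree one in the array. It
  -- holds where Ω > 0, since d is a multiple of C there, and passes to the boundary by continuity.
  have key : ∀ F : Arr → Mat → ℝ, (∀ (c : ℝ) w A, F (fun i j k l => c * w i j k l) A = c * F w A) →
      (∀ y ∈ U, SmAt (fun y => F (fun i j k l => rescaledWeyl G Ω i j k l y) (G y)) y) →
      (∀ y ∈ U, F (fun i j k l => weyl G i j k l y) (G y) = 0) →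
      F (fun i j k l => rescaledWeyl G Ω i j k l x) (G x) = 0 := by
    intro F hl hs h0
    refine hC.toDefFn.eq_of_eq_pos hx (hs x hx).continuousWithinAt (SmAt.const 0).continuousWithinAt
      (hC.toDefFn.eventually_phys hx fun y hy hpos => ?_)
    have : (fun i j k l => rescaledWeyl G Ω i j k l y)
        = fun i j k l => (Ω y)⁻¹ * weyl G i j k l y := by
      funext i j k l; exact hC.rescaledWeyl_eq_of_pos hy hpos i j k l
    rw [this, hl, h0 y hy, mul_zero]
  have S := fun (y : Coord) (hy : y ∈ U) => hC.met.weylSym hy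
  refine ⟨fun a b c d => ?_, fun a b c d => ?_, fun a b c d => ?_, fun a c => ?_⟩
  · have := key (fun w _ => w a b c d + w b a c d) (fun c w A => by ring)
      (fun y hy => (hC.sm_rescaledWeyl hy _ _ _ _).add (hC.sm_rescaledWeyl hy _ _ _ _))
      (fun y hy => by simp only [(S y hy).anti_left a b c d]; ring)
    linarith
  · have := key (fun w A => ∑ e, w a b c e * A e d + ∑ e, w a b d e * A e c)
      (fun k w A => by simp only [mul_assoc, ← Finset.mul_sum]; ring)
      (fun y hy => (SmAt.sum fun e _ => (hC.sm_rescaledWeyl hy _ _ _ _).mul (hC.met.sm y hy _ _)).add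
        (SmAt.sum fun e _ => (hC.sm_rescaledWeyl hy _ _ _ _).mul (hC.met.sm y hy _ _)))
      (fun y hy => by simp only [(S y hy).anti_right a b c d]; ring)
    linarith
  · exact key (fun w _ => w a b c d + w b c a d + w c a b d) (fun c w A => by ring)
      (fun y hy => ((hC.sm_rescaledWeyl hy _ _ _ _).add (hC.sm_rescaledWeyl hy _ _ _ _)).add
        (hC.sm_rescaledWeyl hy _ _ _ _)) (fun y hy => (S y hy).cyclic a b c d)
  · exact key (fun w _ => ∑ b, w a b c b) (fun c w A => by simp only [← Finset.mul_sum])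
      (fun y hy => SmAt.sum fun e _ => hC.sm_rescaledWeyl hy _ _ _ _)
      (fun y hy => (S y hy).trace a c)

/-- Substituting C = Ω d, the gradient terms cancel and the Bianchi equation with k = 3 becomes Ω²
∇_d d_{abc}^d = Ω³ Z. Hence the divergence equals Ω Z on the physical region and tends to zero. -/
lemma covDiv_rescaledWeyl (hdec : DecayOn κ Λ U G Ω 3) (hx : x ∈ U) (h0 : x 0 = 0) (a b c : Fin 4) :
    covDiv G (rescaledWeyl G Ω) a b c x = 0 := by
  obtain ⟨r, hr, hB⟩ := hC.toDefFn.exists_ball hx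
  obtain ⟨Z, hZ, hZe⟩ := hC.exists_weyl_divergence hdec h0 hB
  have hxB : x ∈ Metric.ball x r ∩ HS := ⟨Metric.mem_ball_self hr, hC.met.sub hx⟩
  have hxs := hxB.2
  have hz : Ω x = 0 := hC.zero x hx h0
  have smW := fun a b c d => hC.sm_rescaledWeyl hx a b c d
  have sd : SmAt (covDiv G (rescaledWeyl G Ω) a b c) x :=
    SmAt.sum fun d _ => ((smW a b c d).pd hxs d).sub (SmAt.sum fun e _ =>
      ((((hC.met.sm_christoffel hx e d a).mul (smW e b c d)).add
      ((hC.met.sm_christoffel hx e d b).mul (smW a e c d))).add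
      ((hC.met.sm_christoffel hx e d c).mul (smW a b e d))).sub
      ((hC.met.sm_christoffel hx d d e).mul (smW a b c e)))
  have := hC.toDefFn.eq_of_eq_pos hx sd.continuousWithinAt
    ((hC.smΩ hx).mul (hZ a b c x hxB)).continuousWithinAt (by
      filter_upwards [DefFn.phys_le (DefFn.ball_mem hxB), self_mem_nhdsWithin] with y hy hy'
      have hyU := hB hy
      have h1 := hZe a b c y hy hy'.2
      rw [covDiv_congr hy.2 (W' := fun a b c d y => Ω y * rescaledWeyl G Ω a b c d y)
        (fun a b c d => hC.met.toRelOpen.eventually hyU fun z hz => (hC.mul_rescaledWeyl hz a b c d).symm),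
        covDiv_smul hy.2 (hC.smΩ hyU).dAt (fun a b c d => (hC.sm_rescaledWeyl hyU a b c d).dAt)] at h1
      simp only [← hC.mul_rescaledWeyl hyU] at h1
      have h2 : ∑ d, pd d Ω y * (Ω y * rescaledWeyl G Ω a b c d y)
          = Ω y * ∑ d, pd d Ω y * rescaledWeyl G Ω a b c d y := by
        rw [Finset.mul_sum]; exact Finset.sum_congr rfl fun d _ => by ring
      rw [h2] at h1
      have hne := hy'.2.ne'
      have h3 : Ω y ^ 2 * covDiv G (rescaledWeyl G Ω) a b c y = Ω y ^ 2 * (Ω y * Z a b c y) := by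
        linear_combination h1
      exact mul_left_cancel₀ (pow_ne_zero 2 hne) h3)
  rw [this, hz, zero_mul]

end CompletionOn

end Scri

/-! ### First-order calculus at a point: stationary functions and parallel frames -/

namespace Scri

/-- A smooth function with vanishing gradient at a point. -/
structure FlatAt (f : Coord → ℝ) (x : Coord) : Prop where
  sm : SmAt f x
  pd_eq : ∀ m, pd m f x = 0

namespace FlatAt

variable {f g : Coord → ℝ} {x : Coord} {ι : Type*} (hx : x ∈ HS)
include hx

lemma const (c : ℝ) : FlatAt (fun _ => c) x := ⟨SmAt.const c, fun m => pd_const hx m c⟩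

lemma mul (hf : FlatAt f x) (hg : FlatAt g x) : FlatAt (fun y => f y * g y) x :=
  ⟨hf.sm.mul hg.sm, fun m => by rw [pd_mul hx m hf.sm.dAt hg.sm.dAt, hf.pd_eq, hg.pd_eq]; ring⟩

lemma sum {s : Finset ι} {F : ι → Coord → ℝ} (h : ∀ i ∈ s, FlatAt (F i) x) :
    FlatAt (fun y => ∑ i ∈ s, F i y) x :=
  ⟨SmAt.sum fun i hi => (h i hi).sm, fun m => by
    rw [pd_sum hx m fun i hi => (h i hi).sm.dAt]
    exact Finset.sum_eq_zero fun i hi => (h i hi).pd_eq m⟩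

lemma prod [DecidableEq ι] {s : Finset ι} {F : ι → Coord → ℝ} (h : ∀ i ∈ s, FlatAt (F i) x) :
    FlatAt (fun y => ∏ i ∈ s, F i y) x := by
  induction s using Finset.induction_on with
  | empty => simpa using const hx 1
  | insert i s hi ih =>
    simp only [Finset.prod_insert hi]
    exact mul hx (h i (Finset.mem_insert_self i s)) (ih fun j hj => h j (Finset.mem_insert_of_mem hj))

lemma pd_mul_left (hf : FlatAt f x) (hg : SmAt g x) (m : Fin 4) :
    pd m (fun y => f y * g y) x = f x * pd m g x := by
  rw [pd_mul hx m hf.sm.dAt hg.dAt, hf.pd_eq]; ring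

/-- A smooth function is flat where its square is, unless it vanishes. -/
lemma of_sq (hf : SmAt f x) (h0 : f x ≠ 0) (h : ∀ m, pd m (fun y => f y ^ 2) x = 0) : FlatAt f x :=
  ⟨hf, fun m => by
    have := h m
    rw [pd_pow hx m 2 hf.dAt] at this
    simpa [h0] using this⟩

lemma det {F : Coord → Mat} (hF : ∀ a b, FlatAt (fun y => F y a b) x) :
    FlatAt (fun y => (F y).det) x := by
  simp only [Matrix.det_apply, Units.smul_def, zsmul_eq_mul]
  exact sum hx fun σ _ => mul hx (const hx _) (prod hx fun i _ => hF _ _)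

lemma inv {F : Coord → Mat} (hF : ∀ a b, FlatAt (fun y => F y a b) x) (h0 : (F x).det ≠ 0)
    (a b : Fin 4) : FlatAt (fun y => (F y)⁻¹ a b) x := by
  have hs : SmM F x := fun a b => (hF a b).sm
  refine ⟨hs.inv h0 a b, fun m => ?_⟩
  have h1 := congrFun (congrFun (pdM_inv hx m hs h0) a) b
  have h2 : pdM m F x = 0 := by ext a b; exact (hF a b).pd_eq m
  rw [h2] at h1
  simpa [pdM] using h1

end FlatAt

/-- The absolute value is written as √(det²), a composition of square roots away from zero. -/
lemma SmM.sqrt_abs_det {F : Coord → Mat} {x : Coord} (hF : SmM F x) (h0 : (F x).det ≠ 0) :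
    SmAt (fun y => Real.sqrt |(F y).det|) x := by
  simp only [← Real.sqrt_sq_eq_abs]
  have h1 : Real.sqrt ((F x).det ^ 2) ≠ 0 := by
    rw [Real.sqrt_sq_eq_abs]; exact abs_ne_zero.2 h0
  exact ContDiffWithinAt.sqrt (ContDiffWithinAt.sqrt (hF.det.pow 2) (pow_ne_zero 2 h0)) h1

lemma FlatAt.sqrt_abs_det {F : Coord → Mat} {x : Coord} (hx : x ∈ HS)
    (hF : ∀ a b, FlatAt (fun y => F y a b) x) (h0 : (F x).det ≠ 0) :
    FlatAt (fun y => Real.sqrt |(F y).det|) x := by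
  have hs : SmM F x := fun a b => (hF a b).sm
  have h1 : Real.sqrt |(F x).det| ≠ 0 := (Real.sqrt_pos.2 (abs_pos.2 h0)).ne'
  have hd := FlatAt.det hx hF
  have hsq : FlatAt (fun y => |(F y).det|) x := by
    have sm : SmAt (fun y => |(F y).det|) x := by
      simp only [← Real.sqrt_sq_eq_abs]
      exact ContDiffWithinAt.sqrt (hs.det.pow 2) (pow_ne_zero 2 h0)
    refine FlatAt.of_sq hx sm (abs_ne_zero.2 h0) fun m => ?_
    simp only [sq_abs]
    rw [pd_pow hx m 2 hs.det.dAt, hd.pd_eq, mul_zero]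
  refine FlatAt.of_sq hx (hs.sqrt_abs_det h0) h1 fun m => ?_
  simp only [Real.sq_sqrt (abs_nonneg _)]
  exact hsq.pd_eq m

/-- Entrywise partial derivative of a field of arrays. -/
noncomputable def pdA (m : Fin 4) (W : Coord → Arr) (x : Coord) : Arr :=
  fun a b c d => pd m (fun y => W y a b c d) x

/-- Entrywise smoothness of a field of arrays. -/
def SmA (W : Coord → Arr) (x : Coord) : Prop := ∀ a b c d, SmAt (fun y => W y a b c d) x

section brCov

variable {x : Coord} {W W' : Coord → Arr} {A : Coord → Mat} {X Z v : Coord → Fin 4 → ℝ}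

lemma SmA.slotMat (hW : SmA W x) (hX : ∀ a, SmAt (fun y => X y a) x)
    (hZ : ∀ a, SmAt (fun y => Z y a) x) : SmM (fun y => slotMat (W y) (X y) (Z y)) x := fun b d =>
  show SmAt (fun y => ∑ a, ∑ c, X y a * Z y c * W y a b c d) x from
    SmAt.sum fun a _ => SmAt.sum fun c _ => ((hX a).mul (hZ c)).mul (hW a b c d)

lemma SmA.hodgeAt (hW : SmA W x) (hA : SmM A x) (h0 : (A x).det ≠ 0) :
    SmA (fun y => hodgeAt (A y) (W y)) x := fun _ _ c d =>
  (SmAt.const _).mul (SmAt.sum fun e _ => SmAt.sum fun f _ => SmAt.sum fun p _ => SmAt.sum fun q _ =>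
    (((((hA.sqrt_abs_det h0).mul (SmAt.const _)).mul (hA.inv h0 e p)).mul (hA.inv h0 f q)).mul
      (hW p q c d)))

lemma SmM.trace_mul {F H : Coord → Mat} (hF : SmM F x) (hH : SmM H x) :
    SmAt (fun y => (F y * H y).trace) x := SmAt.sum fun i _ => hF.mul hH i i

lemma pd_trace_mul (hx : x ∈ HS) (m : Fin 4) {F H : Coord → Mat} (hF : SmM F x) (hH : SmM H x) :
    pd m (fun y => (F y * H y).trace) x = (pdM m F x * H x).trace + (F x * pdM m H x).trace := by
  rw [← Matrix.trace_add, ← pdM_mul hx m hF hH]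
  exact pd_sum hx m fun i _ => (hF.mul hH i i).dAt

/-- Smoothness of the Bel-Robinson covector. -/
lemma SmA.brCovector (hW : SmA W x) (hA : SmM A x) (h0 : (A x).det ≠ 0)
    (hv : ∀ a, SmAt (fun y => v y a) x) (e : Fin 4) :
    SmAt (fun y => brCovector (A y) (W y) (v y) e) x := by
  have he : ∀ a, SmAt (fun _ : Coord => (Pi.single e 1 : Fin 4 → ℝ) a) x := fun a => SmAt.const _
  exact ((hW.slotMat he hv).trace_mul (hW.slotMat hv hv)).add
    (((hW.hodgeAt hA h0).slotMat he hv).trace_mul ((hW.hodgeAt hA h0).slotMat hv hv))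

variable (hx : x ∈ HS)
include hx

lemma pdM_slotMat (hW : SmA W x) (hX : ∀ a, FlatAt (fun y => X y a) x)
    (hZ : ∀ a, FlatAt (fun y => Z y a) x) (m : Fin 4) :
    pdM m (fun y => slotMat (W y) (X y) (Z y)) x = slotMat (pdA m W x) (X x) (Z x) := by
  ext b d
  simp only [pdM, slotMat, Matrix.of_apply, pdA]
  rw [pd_sum hx m fun a _ => (SmAt.sum fun c _ => ((hX a).sm.mul (hZ c).sm).mul (hW a b c d)).dAt]
  refine Finset.sum_congr rfl fun a _ => ?_
  rw [pd_sum hx m fun c _ => (((hX a).sm.mul (hZ c).sm).mul (hW a b c d)).dAt]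
  exact Finset.sum_congr rfl fun c _ => (FlatAt.mul hx (hX a) (hZ c)).pd_mul_left hx (hW a b c d) m

lemma pdA_hodgeAt (hW : SmA W x) (hA : ∀ a b, FlatAt (fun y => A y a b) x) (h0 : (A x).det ≠ 0)
    (m : Fin 4) : pdA m (fun y => hodgeAt (A y) (W y)) x = hodgeAt (A x) (pdA m W x) := by
  funext a b c d
  have hs := FlatAt.sqrt_abs_det hx hA h0
  have hi := FlatAt.inv hx hA h0
  have hf : ∀ e f p q, FlatAt (fun y => Real.sqrt |(A y).det| * altSymbol a b e f * (A y)⁻¹ e p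
      * (A y)⁻¹ f q) x := fun e f p q =>
    FlatAt.mul hx (FlatAt.mul hx (FlatAt.mul hx hs (FlatAt.const hx _)) (hi e p)) (hi f q)
  have sm : ∀ e f p q, SmAt (fun y => Real.sqrt |(A y).det| * altSymbol a b e f * (A y)⁻¹ e p
      * (A y)⁻¹ f q * W y p q c d) x := fun e f p q => (hf e f p q).sm.mul (hW p q c d)
  simp only [pdA, hodgeAt]
  rw [pd_const_mul hx m _ (SmAt.sum fun e _ => SmAt.sum fun f _ => SmAt.sum fun p _ =>
      SmAt.sum fun q _ => sm e f p q).dAt]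
  congr 1
  rw [pd_sum hx m fun e _ => (SmAt.sum fun f _ => SmAt.sum fun p _ =>
      SmAt.sum fun q _ => sm e f p q).dAt]
  refine Finset.sum_congr rfl fun e _ => ?_
  rw [pd_sum hx m fun f _ => (SmAt.sum fun p _ => SmAt.sum fun q _ => sm e f p q).dAt]
  refine Finset.sum_congr rfl fun f _ => ?_
  rw [pd_sum hx m fun p _ => (SmAt.sum fun q _ => sm e f p q).dAt]
  refine Finset.sum_congr rfl fun p _ => ?_
  rw [pd_sum hx m fun q _ => (sm e f p q).dAt]
  exact Finset.sum_congr rfl fun q _ => (hf e f p q).pd_mul_left hx (hW p q c d) m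

/-- Derivative of the Bel-Robinson covector where the metric and the vector are stationary. -/
lemma pd_brCovector (hW : SmA W x) (hA : ∀ a b, FlatAt (fun y => A y a b) x) (h0 : (A x).det ≠ 0)
    (hv : ∀ a, FlatAt (fun y => v y a) x) (e m : Fin 4) :
    pd m (fun y => brCovector (A y) (W y) (v y) e) x
      = brForm (A x) (pdA m W x) (W x) (v x) e + brForm (A x) (W x) (pdA m W x) (v x) e := by
  have he : ∀ a, FlatAt (fun _ : Coord => (Pi.single e 1 : Fin 4 → ℝ) a) x :=
    fun a => FlatAt.const hx _
  have hA' : SmM A x := fun a b => (hA a b).sm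
  have hH := hW.hodgeAt hA' h0
  have s1 := hW.slotMat (fun a => (he a).sm) (fun a => (hv a).sm)
  have s2 := hW.slotMat (fun a => (hv a).sm) (fun a => (hv a).sm)
  have s3 := hH.slotMat (fun a => (he a).sm) (fun a => (hv a).sm)
  have s4 := hH.slotMat (fun a => (hv a).sm) (fun a => (hv a).sm)
  simp only [brCovector]
  rw [pd_add hx m (s1.trace_mul s2).dAt (s3.trace_mul s4).dAt, pd_trace_mul hx m s1 s2,
    pd_trace_mul hx m s3 s4, pdM_slotMat hx hW he hv, pdM_slotMat hx hW hv hv,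
    pdM_slotMat hx hH he hv, pdM_slotMat hx hH hv hv, pdA_hodgeAt hx hW hA h0]
  simp only [brForm]
  ring

end brCov

lemma pd_coord {x : Coord} (hx : x ∈ HS) (m k : Fin 4) : pd m (fun y : Coord => y k) x = kd k m := by
  have h1 : fderivWithin ℝ (fun y : Coord => y k) HS x = EuclideanSpace.proj (𝕜 := ℝ) k :=
    (EuclideanSpace.proj (𝕜 := ℝ) k).hasFDerivWithinAt.fderivWithin (uniqueDiffOn_HS x hx)
  rw [pd, h1]
  simp

/-- A matrix field with prescribed one-jet. -/
lemma exists_matrix_jet {x : Coord} (hx : x ∈ HS) (L0 : Mat) (B : Fin 4 → Mat) :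
    ∃ L : Coord → Mat, SmM L x ∧ L x = L0 ∧ ∀ m, pdM m L x = B m := by
  have hc : ∀ k, SmAt (fun y : Coord => y k) x := fun k =>
    (EuclideanSpace.proj (𝕜 := ℝ) k).contDiff.contDiffWithinAt
  have hcx : ∀ k, SmAt (fun y : Coord => y k - x k) x := fun k => (hc k).sub (SmAt.const _)
  refine ⟨fun y => Matrix.of fun a b => L0 a b + ∑ k, (y k - x k) * B k a b, fun a b =>
    (SmAt.const _).add (SmAt.sum fun k _ => (hcx k).mul (SmAt.const _)), ?_, fun m => ?_⟩
  · ext a b; simp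
  · ext a b
    simp only [pdM, Matrix.of_apply]
    rw [pd_add hx m (SmAt.const _).dAt (SmAt.sum fun k _ => (hcx k).mul (SmAt.const _)).dAt,
      pd_const hx, pd_sum hx m fun k _ => ((hcx k).mul (SmAt.const _)).dAt, zero_add]
    have : ∀ k, pd m (fun y : Coord => (y k - x k) * B k a b) x = kd k m * B k a b := by
      intro k
      rw [pd_mul hx m (hcx k).dAt (SmAt.const _).dAt, pd_const hx, pd_sub hx m (hc k).dAt
        (SmAt.const _).dAt, pd_const hx, pd_coord hx]
      ring
    simp [this]

section act

variable {x : Coord} (hx : x ∈ HS) {N : Coord → Mat} {W : Coord → Arr} (hN : SmM N x) (hW : SmA W x)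

lemma SmM.act1 (hN : SmM N x) (hW : SmA W x) : SmA (fun y => act1 (N y) (W y)) x :=
  fun a b c d => SmAt.sum fun p _ => (hN a p).mul (hW p b c d)
lemma SmM.act2 (hN : SmM N x) (hW : SmA W x) : SmA (fun y => act2 (N y) (W y)) x :=
  fun a b c d => SmAt.sum fun p _ => (hN b p).mul (hW a p c d)
lemma SmM.act3 (hN : SmM N x) (hW : SmA W x) : SmA (fun y => act3 (N y) (W y)) x :=
  fun a b c d => SmAt.sum fun p _ => (hN c p).mul (hW a b p d)
lemma SmM.act4 (hN : SmM N x) (hW : SmA W x) : SmA (fun y => act4 (N y) (W y)) x :=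
  fun a b c d => SmAt.sum fun p _ => (hN d p).mul (hW a b c p)

include hx hN hW

lemma pdA_act1 (m : Fin 4) : pdA m (fun y => act1 (N y) (W y)) x
    = act1 (pdM m N x) (W x) + act1 (N x) (pdA m W x) := by
  funext a b c d
  simp only [pdA, act1, Pi.add_apply, ← Finset.sum_add_distrib]
  rw [pd_sum hx m fun p _ => ((hN a p).mul (hW p b c d)).dAt]
  exact Finset.sum_congr rfl fun p _ => pd_mul hx m (hN a p).dAt (hW p b c d).dAt

lemma pdA_act2 (m : Fin 4) : pdA m (fun y => act2 (N y) (W y)) x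
    = act2 (pdM m N x) (W x) + act2 (N x) (pdA m W x) := by
  funext a b c d
  simp only [pdA, act2, Pi.add_apply, ← Finset.sum_add_distrib]
  rw [pd_sum hx m fun p _ => ((hN b p).mul (hW a p c d)).dAt]
  exact Finset.sum_congr rfl fun p _ => pd_mul hx m (hN b p).dAt (hW a p c d).dAt

lemma pdA_act3 (m : Fin 4) : pdA m (fun y => act3 (N y) (W y)) x
    = act3 (pdM m N x) (W x) + act3 (N x) (pdA m W x) := by
  funext a b c d
  simp only [pdA, act3, Pi.add_apply, ← Finset.sum_add_distrib]
  rw [pd_sum hx m fun p _ => ((hN c p).mul (hW a b p d)).dAt]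
  exact Finset.sum_congr rfl fun p _ => pd_mul hx m (hN c p).dAt (hW a b p d).dAt

lemma pdA_act4 (m : Fin 4) : pdA m (fun y => act4 (N y) (W y)) x
    = act4 (pdM m N x) (W x) + act4 (N x) (pdA m W x) := by
  funext a b c d
  simp only [pdA, act4, Pi.add_apply, ← Finset.sum_add_distrib]
  rw [pd_sum hx m fun p _ => ((hN d p).mul (hW a b c p)).dAt]
  exact Finset.sum_congr rfl fun p _ => pd_mul hx m (hN d p).dAt (hW a b c p).dAt

end act

section actadd
variable (N N' : Mat) (w w' : Arr)
lemma act1_add : act1 N (w + w') = act1 N w + act1 N w' := by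
  funext a b c d; simp [act1, mul_add, Finset.sum_add_distrib]
lemma act2_add : act2 N (w + w') = act2 N w + act2 N w' := by
  funext a b c d; simp [act2, mul_add, Finset.sum_add_distrib]
lemma act3_add : act3 N (w + w') = act3 N w + act3 N w' := by
  funext a b c d; simp [act3, mul_add, Finset.sum_add_distrib]
lemma act4_add : act4 N (w + w') = act4 N w + act4 N w' := by
  funext a b c d; simp [act4, mul_add, Finset.sum_add_distrib]
lemma act3_act3 : act3 N (act3 N' w) = act3 (N * N') w := by
  funext a b c d; exact sum_mul_assoc_aux N N' (fun q => w a b q d) c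
end actadd

/-- Covariant derivative `∇_m W_{abc}{}^d` of a field of arrays. -/
noncomputable def covA (G : MetricComp) (m : Fin 4) (W : Coord → Arr) (x : Coord) : Arr :=
  pdA m W x + act1 (-conn G m x) (W x) + act2 (-conn G m x) (W x) + act3 (-conn G m x) (W x)
    + act4 (conn G m x).transpose (W x)

lemma sum_covA (G : MetricComp) (W : Coord → Arr) (x : Coord) (a b c : Fin 4) :
    ∑ d, covA G d W x a b c d = covDiv G (fun a b c d y => W y a b c d) a b c x := by
  simp only [covA, covDiv, Pi.add_apply, act1, act2, act3, act4, pdA, conn, Matrix.neg_apply,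
    Matrix.of_apply, Matrix.transpose_apply]
  refine Finset.sum_congr rfl fun d _ => ?_
  simp only [Finset.sum_add_distrib, Finset.sum_sub_distrib, neg_mul, Finset.sum_neg_distrib]
  ring

/-- In a frame that is parallel at a point, partial derivatives are covariant derivatives. -/
lemma pdA_frameArr {G : MetricComp} {x : Coord} (hx : x ∈ HS) {L M : Coord → Mat} {W : Coord → Arr}
    (hL : SmM L x) (hM : SmM M x) (hW : SmA W x) (m : Fin 4)
    (hLd : pdM m L x = -((conn G m x).transpose * L x))
    (hMd : pdM m M x = M x * (conn G m x).transpose) :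
    pdA m (fun y => frameArr (L y) (M y) (W y)) x = frameArr (L x) (M x) (covA G m W x) := by
  -- By the product rule, the derivatives of the frame and of the dual frame supply one connection
  -- term per index, exactly those of `covA`.
  have hT : SmM (fun y => (L y).transpose) x := hL.transpose
  have hTd : pdM m (fun y => (L y).transpose) x = (L x).transpose * (-conn G m x) := by
    rw [pdM_transpose, hLd, Matrix.transpose_neg, Matrix.transpose_mul, Matrix.transpose_transpose,
      Matrix.mul_neg]
  have h4 := hM.act4 hW
  have h3 := hT.act3 h4
  have h2 := hT.act2 h3
  have e : (fun y => frameArr (L y) (M y) (W y)) = fun y => act1 (L y).transpose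
      (act2 (L y).transpose (act3 (L y).transpose (act4 (M y) (W y)))) := by
    funext y; rw [frameArr_eq]
  rw [e, pdA_act1 hx hT h2, pdA_act2 hx hT h3, pdA_act3 hx hT h4, pdA_act4 hx hM hW, hTd, hMd,
    frameArr_eq, covA]
  simp only [act1_add, act2_add, act3_add, act4_add, ← act1_act1, ← act2_act2, ← act3_act3,
    ← act4_act4]
  simp only [act1_act2, act1_act3, act1_act4, act2_act3, act2_act4, act3_act4]
  abel

end Scri

/-! ### Divergence of the supermomentum along a parallel vector field -/

namespace Scri

section linear

variable (k : Fin 4 → ℝ) (F : Fin 4 → Arr)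

lemma slotMat_sum (X Z : Fin 4 → ℝ) : slotMat (fun a b c d => ∑ m, k m * F m a b c d) X Z
    = ∑ m, k m • slotMat (F m) X Z := by
  ext b d
  simp only [slotMat, Matrix.of_apply, Matrix.sum_apply, Matrix.smul_apply, smul_eq_mul,
    Finset.mul_sum]
  have : ∀ a, ∑ c, ∑ m, X a * Z c * (k m * F m a b c d) = ∑ m, ∑ c, k m * (X a * Z c * F m a b c d) := by
    intro a
    rw [Finset.sum_comm]
    exact Finset.sum_congr rfl fun _ _ => Finset.sum_congr rfl fun _ _ => by ring
  simp only [this]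
  rw [Finset.sum_comm]

lemma hodgeAt_sum (A : Mat) : hodgeAt A (fun a b c d => ∑ m, k m * F m a b c d)
    = fun a b c d => ∑ m, k m * hodgeAt A (F m) a b c d := by
  funext a b c d
  simp only [hodgeAt, Finset.mul_sum]
  rw [Finset.sum_comm (f := fun m e => ∑ f, ∑ p, ∑ q, k m * (1 / 2 * (Real.sqrt |A.det|
    * altSymbol a b e f * A⁻¹ e p * A⁻¹ f q * F m p q c d)))]
  refine Finset.sum_congr rfl fun e _ => ?_
  rw [Finset.sum_comm (f := fun m f => ∑ p, ∑ q, k m * (1 / 2 * (Real.sqrt |A.det|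
    * altSymbol a b e f * A⁻¹ e p * A⁻¹ f q * F m p q c d)))]
  refine Finset.sum_congr rfl fun f _ => ?_
  rw [Finset.sum_comm (f := fun m p => ∑ q, k m * (1 / 2 * (Real.sqrt |A.det|
    * altSymbol a b e f * A⁻¹ e p * A⁻¹ f q * F m p q c d)))]
  refine Finset.sum_congr rfl fun p _ => ?_
  rw [Finset.sum_comm (f := fun m q => k m * (1 / 2 * (Real.sqrt |A.det|
    * altSymbol a b e f * A⁻¹ e p * A⁻¹ f q * F m p q c d)))]
  exact Finset.sum_congr rfl fun q _ => Finset.sum_congr rfl fun m _ => by ring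

lemma brForm_sum (A : Mat) (w : Arr) (v : Fin 4 → ℝ) (e : Fin 4) :
    brForm A (fun a b c d => ∑ m, k m * F m a b c d) w v e = ∑ m, k m * brForm A (F m) w v e ∧
    brForm A w (fun a b c d => ∑ m, k m * F m a b c d) v e = ∑ m, k m * brForm A w (F m) v e := by
  constructor <;>
  · simp only [brForm, hodgeAt_sum, slotMat_sum, Finset.sum_mul, Finset.mul_sum, Matrix.trace_sum,
      Matrix.smul_mul, Matrix.mul_smul, Matrix.trace_smul, smul_eq_mul, mul_add,
      Finset.sum_add_distrib]

lemma WeylSym.sum {A : Mat} (h : ∀ m, WeylSym A (F m)) :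
    WeylSym A (fun a b c d => ∑ m, k m * F m a b c d) where
  anti_left a b c d := by
    rw [← Finset.sum_neg_distrib]
    exact Finset.sum_congr rfl fun m _ => by rw [(h m).anti_left]; ring
  anti_right a b c d := by
    simp only [Finset.sum_mul]
    rw [Finset.sum_comm, Finset.sum_comm (f := fun e m => k m * F m a b d e * A e c),
      ← Finset.sum_neg_distrib]
    refine Finset.sum_congr rfl fun m _ => ?_
    simp only [mul_assoc, ← Finset.mul_sum, (h m).anti_right a b c d]
    ring
  cyclic a b c d := by
    rw [← Finset.sum_add_distrib, ← Finset.sum_add_distrib]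
    exact Finset.sum_eq_zero fun m _ => by rw [← mul_add, ← mul_add, (h m).cyclic, mul_zero]
  trace a c := by
    rw [Finset.sum_comm]
    exact Finset.sum_eq_zero fun m _ => by rw [← Finset.mul_sum, (h m).trace, mul_zero]

end linear

/-- The derivative of a field of Weyl candidates is a Weyl candidate where the metric is
stationary. -/
lemma WeylSym.pdA {x : Coord} (hx : x ∈ HS) {A : Coord → Mat} {W : Coord → Arr} (hW : SmA W x)
    (hA : ∀ a b, FlatAt (fun y => A y a b) x) (h : ∀ᶠ y in 𝓝[HS] x, WeylSym (A y) (W y)) (m : Fin 4) :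
    WeylSym (A x) (pdA m W x) where
  anti_left a b c d := by
    simp only [Scri.pdA]
    rw [← pd_neg hx]
    exact pd_congr hx (h.mono fun y hy => hy.anti_left a b c d) m
  anti_right a b c d := by
    have key : ∀ c d, pd m (fun y => ∑ e, W y a b c e * A y e d) x
        = ∑ e, Scri.pdA m W x a b c e * A x e d := by
      intro c d
      rw [pd_sum hx m fun e _ => ((hW a b c e).mul (hA e d).sm).dAt]
      refine Finset.sum_congr rfl fun e _ => ?_
      rw [pd_mul hx m (hW a b c e).dAt (hA e d).sm.dAt, (hA e d).pd_eq, mul_zero, add_zero]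
      rfl
    rw [← key, ← key, ← pd_neg hx]
    exact pd_congr hx (h.mono fun y hy => hy.anti_right a b c d) m
  cyclic a b c d := by
    simp only [Scri.pdA]
    rw [← pd_add hx m (hW a b c d).dAt (hW b c a d).dAt,
      ← pd_add hx m ((hW a b c d).add (hW b c a d)).dAt (hW c a b d).dAt, ← pd_const hx m 0]
    exact pd_congr hx (h.mono fun y hy => hy.cyclic a b c d) m
  trace a c := by
    simp only [Scri.pdA]
    rw [← pd_sum hx m fun b _ => (hW a b c b).dAt, ← pd_const hx m 0]
    exact pd_congr hx (h.mono fun y hy => hy.trace a c) m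

namespace CompletionOn

variable {κ Λ : ℝ} {U : Set Coord} {G : MetricComp} {Ω : Coord → ℝ} {x : Coord}
  (hC : CompletionOn κ Λ U G Ω)
include hC

/-- The supermomentum of the rescaled Weyl tensor with respect to a vector field that is parallel at
a boundary point is divergence-free there. -/
theorem divergence_supermomentum (hdec : DecayOn κ Λ U G Ω 3) (hxU : x ∈ U) (h0 : x 0 = 0)
    {v : Coord → Fin 4 → ℝ} (hv : ∀ a, SmAt (fun y => v y a) x) (hvt : bil (G x) (v x) (v x) < 0)
    (hvp : ∀ m a, pd m (fun y => v y a) x = -∑ l, christoffel G a m l x * v x l) :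
    divergence G (supermomentum G Ω v) x = 0 := by
  have hx : x ∈ HS := hC.met.sub hxU
  obtain ⟨L0, M0, hLM0, hL0, l, hl, hlv⟩ := (hC.lorentz x hxU).exists_frame hvt
  have hML0 : M0 * L0 = 1 := mul_eq_one_comm.1 hLM0
  -- The frame is adapted to v and orthonormal at x, and its first derivatives are chosen so that
  -- its legs are parallel there. Orthonormality away from x is not needed.
  obtain ⟨L, hLs, hLx, hLd⟩ := exists_matrix_jet hx L0 fun m => -((conn G m x).transpose * L0)
  have hdetL : (L x).det ≠ 0 := by rw [hLx]; exact (det_ne_zero_of_frame hL0).1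
  set M : Coord → Mat := fun y => (L y)⁻¹ with hM
  have hMs : SmM M x := hLs.inv hdetL
  have hMx : M x = M0 := by
    rw [hM]; simp only [hLx]; exact Matrix.inv_eq_left_inv hML0
  have hMd : ∀ m, pdM m M x = M x * (conn G m x).transpose := by
    intro m
    rw [hM, pdM_inv hx m hLs hdetL, hLd, ← hLx]
    simp only [Matrix.mul_neg, Matrix.neg_mul, neg_neg, Matrix.mul_assoc]
    rw [Matrix.mul_nonsing_inv _ (isUnit_iff_ne_zero.2 hdetL), Matrix.mul_one]
  have hev : ∀ᶠ y in 𝓝[HS] x, y ∈ U ∧ L y * M y = 1 := by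
    filter_upwards [hC.met.nhd x hxU, hLs.det.continuousWithinAt.eventually_ne hdetL] with y hy hy'
    exact ⟨hy, Matrix.mul_nonsing_inv _ (isUnit_iff_ne_zero.2 hy')⟩
  set A : Coord → Mat := fun y => (L y).transpose * G y * L y with hA
  have hGs := hC.met.sm x hxU
  have hAs : SmM A x := (hLs.transpose.mul hGs).mul hLs
  have hAx : A x = mink := by simp only [hA, hLx]; exact hL0
  -- The frame metric is stationary at x, because both the metric and the legs are parallel there.
  have hAd : ∀ m, pdM m A x = 0 := by
    intro m
    rw [hA, pdM_mul hx m (hLs.transpose.mul hGs) hLs, pdM_mul hx m hLs.transpose hGs, pdM_transpose,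
      hLd, hC.met.pdM_metric hxU, hLx, Matrix.transpose_neg, Matrix.transpose_mul,
      Matrix.transpose_transpose]
    noncomm_ring
  have hAf : ∀ a b, FlatAt (fun y => A y a b) x := fun a b =>
    ⟨hAs a b, fun m => congrFun (congrFun (hAd m) a) b⟩
  have hAdet : (A x).det ≠ 0 := by rw [hAx, det_mink]; norm_num
  set u : Coord → Fin 4 → ℝ := fun y => (M y).mulVec (v y) with hu
  have hux : u x = Pi.single 0 l := by
    simp only [hu, hMx, ← hlv, Matrix.mulVec_mulVec, hML0, Matrix.one_mulVec]
  -- The frame components of v are stationary as well. So in the derivative of the Bel-Robinson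
  -- covector only the rescaled Weyl tensor is differentiated.
  have huf : ∀ a, FlatAt (fun y => u y a) x := by
    intro a
    refine ⟨show SmAt (fun y => ∑ b, M y a b * v y b) x from
      SmAt.sum fun b _ => (hMs a b).mul (hv b), fun m => ?_⟩
    have e : pd m (fun y => u y a) x = ∑ b, (pdM m M x a b * v x b + M x a b * pd m (fun y => v y b) x) := by
      have : (fun y => u y a) = fun y => ∑ b, M y a b * v y b := rfl
      rw [this, pd_sum hx m fun b _ => ((hMs a b).mul (hv b)).dAt]
      exact Finset.sum_congr rfl fun b _ => pd_mul hx m (hMs a b).dAt (hv b).dAt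
    have e2 : ∑ b, pdM m M x a b * v x b = ∑ b, M x a b * ∑ l, christoffel G b m l x * v x l := by
      rw [hMd]
      exact (sum_mul_assoc_aux (M x) (conn G m x).transpose (v x) a).symm
    rw [e, Finset.sum_add_distrib, e2, ← Finset.sum_add_distrib]
    exact Finset.sum_eq_zero fun b _ => by rw [hvp]; ring
  set W : Coord → Arr := fun y a b c d => rescaledWeyl G Ω a b c d y with hW
  have hWs : SmA W x := fun a b c d => hC.sm_rescaledWeyl hxU a b c d
  set w : Coord → Arr := fun y => frameArr (L y) (M y) (W y) with hw
  have hws : SmA w x := by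
    have : w = fun y => act1 (L y).transpose
      (act2 (L y).transpose (act3 (L y).transpose (act4 (M y) (W y)))) := by
      funext y; simp only [hw]; rw [frameArr_eq]
    rw [this]
    exact hLs.transpose.act1 (hLs.transpose.act2 (hLs.transpose.act3 (hMs.act4 hWs)))
  have hwsym : ∀ᶠ y in 𝓝[HS] x, WeylSym (A y) (w y) := by
    filter_upwards [hev] with y hy
    exact (hC.weylSym_rescaledWeyl hy.1).frame hy.2
  set q : Fin 4 → Coord → ℝ := fun e y => brCovector (A y) (w y) (u y) e with hq
  have hqs : ∀ e, SmAt (q e) x := fun e => hws.brCovector hAs hAdet (fun a => (huf a).sm) e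
  -- `K` raises the frame index of the covector `q` and returns to coordinate components. It is
  -- parallel at x, and its derivative yields the Christoffel term that cancels in the covariant
  -- divergence.
  set K : Coord → Mat := fun y => L y * (A y)⁻¹ with hK
  have hKs : SmM K x := hLs.mul (hAs.inv hAdet)
  have hKd : ∀ m, pdM m K x = -((conn G m x).transpose * K x) := by
    intro m
    rw [hK, pdM_mul hx m hLs (hAs.inv hAdet), pdM_inv hx m hAs hAdet, hAd, hLd, ← hLx]
    simp [Matrix.mul_assoc]
  have hsm : ∀ᶠ y in 𝓝[HS] x, ∀ a, supermomentum G Ω v y a = -∑ e, K y a e * q e y := by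
    filter_upwards [hev] with y hy a
    have hdG := hC.met.det y hy.1
    have hqe : (fun e => q e y) = (L y).transpose.mulVec (brCovector (G y) (W y) (v y)) := by
      funext e
      simp only [hq, hA, hw]
      rw [brCovector_frame hy.2 (G y) hdG]
      simp only [hu, Matrix.mulVec_mulVec, hy.2, Matrix.one_mulVec]
      rfl
    have hinv : K y * (L y).transpose = (G y)⁻¹ := by
      simp only [hK, hA]
      rw [Matrix.mul_assoc, inv_frame_metric hy.2 (G y) hdG, ← Matrix.mul_assoc, hy.2, Matrix.one_mul]
    rw [supermomentum_eq]
    congr 1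
    have : ∑ e, K y a e * q e y = (K y).mulVec (fun e => q e y) a := rfl
    rw [this, hqe, Matrix.mulVec_mulVec, hinv]
    rfl
  have hKx : K x = L0 * mink := by simp only [hK, hAx, hLx, mink_inv]
  -- the divergence reduces to frame derivatives
  have hPx : ∀ a, supermomentum G Ω v x a = -∑ e, K x a e * q e x := hsm.self_of_nhdsWithin hx
  have hPd : ∀ m a, pd m (fun y => supermomentum G Ω v y a) x
      = -∑ l, christoffel G a m l x * supermomentum G Ω v x l - ∑ e, K x a e * pd m (q e) x := by
    intro m a
    rw [pd_congr hx (hsm.mono fun y hy => hy a), pd_neg hx,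
      pd_sum hx m fun e _ => ((hKs a e).mul (hqs e)).dAt]
    have e1 : ∀ e, pd m (fun y => K y a e * q e y) x
        = -(((conn G m x).transpose * K x) a e * q e x) + K x a e * pd m (q e) x := by
      intro e
      rw [pd_mul hx m (hKs a e).dAt (hqs e).dAt]
      have := congrFun (congrFun (hKd m) a) e
      simp only [pdM, Matrix.of_apply, Matrix.neg_apply] at this
      rw [this]; ring
    have e2 : ∑ e, ((conn G m x).transpose * K x) a e * q e x
        = -∑ l, christoffel G a m l x * supermomentum G Ω v x l := by
      rw [← sum_mul_assoc_aux (conn G m x).transpose (K x) (fun e => q e x) a,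
        ← Finset.sum_neg_distrib]
      exact Finset.sum_congr rfl fun l _ => by rw [hPx]; simp [conn]
    simp only [e1, Finset.sum_add_distrib, Finset.sum_neg_distrib]
    rw [e2]; ring
  have hdiv : divergence G (supermomentum G Ω v) x = -∑ m, ∑ e, K x m e * pd m (q e) x := by
    rw [divergence, ← Finset.sum_neg_distrib]
    exact Finset.sum_congr rfl fun m _ => by rw [hPd]; ring
  -- `D e` is the derivative of the frame components along the leg e; being taken where the frame
  -- metric is stationary, it is again a Weyl candidate for the Minkowski matrix.
  set D : Fin 4 → Arr := fun e a b c d => ∑ m, L0 m e * pdA m w x a b c d with hD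
  have hDsym : ∀ e, WeylSym mink (D e) := fun e => WeylSym.sum (fun m => L0 m e) (fun m => pdA m w x)
    fun m => by rw [← hAx]; exact WeylSym.pdA hx hws hAf hwsym m
  have hpw : ∀ m, pdA m w x = frameArr L0 M0 (covA G m W x) := by
    intro m
    rw [← hLx, ← hMx]
    exact pdA_frameArr hx hLs hMs hWs m (by rw [hLd, hLx]) (hMd m)
  -- The leg in the direction of differentiation and the dual leg in the last slot cancel in the
  -- contraction, which leaves frame components of the covariant divergence of d.
  have hDdiv : ∀ a b c, ∑ d, D d a b c d = 0 := by
    intro a b c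
    simp only [hD, hpw]
    have e1 : ∀ m, ∑ d, L0 m d * frameArr L0 M0 (covA G m W x) a b c d
        = act1 L0.transpose (act2 L0.transpose (act3 L0.transpose (covA G m W x))) a b c m := by
      intro m
      have h1 : act4 L0 (frameArr L0 M0 (covA G m W x))
          = act1 L0.transpose (act2 L0.transpose (act3 L0.transpose (covA G m W x))) := by
        rw [frameArr_eq, ← act1_act4, ← act2_act4, ← act3_act4, act4_act4, hLM0, act4_one]
      rw [← h1]; rfl
    rw [Finset.sum_comm]
    simp only [e1, act1, act2, act3, Finset.mul_sum]
    rw [Finset.sum_comm]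
    refine Finset.sum_eq_zero fun p _ => ?_
    rw [Finset.sum_comm]
    refine Finset.sum_eq_zero fun r _ => ?_
    rw [Finset.sum_comm]
    refine Finset.sum_eq_zero fun s _ => ?_
    simp only [← Finset.mul_sum]
    rw [sum_covA, hC.covDiv_rescaledWeyl hdec hxU h0]
    simp
  have hwx : WeylSym mink (w x) := by rw [← hAx]; exact hwsym.self_of_nhdsWithin hx
  have hfin := sum_brForm_mink_eq_zero hwx hDsym hDdiv l
  rw [hdiv, neg_eq_zero, ← hfin, Finset.sum_comm]
  refine Finset.sum_congr rfl fun e _ => ?_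
  simp only [hD]
  rw [(brForm_sum _ _ _ _ _ _).1, (brForm_sum _ _ _ _ _ _).2, ← Finset.sum_add_distrib,
    Finset.mul_sum]
  refine Finset.sum_congr rfl fun m _ => ?_
  have hKe : K x m e = L0 m e * mink e e := by rw [hKx, mink, Matrix.mul_diagonal]; simp
  have hqd : pd m (q e) x = brForm mink (pdA m w x) (w x) (Pi.single 0 l) e
      + brForm mink (w x) (pdA m w x) (Pi.single 0 l) e := by
    rw [← hAx, ← hux]
    exact pd_brCovector hx hws hAf hAdet huf e m
  rw [hKe, hqd]; ring

end CompletionOn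

end Scri

/-! ### The normal in a divergence-free gauge, and the three properties in a coordinate patch -/

namespace Scri

section hessian

variable {U : Set Coord} {G : MetricComp} {Ω : Coord → ℝ} {x : Coord} (h : MetricOn U G)
  (hΩ : ∀ y ∈ U, SmAt Ω y) (hx : x ∈ U) (hH : ∀ a b, hessian G Ω a b x = 0)
include h hΩ hx hH

/-- The inverse metric is parallel, so ∇_a N_b = 0 makes N^a parallel at the point. -/
lemma pd_normal_of_hessian (m a : Fin 4) :
    pd m (fun y => normal G Ω y a) x = -∑ l, christoffel G a m l x * normal G Ω x l := by
  have hs := h.hs hx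
  have e1 : ∀ b, pd m (pd b Ω) x = ∑ c, christoffel G c m b x * pd c Ω x := fun b => by
    have := hH m b
    rw [hessian] at this
    exact sub_eq_zero.1 this
  have sN : ∀ b, SmAt (pd b Ω) x := fun b => (hΩ x hx).pd hs b
  have e2 : pd m (fun y => normal G Ω y a) x
      = ∑ b, (pdM m (fun y => (G y)⁻¹) x a b * pd b Ω x + (G x)⁻¹ a b * pd m (pd b Ω) x) := by
    have : (fun y => normal G Ω y a) = fun y => ∑ b, (G y)⁻¹ a b * pd b Ω y := rfl
    rw [this, pd_sum hs m fun b _ => ((h.smM_inv hx a b).mul (sN b)).dAt]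
    exact Finset.sum_congr rfl fun b _ => pd_mul hs m (h.smM_inv hx a b).dAt (sN b).dAt
  have e3 : ∑ b, (G x)⁻¹ a b * pd m (pd b Ω) x
      = ((G x)⁻¹ * conn G m x).mulVec (fun b => pd b Ω x) a := by
    simp only [e1]
    exact sum_mul_assoc_aux (G x)⁻¹ (conn G m x) (fun b => pd b Ω x) a
  have e4 : ∑ l, christoffel G a m l x * normal G Ω x l
      = ((conn G m x).transpose * (G x)⁻¹).mulVec (fun b => pd b Ω x) a :=
    sum_mul_assoc_aux (conn G m x).transpose (G x)⁻¹ (fun b => pd b Ω x) a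
  have e5 : ∑ b, pdM m (fun y => (G y)⁻¹) x a b * pd b Ω x
      = (pdM m (fun y => (G y)⁻¹) x).mulVec (fun b => pd b Ω x) a := rfl
  rw [e2, Finset.sum_add_distrib, e3, e4, e5, h.pdM_metricInv hx, Matrix.neg_mulVec,
    Matrix.add_mulVec]
  simp

lemma flat_normalSq : FlatAt (normalSq G Ω) x := by
  have hs := h.hs hx
  have sN : ∀ b, SmAt (pd b Ω) x := fun b => (hΩ x hx).pd hs b
  have sn := fun a => sm_normal h hΩ hx a
  refine ⟨sm_normalSq h hΩ hx, fun m => ?_⟩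
  have e1 : ∀ b, pd m (pd b Ω) x = ∑ c, christoffel G c m b x * pd c Ω x := fun b => by
    have := hH m b
    rw [hessian] at this
    exact sub_eq_zero.1 this
  have e2 : pd m (normalSq G Ω) x
      = ∑ a, (pd m (pd a Ω) x * normal G Ω x a + pd a Ω x * pd m (fun y => normal G Ω y a) x) := by
    have : normalSq G Ω = fun y => ∑ b, pd b Ω y * normal G Ω y b := rfl
    rw [this, pd_sum hs m fun b _ => ((sN b).mul (sn b)).dAt]
    exact Finset.sum_congr rfl fun b _ => pd_mul hs m (sN b).dAt (sn b).dAt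
  rw [e2]
  simp only [e1, pd_normal_of_hessian h hΩ hx hH, Finset.sum_add_distrib, mul_neg,
    Finset.sum_neg_distrib, Finset.sum_mul, Finset.mul_sum]
  rw [Finset.sum_comm, ← sub_eq_add_neg, sub_eq_zero]
  exact Finset.sum_congr rfl fun a _ => Finset.sum_congr rfl fun b _ => by ring

/-- N² is stationary by `flat_normalSq`, and a nonvanishing function is stationary where its square
is. Hence n^a is parallel together with N^a. -/
lemma flat_lapse (hn : normalSq G Ω x < 0) : FlatAt (lapse G Ω) x := by
  have hs := h.hs hx
  have hf := flat_normalSq h hΩ hx hH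
  have hsm : SmAt (lapse G Ω) x := ContDiffWithinAt.sqrt hf.sm.neg (by linarith)
  have h0 : lapse G Ω x ≠ 0 := (Real.sqrt_pos.2 (by linarith)).ne'
  refine FlatAt.of_sq hs hsm h0 fun m => ?_
  rw [pd_congr hs (g := fun y => -normalSq G Ω y), pd_neg hs, hf.pd_eq, neg_zero]
  filter_upwards [hf.sm.continuousWithinAt.eventually_lt_const hn] with y hy
  exact Real.sq_sqrt (by linarith)

end hessian

namespace CompletionOn

variable {κ Λ : ℝ} {U : Set Coord} {G : MetricComp} {Ω : Coord → ℝ} {x : Coord}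
  (hC : CompletionOn κ Λ U G Ω)
include hC

lemma normalSq_neg (hx : x ∈ U) (h0 : x 0 = 0) : normalSq G Ω x < 0 := by
  rw [hC.normalSq_eq hx h0]; linarith [hC.lam]

lemma sm_lapse (hx : x ∈ U) (hn : normalSq G Ω x < 0) : SmAt (lapse G Ω) x :=
  ContDiffWithinAt.sqrt (sm_normalSq hC.met (fun _ hy => hC.smΩ hy) hx).neg (by linarith)

omit hC in
lemma lapse_ne_zero (hn : normalSq G Ω x < 0) : lapse G Ω x ≠ 0 :=
  (Real.sqrt_pos.2 (by linarith)).ne'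

lemma sm_unitNormal (hx : x ∈ U) (hn : normalSq G Ω x < 0) (a : Fin 4) :
    SmAt (fun y => unitNormal G Ω y a) x :=
  ((hC.sm_lapse hx hn).inv (lapse_ne_zero hn)).mul
    (sm_normal hC.met (fun _ hy => hC.smΩ hy) hx a)

lemma sm_supermomentum (hx : x ∈ U) {v : Coord → Fin 4 → ℝ} (hv : ∀ a, SmAt (fun y => v y a) x)
    (a : Fin 4) : SmAt (fun y => supermomentum G Ω v y a) x := by
  simp only [supermomentum_eq]
  exact SmAt.neg (SmAt.sum fun e _ => (hC.met.sm_ginv hx a e).mul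
    (SmA.brCovector (W := fun y a b c d => rescaledWeyl G Ω a b c d y)
      (fun a b c d => hC.sm_rescaledWeyl hx a b c d) (hC.met.sm x hx) (hC.met.det x hx) hv e))

/-- The two supermomenta of the theorem are built on vectors positively proportional to the normal. -/
lemma exists_vector {P : MetricComp → (Coord → ℝ) → Coord → Fin 4 → ℝ}
    (hP : P = canonicalSupermomentum ∨ P = asymptoticSupermomentum) :
    ∃ v : Coord → Fin 4 → ℝ, P G Ω = supermomentum G Ω v ∧
      (∀ x ∈ U, normalSq G Ω x < 0 → (∀ a, SmAt (fun y => v y a) x) ∧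
        ∃ c : ℝ, 0 < c ∧ v x = c • normal G Ω x) ∧
      ∀ x ∈ U, normalSq G Ω x < 0 → (∀ a b, hessian G Ω a b x = 0) →
        ∀ m a, pd m (fun y => v y a) x = -∑ l, christoffel G a m l x * v x l := by
  have hΩ : ∀ y ∈ U, SmAt Ω y := fun y hy => hC.smΩ hy
  rcases hP with rfl | rfl
  · refine ⟨unitNormal G Ω, rfl, fun x hx hn => ⟨hC.sm_unitNormal hx hn, (lapse G Ω x)⁻¹,
      inv_pos.2 (Real.sqrt_pos.2 (by linarith)), rfl⟩, fun x hx hn hH m a => ?_⟩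
    have hs := hC.met.hs hx
    have hl := flat_lapse hC.met hΩ hx hH hn
    have h0 := lapse_ne_zero hn
    have : (fun y => unitNormal G Ω y a) = fun y => (lapse G Ω y)⁻¹ * normal G Ω y a := rfl
    rw [this, pd_mul hs m (hl.sm.inv h0).dAt (sm_normal hC.met hΩ hx a).dAt,
      pd_inv hs m hl.sm.dAt h0, hl.pd_eq, pd_normal_of_hessian hC.met hΩ hx hH]
    simp only [unitNormal, neg_zero, zero_mul, zero_add, mul_neg, Finset.mul_sum]
    congr 1
    exact Finset.sum_congr rfl fun l _ => by ring
  · exact ⟨normal G Ω, rfl, fun x hx hn => ⟨sm_normal hC.met hΩ hx, 1, one_pos, (one_smul _ _).symm⟩,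
      fun x hx hn hH m a => pd_normal_of_hessian hC.met hΩ hx hH m a⟩

section main

variable {P : MetricComp → (Coord → ℝ) → Coord → Fin 4 → ℝ}
  (hP : P = canonicalSupermomentum ∨ P = asymptoticSupermomentum)
include hP

lemma sm_main (hx : x ∈ U) (hn : normalSq G Ω x < 0) (a : Fin 4) :
    SmAt (fun y => P G Ω y a) x := by
  obtain ⟨v, hPv, hv, -⟩ := hC.exists_vector hP
  rw [hPv]
  exact hC.sm_supermomentum hx (hv x hx hn).1 a

lemma divergence_main (hdec : DecayOn κ Λ U G Ω 3) (hx : x ∈ U) (h0 : x 0 = 0)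
    (hH : ∀ a b, hessian G Ω a b x = 0) : divergence G (P G Ω) x = 0 := by
  obtain ⟨v, hPv, hv, hvd⟩ := hC.exists_vector hP
  have hn := hC.normalSq_neg hx h0
  obtain ⟨hs, c, hc, hvc⟩ := hv x hx hn
  rw [hPv]
  refine hC.divergence_supermomentum hdec hx h0 hs ?_ (hvd x hx hn hH)
  rw [hvc, bil, Matrix.mulVec_smul, smul_dotProduct, dotProduct_smul, ← bil,
    (bil_normal (Ω := Ω) hC.met hx).2, smul_eq_mul, smul_eq_mul, ← mul_assoc]
  exact mul_neg_of_pos_of_neg (mul_pos hc hc) hn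

/-- The supermomentum is causal with the time orientation of the normal. -/
lemma causal_main (hx : x ∈ U) (hn : normalSq G Ω x < 0) {t : Fin 4 → ℝ} (ht : bil (G x) t t < 0)
    (htn : bil (G x) t (normal G Ω x) < 0) :
    bil (G x) (P G Ω x) (P G Ω x) ≤ 0 ∧ (P G Ω x = 0 ∨ bil (G x) t (P G Ω x) < 0) := by
  obtain ⟨v, hPv, hv, -⟩ := hC.exists_vector hP
  obtain ⟨-, c, hc, hvc⟩ := hv x hx hn
  have h1 : bil (G x) (v x) (v x) < 0 := by
    rw [hvc, bil, Matrix.mulVec_smul, smul_dotProduct, dotProduct_smul, ← bil,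
      (bil_normal (Ω := Ω) hC.met hx).2, smul_eq_mul, smul_eq_mul, ← mul_assoc]
    exact mul_neg_of_pos_of_neg (mul_pos hc hc) hn
  have h2 : bil (G x) t (v x) < 0 := by
    rw [hvc, bil, Matrix.mulVec_smul, dotProduct_smul, ← bil, smul_eq_mul]
    exact mul_neg_of_pos_of_neg hc htn
  have := brCovector_causal (hC.lorentz x hx) (hC.weylSym_rescaledWeyl hx) ht h1 h2
  have he : P G Ω x = fun a => -∑ e, (G x)⁻¹ a e *
      brCovector (G x) (fun a b c d => rescaledWeyl G Ω a b c d x) (v x) e := by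
    funext a; rw [hPv, supermomentum_eq]; rfl
  rw [he]
  exact this

end main

/-! ### Gauge transformations -/

section gauge

variable {φ : Coord → ℝ} (hφ : ∀ y ∈ U, SmAt φ y) (hφ0 : ∀ y ∈ U, 0 < φ y)

include hφ hφ0

omit hφ0 in
-- The term with the derivative of φ carries a factor Ω, which vanishes at the boundary. This
-- confines the gauge laws for the normal to 𝒥.
lemma pd_gauge (hx : x ∈ U) (h0 : x 0 = 0) (a : Fin 4) :
    pd a (fun y => φ y * Ω y) x = φ x * pd a Ω x := by
  rw [pd_mul (hC.met.hs hx) a (hφ x hx).dAt (hC.smΩ hx).dAt, hC.zero x hx h0]; ring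

lemma normal_gauge (hx : x ∈ U) (h0 : x 0 = 0) (a : Fin 4) :
    normal (rescale φ G) (fun y => φ y * Ω y) x a = (φ x)⁻¹ * normal G Ω x a := by
  have hne := (hφ0 x hx).ne'
  simp only [normal, normalLow, hC.pd_gauge hφ hx h0,
    hC.met.ginv_rescale hφ (fun y hy => (hφ0 y hy).ne') hx, Finset.mul_sum]
  exact Finset.sum_congr rfl fun b _ => by field_simp

lemma normalSq_gauge (hx : x ∈ U) (h0 : x 0 = 0) :
    normalSq (rescale φ G) (fun y => φ y * Ω y) x = normalSq G Ω x := by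
  have hne := (hφ0 x hx).ne'
  simp only [normalSq, hC.normal_gauge hφ hφ0 hx h0, normalLow, hC.pd_gauge hφ hx h0]
  exact Finset.sum_congr rfl fun b _ => by field_simp

/-- C_{abc}^d is unchanged and Ω is multiplied by φ. Near the point the regions Ω > 0 and φΩ > 0
coincide, so both limits are taken along the same filter and the law holds up to the boundary. -/
lemma rescaledWeyl_gauge (hx : x ∈ U) (a b c d : Fin 4) :
    rescaledWeyl (rescale φ G) (fun y => φ y * Ω y) a b c d x
      = (φ x)⁻¹ * rescaledWeyl G Ω a b c d x := by
  have hne : ∀ y ∈ U, φ y ≠ 0 := fun y hy => (hφ0 y hy).ne'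
  have hS : 𝓝[{y | y ∈ HS ∧ 0 < φ y * Ω y}] x = 𝓝[{y | y ∈ HS ∧ 0 < Ω y}] x := by
    rw [nhdsWithin_eq_iff_eventuallyEq]
    have : ∀ᶠ y in 𝓝 x, y ∈ HS → y ∈ U := by
      rw [← eventually_nhdsWithin_iff]; exact hC.met.nhd x hx
    filter_upwards [this] with y hy
    apply propext
    constructor
    · rintro ⟨h1, h2⟩; exact ⟨h1, pos_of_mul_pos_right h2 (hφ0 y (hy h1)).le⟩
    · rintro ⟨h1, h2⟩; exact ⟨h1, mul_pos (hφ0 y (hy h1)) h2⟩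
  have hnb := hC.toDefFn.neBot hx
  refine extendFrom_eq ?_ ?_
  · rw [mem_closure_iff_nhdsWithin_neBot, hS]; exact hnb
  · rw [hS]
    have hs : SmAt (fun y => (φ y)⁻¹ * rescaledWeyl G Ω a b c d y) x :=
      ((hφ x hx).inv (hne x hx)).mul (hC.sm_rescaledWeyl hx a b c d)
    refine (hs.continuousWithinAt.tendsto.mono_left DefFn.phys_le).congr' ?_
    refine hC.toDefFn.eventually_phys hx fun y hy hpos => ?_
    change (φ y)⁻¹ * rescaledWeyl G Ω a b c d y = (φ y * Ω y)⁻¹ * weyl (rescale φ G) a b c d y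
    rw [hC.rescaledWeyl_eq_of_pos hy hpos, hC.met.weyl_rescale hφ hne hy, mul_inv]
    ring

omit hC hφ hφ0 in
-- In dimension four the dual on an index pair is conformally invariant: √|det| gains c⁴ and the two
-- inverse metrics lose c⁴.
lemma hodgeAt_smul (A : Mat) (w : Arr) {c : ℝ} (hc : c ≠ 0) (k : ℝ) :
    hodgeAt (c ^ 2 • A) (fun i j l m => k * w i j l m) = fun i j l m => k * hodgeAt A w i j l m := by
  have hinv : (c ^ 2 • A)⁻¹ = (c ^ 2)⁻¹ • A⁻¹ := by
    by_cases hA : IsUnit A.det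
    · refine Matrix.inv_eq_left_inv ?_
      rw [Matrix.smul_mul, Matrix.mul_smul, smul_smul, inv_mul_cancel₀ (pow_ne_zero 2 hc), one_smul,
        Matrix.nonsing_inv_mul _ hA]
    · rw [Matrix.nonsing_inv_apply_not_isUnit _ hA, Matrix.nonsing_inv_apply_not_isUnit, smul_zero]
      rw [Matrix.det_smul, isUnit_iff_ne_zero]
      rw [isUnit_iff_ne_zero, not_not] at hA
      simp [hA]
  have hdet : Real.sqrt |(c ^ 2 • A).det| = c ^ 4 * Real.sqrt |A.det| := by
    rw [Matrix.det_smul, abs_mul, Real.sqrt_mul (abs_nonneg _)]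
    congr 1
    rw [abs_of_nonneg (by positivity)]
    have : (c ^ 2) ^ Fintype.card (Fin 4) = (c ^ 4) ^ 2 := by simp; ring
    rw [this, Real.sqrt_sq (by positivity)]
  funext i j l m
  simp only [hodgeAt, hinv, hdet, Matrix.smul_apply, smul_eq_mul, Finset.mul_sum]
  refine Finset.sum_congr rfl fun _ _ => Finset.sum_congr rfl fun _ _ =>
    Finset.sum_congr rfl fun _ _ => Finset.sum_congr rfl fun _ _ => ?_
  field_simp

omit hC hφ hφ0 in
lemma brCovector_gauge (A : Mat) (w : Arr) {c : ℝ} (hc : c ≠ 0) (k s : ℝ) (v : Fin 4 → ℝ)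
    (e : Fin 4) : brCovector (c ^ 2 • A) (fun i j l m => k * w i j l m) (s • v) e
      = k ^ 2 * s ^ 3 * brCovector A w v e := by
  have l1 : ∀ (w : Arr) (X : Fin 4 → ℝ), slotMat (fun i j l m => k * w i j l m) X (s • v)
      = (k * s) • slotMat w X v := by
    intro w X
    ext b d
    simp only [slotMat, Matrix.of_apply, Matrix.smul_apply, Pi.smul_apply, smul_eq_mul, Finset.mul_sum]
    exact Finset.sum_congr rfl fun _ _ => Finset.sum_congr rfl fun _ _ => by ring
  have l2 : ∀ (w : Arr), slotMat w (s • v) v = s • slotMat w v v := by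
    intro w
    ext b d
    simp only [slotMat, Matrix.of_apply, Matrix.smul_apply, Pi.smul_apply, smul_eq_mul, Finset.mul_sum]
    exact Finset.sum_congr rfl fun _ _ => Finset.sum_congr rfl fun _ _ => by ring
  simp only [brCovector, hodgeAt_smul A w hc k, l1, l2, Matrix.smul_mul, Matrix.mul_smul,
    Matrix.trace_smul, smul_eq_mul]
  ring

/-- The exponent is 7 = 2 + 2 + 3: the inverse metric, two factors of the rescaled Weyl tensor, and
three vectors. -/
lemma supermomentum_gauge (hx : x ∈ U) {v v' : Coord → Fin 4 → ℝ}
    (hv : v' x = (φ x)⁻¹ • v x) (a : Fin 4) :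
    supermomentum (rescale φ G) (fun y => φ y * Ω y) v' x a
      = (φ x ^ 7)⁻¹ * supermomentum G Ω v x a := by
  have hne := (hφ0 x hx).ne'
  have hR : rescale φ G x = φ x ^ 2 • G x := rfl
  simp only [supermomentum_eq, hC.rescaledWeyl_gauge hφ hφ0 hx, hv, hR,
    brCovector_gauge _ _ hne, hC.met.ginv_rescale hφ (fun y hy => (hφ0 y hy).ne') hx, mul_neg,
    Finset.mul_sum]
  congr 1
  exact Finset.sum_congr rfl fun e _ => by field_simp

lemma main_gauge (hx : x ∈ U) (h0 : x 0 = 0) {P : MetricComp → (Coord → ℝ) → Coord → Fin 4 → ℝ}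
    (hP : P = canonicalSupermomentum ∨ P = asymptoticSupermomentum) (a : Fin 4) :
    P (rescale φ G) (fun y => φ y * Ω y) x a = (φ x ^ 7)⁻¹ * P G Ω x a := by
  have hn := fun a => hC.normal_gauge hφ hφ0 hx h0 a
  rcases hP with rfl | rfl
  · refine hC.supermomentum_gauge hφ hφ0 hx ?_ a
    funext b
    simp only [unitNormal, lapse, hC.normalSq_gauge hφ hφ0 hx h0, hn, Pi.smul_apply, smul_eq_mul]
    ring
  · exact hC.supermomentum_gauge hφ hφ0 hx (funext fun b => hn b) a

lemma superPoynting_gauge (hx : x ∈ U) (h0 : x 0 = 0) (a : Fin 4) :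
    superPoynting (rescale φ G) (fun y => φ y * Ω y) x a = (φ x ^ 7)⁻¹ * superPoynting G Ω x a := by
  have hn := fun a => hC.normal_gauge hφ hφ0 hx h0 a
  have hp := fun a => hC.main_gauge hφ hφ0 hx h0 (Or.inl rfl) a
  have hne := (hφ0 x hx).ne'
  simp only [superPoynting, hp, unitNormal, unitNormalLow, lapse, normalLow,
    hC.normalSq_gauge hφ hφ0 hx h0, hn, hC.pd_gauge hφ hx h0, mul_add, Finset.mul_sum]
  congr 1
  exact Finset.sum_congr rfl fun e _ => by field_simp

end gauge

end CompletionOn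

end Scri

/-! ### Charts of a manifold with boundary -/

namespace Scri

section chart

variable {M : Type*} [TopologicalSpace M]
  {e e' : OpenPartialHomeomorph M (EuclideanHalfSpace 4)} {x : Coord} {p : M}

lemma pt_mem_source (hx : x ∈ dom e) : pt e x ∈ e.source := by
  have := (e.extend (𝓡∂ 4)).map_target hx
  rwa [e.extend_source] at this

lemma extend_pt (hx : x ∈ dom e) : e.extend (𝓡∂ 4) (pt e x) = x := (e.extend (𝓡∂ 4)).right_inv hx

lemma pt_extend (hp : p ∈ e.source) : pt e (e.extend (𝓡∂ 4) p) = p := e.extend_left_inv hp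

lemma extend_mem_dom (hp : p ∈ e.source) : e.extend (𝓡∂ 4) p ∈ dom e :=
  (e.extend (𝓡∂ 4)).map_source (by rwa [e.extend_source])

lemma relOpen_dom (e : OpenPartialHomeomorph M (EuclideanHalfSpace 4)) : RelOpen (dom e) where
  sub := e.extend_target_subset_range
  nhd x hx := by
    have := e.extend_target_mem_nhdsWithin (I := 𝓡∂ 4) (pt_mem_source hx)
    rwa [extend_pt hx] at this

lemma dom_eq (e : OpenPartialHomeomorph M (EuclideanHalfSpace 4)) : dom e = (𝓡∂ 4) '' e.target :=
  e.extend_target'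

variable [ChartedSpace (EuclideanHalfSpace 4) M]

lemma contMDiffOn_pt (he : IsChart e) : ContMDiffOn 𝓘(ℝ, Coord) (𝓡∂ 4) ∞ (pt e) (dom e) := by
  rw [dom_eq]
  exact contMDiffOn_extend_symm he

lemma contMDiffWithinAt_pt (he : IsChart e) (hx : x ∈ dom e) :
    ContMDiffWithinAt 𝓘(ℝ, Coord) (𝓡∂ 4) ∞ (pt e) HS x :=
  (contMDiffOn_pt he x hx).mono_of_mem_nhdsWithin ((relOpen_dom e).nhd x hx)

lemma smAt_inChart {f : M → ℝ} (hf : ContMDiff (𝓡∂ 4) 𝓘(ℝ, ℝ) ∞ f) (he : IsChart e) (hx : x ∈ dom e) :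
    SmAt (inChart f e) x :=
  contMDiffWithinAt_iff_contDiffWithinAt.1 ((hf (pt e x)).comp_contMDiffWithinAt x (contMDiffWithinAt_pt he hx))

/-- A transition map has surjective derivative and takes values in the closed convex half-space, so
it cannot send an interior point to a boundary point: near such a point its image would leave the
half-space. -/
lemma extend_mem_interior_HS (he : IsChart e) (he' : IsChart e') (hp : p ∈ e.source) (hp' : p ∈ e'.source)
    (h : e.extend (𝓡∂ 4) p ∈ interior HS) : e'.extend (𝓡∂ 4) p ∈ interior HS := by
  let I := 𝓡∂ 4
  have hx : e.extend I p ∈ interior (e.extend I).target :=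
    e.mem_interior_extend_target (e.map_source hp) h
  let φ := I.extendCoordChange e e'
  have hφ : ContDiffOn ℝ ∞ φ φ.source := I.contDiffOn_extendCoordChange he he'
  have hs : e.extend I p ∈ φ.source := by simp [φ, hp, hp']
  have hsur : Function.Surjective (fderivWithin ℝ φ φ.source (e.extend I p)) :=
    (I.isInvertible_fderivWithin_extendCoordChange (by simp) he he' hs).surjective
  have hφx : φ.source ∈ 𝓝 (e.extend I p) := by
    simp_rw [φ, ModelWithCorners.extendCoordChange, PartialEquiv.trans_source, PartialEquiv.symm_source,
      Filter.inter_mem_iff, mem_interior_iff_mem_nhds.1 hx, true_and, e'.extend_source]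
    exact e.extend_preimage_mem_nhds hp <| e'.open_source.mem_nhds hp'
  rw [fderivWithin_of_mem_nhds hφx] at hsur
  have hφ' : DifferentiableAt ℝ φ (e.extend I p) :=
    (hφ.differentiableOn (by simp)).differentiableAt hφx
  have hmaps : MapsTo φ φ.source (range I) :=
    φ.mapsTo.mono_right <| by simp [φ, ModelWithCorners.extendCoordChange, inter_assoc]
  have := hφ'.mem_interior_convex_of_surjective_fderiv hφx I.convex_range I.isClosed_range
    I.nonempty_interior hmaps hsur
  rwa [show φ (e.extend I p) = e'.extend I p by simp [φ, hp]] at this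

/-- The chart is a left inverse of its parametrisation, so the derivative of the latter is
injective; equality of the finite dimensions gives surjectivity. -/
lemma bijective_mfderivWithin_pt (he : IsChart e) (hx : x ∈ dom e) :
    Function.Bijective (mfderivWithin 𝓘(ℝ, Coord) (𝓡∂ 4) (pt e) HS x) := by
  have hxs : x ∈ HS := (relOpen_dom e).sub hx
  have hu : UniqueMDiffWithinAt 𝓘(ℝ, Coord) HS x := (uniqueDiffOn_HS x hxs).uniqueMDiffWithinAt
  have hJ : MDifferentiableWithinAt 𝓘(ℝ, Coord) (𝓡∂ 4) (pt e) HS x :=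
    (contMDiffWithinAt_pt he hx).mdifferentiableWithinAt (by simp)
  have hK : MDifferentiableAt (𝓡∂ 4) 𝓘(ℝ, Coord) (e.extend (𝓡∂ 4)) (pt e x) :=
    (e.contMDiffAt_extend he (pt_mem_source hx)).mdifferentiableAt (by simp)
  have hcomp := mfderiv_comp_mfderivWithin x hK hJ hu
  have hid : mfderivWithin 𝓘(ℝ, Coord) 𝓘(ℝ, Coord) (e.extend (𝓡∂ 4) ∘ pt e) HS x
      = ContinuousLinearMap.id ℝ (TangentSpace 𝓘(ℝ, Coord) x) := by
    rw [← mfderivWithin_id hu]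
    refine Filter.EventuallyEq.mfderivWithin_eq ?_ (extend_pt hx)
    filter_upwards [(relOpen_dom e).nhd x hx] with y hy using extend_pt hy
  rw [hid] at hcomp
  have hinj : Function.Injective (mfderivWithin 𝓘(ℝ, Coord) (𝓡∂ 4) (pt e) HS x) := by
    intro v w hvw
    have h1 := DFunLike.congr_fun hcomp v
    have h2 := DFunLike.congr_fun hcomp w
    rw [ContinuousLinearMap.comp_apply] at h1 h2
    exact h1.trans ((congrArg _ hvw).trans h2.symm)
  have key : ∀ A : Coord →L[ℝ] Coord, Function.Injective A → Function.Bijective A := fun A hA =>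
    ⟨hA, LinearMap.injective_iff_surjective.1 hA⟩
  exact key _ hinj

variable [IsManifold (𝓡∂ 4) ∞ M]

/-- Interior points are defined through the preferred chart; invariance under transition maps
permits any other chart. -/
lemma isInteriorPoint_pt (he : IsChart e) (hx : x ∈ dom e) :
    (𝓡∂ 4).IsInteriorPoint (pt e x) ↔ 0 < x 0 := by
  have h1 : (𝓡∂ 4).IsInteriorPoint (pt e x) ↔ (chartAt _ (pt e x)).extend (𝓡∂ 4) (pt e x) ∈ interior HS :=
    Iff.rfl
  have hc : IsChart (chartAt (EuclideanHalfSpace 4) (pt e x)) := IsManifold.chart_mem_maximalAtlas _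
  have h2 : x ∈ interior HS ↔ 0 < x 0 := by rw [interior_HS]; rfl
  rw [h1, ← h2]
  constructor
  · intro h
    simpa only [extend_pt hx] using
      extend_mem_interior_HS hc he (mem_chart_source _ _) (pt_mem_source hx) h
  · intro h
    exact extend_mem_interior_HS he hc (pt_mem_source hx) (mem_chart_source _ _) (by rwa [extend_pt hx])

end chart

end Scri

/-! ### Tangent vectors in charts, and the passage from manifold data to coordinate patches -/

namespace Scri

section tangent

variable {M : Type*} [TopologicalSpace M] [ChartedSpace (EuclideanHalfSpace 4) M]
  {e : OpenPartialHomeomorph M (EuclideanHalfSpace 4)} {x : Coord}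

lemma toTangent_eq (e : OpenPartialHomeomorph M (EuclideanHalfSpace 4)) (x : Coord) (V : Fin 4 → ℝ) :
    toTangent e x V = mfderivWithin 𝓘(ℝ, Coord) (𝓡∂ 4) (pt e) HS x (WithLp.toLp 2 V : Coord) := by
  have : (WithLp.toLp 2 V : Coord) = ∑ i, V i • (EuclideanSpace.single i (1 : ℝ) : Coord) := by
    ext j
    simp [Pi.single_apply]
  rw [this]
  exact (map_sum (mfderivWithin 𝓘(ℝ, Coord) (𝓡∂ 4) (pt e) HS x) _ _ |>.trans
    (Finset.sum_congr rfl fun i _ => map_smul _ _ _)).symm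

lemma bil_comps (g : BilinField M) (e : OpenPartialHomeomorph M (EuclideanHalfSpace 4)) (x : Coord)
    (v w : Fin 4 → ℝ) : bil (comps g e x) v w = g (pt e x) (toTangent e x v) (toTangent e x w) := by
  simp only [bil, dotProduct, Matrix.mulVec, comps, Matrix.of_apply, toTangent, map_sum, map_smul,
    LinearMap.sum_apply, LinearMap.smul_apply, smul_eq_mul, Finset.mul_sum]
  rw [Finset.sum_comm]
  exact Finset.sum_congr rfl fun i _ => Finset.sum_congr rfl fun j _ => by ring

lemma exists_toTangent_eq (he : IsChart e) (hx : x ∈ dom e) (u : TangentSpace (𝓡∂ 4) (pt e x)) :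
    ∃ v, toTangent e x v = u := by
  obtain ⟨v, rfl⟩ := (bijective_mfderivWithin_pt he hx).2 u
  exact ⟨WithLp.ofLp v, toTangent_eq e x _⟩

lemma mfderiv_coordVec {f : M → ℝ} (hf : ContMDiff (𝓡∂ 4) 𝓘(ℝ, ℝ) ∞ f) (he : IsChart e) (hx : x ∈ dom e)
    (i : Fin 4) : mfderiv (𝓡∂ 4) 𝓘(ℝ, ℝ) f (pt e x) (coordVec e x i) = pd i (inChart f e) x := by
  have hu : UniqueMDiffWithinAt 𝓘(ℝ, Coord) HS x :=
    (uniqueDiffOn_HS x ((relOpen_dom e).sub hx)).uniqueMDiffWithinAt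
  have hcomp := mfderiv_comp_mfderivWithin x ((hf (pt e x)).mdifferentiableAt (by simp))
    ((contMDiffWithinAt_pt he hx).mdifferentiableWithinAt (by simp)) hu
  have h1 : pd i (inChart f e) x = mfderivWithin 𝓘(ℝ, Coord) 𝓘(ℝ, ℝ) (f ∘ pt e) HS x
      (EuclideanSpace.single i (1 : ℝ) : Coord) := by
    rw [mfderivWithin_eq_fderivWithin]
    rfl
  rw [h1, hcomp]
  rfl

lemma mfderiv_toTangent {f : M → ℝ} (hf : ContMDiff (𝓡∂ 4) 𝓘(ℝ, ℝ) ∞ f) (he : IsChart e) (hx : x ∈ dom e)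
    (v : Fin 4 → ℝ) : mfderiv (𝓡∂ 4) 𝓘(ℝ, ℝ) f (pt e x) (toTangent e x v)
      = v ⬝ᵥ fun i => pd i (inChart f e) x := by
  simp only [dotProduct, ← mfderiv_coordVec hf he hx]
  exact (map_sum (mfderiv (𝓡∂ 4) 𝓘(ℝ, ℝ) f (pt e x)) _ _).trans
    (Finset.sum_congr rfl fun i _ => map_smul _ _ _)

/-- The columns of the congruence matrix are the coordinate components of an orthonormal basis. -/
lemma lorentzian_comps {g : BilinField M} (hg : IsLorentzMetric g) (he : IsChart e) (hx : x ∈ dom e) :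
    Lorentzian (comps g e x) := by
  obtain ⟨b, hb⟩ := hg.signature (pt e x)
  choose S hS using fun j => exists_toTangent_eq he hx (b j)
  refine ⟨Matrix.of fun i j => S j i, ?_⟩
  ext j k
  have h1 : bil (comps g e x) (S j) (S k) = if j = k then (if j = 0 then -1 else 1) else 0 := by
    rw [bil_comps, hS, hS, hb]
  have h2 : ((Matrix.of fun i j => S j i).transpose * comps g e x * (Matrix.of fun i j => S j i)) j k
      = bil (comps g e x) (S j) (S k) := by
    rw [Matrix.mul_assoc]
    rfl
  rw [h2, h1]
  fin_cases j <;> fin_cases k <;> simp [mink]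

variable [IsManifold (𝓡∂ 4) ∞ M]

lemma completionOn {κ Λ : ℝ} (hκ : 0 < κ) (hΛ : 0 < Λ) {g : BilinField M} {Ω : M → ℝ}
    (hc : IsConformalCompletion κ Λ g Ω) (he : IsChart e) :
    CompletionOn κ Λ (dom e) (comps g e) (inChart Ω e) where
  toRelOpen := relOpen_dom e
  sm x hx a b := (hc.metric.smooth e he a b x hx).mono_of_mem_nhdsWithin ((relOpen_dom e).nhd x hx)
  symm x hx := (lorentzian_comps hc.metric he hx).symm
  det x hx := by
    obtain ⟨S, hS⟩ := lorentzian_comps hc.metric he hx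
    exact (det_ne_zero_of_frame hS).2
  smooth x hx := smAt_inChart hc.smooth he hx
  pos x hx h0 := hc.pos _ ((isInteriorPoint_pt he hx).2 h0)
  zero x hx h0 := hc.zero _ <| by
    rw [← ModelWithCorners.compl_interior]
    exact fun h => h0.not_gt ((isInteriorPoint_pt he hx).1 h)
  kappa := hκ
  lam := hΛ
  lorentz x hx := lorentzian_comps hc.metric he hx
  decay := hc.decay e he

end tangent

end Scri

/-! ### Time orientation and the region where the normal is timelike -/

namespace Scri

section timelikeNormal

variable {M : Type*} [TopologicalSpace M] [ChartedSpace (EuclideanHalfSpace 4) M] [IsManifold (𝓡∂ 4) ∞ M]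
  {κ Λ : ℝ} {g : BilinField M} {Ω : M → ℝ}
  {e : OpenPartialHomeomorph M (EuclideanHalfSpace 4)} {x : Coord}

/-- The points at which the gradient of `Ω` is timelike. -/
def timelikeNormal (g : BilinField M) (Ω : M → ℝ) : Set M :=
  {p | ∃ N : TangentSpace (𝓡∂ 4) p, (∀ v, g p N v = mfderiv (𝓡∂ 4) 𝓘(ℝ, ℝ) Ω p v) ∧ g p N N < 0}

/-- A smooth conformal completion with positive constants. -/
structure PosCompletion (κ Λ : ℝ) (g : BilinField M) (Ω : M → ℝ) : Prop extends
    IsConformalCompletion κ Λ g Ω where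
  kappa : 0 < κ
  lam : 0 < Λ

/-- The pairing is the fibre component of the tangent map of Ω composed with the section T. -/
lemma continuous_normalPairing (hΩ : ContMDiff (𝓡∂ 4) 𝓘(ℝ, ℝ) ∞ Ω) {T : (p : M) → TangentSpace (𝓡∂ 4) p}
    (hT : Continuous fun p => (⟨p, T p⟩ : TangentBundle (𝓡∂ 4) M)) : Continuous (normalPairing Ω T) := by
  have h1 : Continuous (tangentMap (𝓡∂ 4) 𝓘(ℝ, ℝ) Ω) := hΩ.continuous_tangentMap (by simp)
  have h2 := (tangentBundleModelSpaceHomeomorph 𝓘(ℝ, ℝ)).continuous.comp (h1.comp hT)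
  exact continuous_snd.comp h2

lemma exists_isChart (p : M) :
    ∃ e : OpenPartialHomeomorph M (EuclideanHalfSpace 4), IsChart e ∧ p ∈ e.source :=
  ⟨_, IsManifold.chart_mem_maximalAtlas p, mem_chart_source _ p⟩

variable (hc : PosCompletion κ Λ g Ω) (he : IsChart e) (hx : x ∈ dom e)
include hc he

lemma PosCompletion.on : CompletionOn κ Λ (dom e) (comps g e) (inChart Ω e) :=
  completionOn hc.kappa hc.lam hc.toIsConformalCompletion he

include hx

lemma metric_normal (v : TangentSpace (𝓡∂ 4) (pt e x)) :
    g (pt e x) v (toTangent e x (normal (comps g e) (inChart Ω e) x))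
      = mfderiv (𝓡∂ 4) 𝓘(ℝ, ℝ) Ω (pt e x) v := by
  obtain ⟨w, rfl⟩ := exists_toTangent_eq he hx v
  have hn := (bil_normal (Ω := inChart Ω e) (hc.on he).met hx).1
  rw [mfderiv_toTangent hc.smooth he hx, ← bil_comps, bil]
  exact congrArg _ (funext hn)

/-- Any vector representing dΩ has the same square as the coordinate normal, since both equal dΩ
evaluated on the other. This links the chart-independent set with the coordinate expression. -/
lemma mem_timelikeNormal_iff : pt e x ∈ timelikeNormal g Ω ↔
    normalSq (comps g e) (inChart Ω e) x < 0 := by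
  have hC := hc.on he
  have hn := (bil_normal (Ω := inChart Ω e) hC.met hx).2
  rw [bil_comps] at hn
  rw [← hn]
  constructor
  · rintro ⟨N, hN, hlt⟩
    have : g (pt e x) (toTangent e x (normal (comps g e) (inChart Ω e) x))
        (toTangent e x (normal (comps g e) (inChart Ω e) x)) = g (pt e x) N N := by
      rw [metric_normal hc he hx, ← hN, hN N, ← metric_normal hc he hx]
    rwa [this]
  · intro h
    exact ⟨_, fun v => by rw [hc.metric.symm, metric_normal hc he hx], h⟩

lemma future_of_pairing_neg {P : MetricComp → (Coord → ℝ) → Coord → Fin 4 → ℝ}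
    (hP : P = canonicalSupermomentum ∨ P = asymptoticSupermomentum)
    (hmem : pt e x ∈ timelikeNormal g Ω) {t : TangentSpace (𝓡∂ 4) (pt e x)} (ht : g (pt e x) t t < 0)
    (hneg : g (pt e x) t (toTangent e x (normal (comps g e) (inChart Ω e) x)) < 0) :
    FutureTimelike (g (pt e x)) t (toTangent e x (normal (comps g e) (inChart Ω e) x)) ∧
      FutureCausal (g (pt e x)) t (toTangent e x (P (comps g e) (inChart Ω e) x)) := by
  have hC := hc.on he
  have hlt := (mem_timelikeNormal_iff hc he hx).1 hmem
  have hn := (bil_normal (Ω := inChart Ω e) hC.met hx).2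
  obtain ⟨w, rfl⟩ := exists_toTangent_eq he hx t
  rw [← bil_comps] at ht hneg
  obtain ⟨h1, h2⟩ := hC.causal_main hP hx hlt ht hneg
  simp only [FutureTimelike, FutureCausal, ← bil_comps]
  refine ⟨⟨hn.trans_lt hlt, hneg⟩, h1, h2.imp_left fun h => ?_⟩
  rw [h]
  simp [toTangent]

omit he hx in
lemma isOpen_timelikeNormal : IsOpen (timelikeNormal g Ω) := by
  refine isOpen_iff_mem_nhds.2 fun p hp => ?_
  obtain ⟨e, he, hps⟩ := exists_isChart p
  have hx : e.extend (𝓡∂ 4) p ∈ dom e := extend_mem_dom hps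
  rw [← pt_extend hps, mem_timelikeNormal_iff hc he hx] at hp
  have hC := hc.on he
  have hcont := (sm_normalSq hC.met hC.toDefFn.smooth hx).continuousWithinAt
  have hev : ∀ᶠ y in 𝓝[HS] (e.extend (𝓡∂ 4) p), normalSq (comps g e) (inChart Ω e) y < 0 :=
    hcont.eventually_lt_const hp
  have htend : Tendsto (e.extend (𝓡∂ 4)) (𝓝 p) (𝓝[HS] (e.extend (𝓡∂ 4) p)) :=
    tendsto_nhdsWithin_iff.2 ⟨(e.continuousAt_extend hps).tendsto,
      Eventually.of_forall fun q => ⟨e q, rfl⟩⟩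
  filter_upwards [htend.eventually hev, e.open_source.mem_nhds hps] with q hq hqs
  rw [← pt_extend hqs]
  exact (mem_timelikeNormal_iff hc he (extend_mem_dom hqs)).2 hq

omit hx in
lemma scri_iff (hx : x ∈ dom e) : pt e x ∈ scri Ω ↔ x 0 = 0 :=
  (hc.on he).toDefFn.eq_zero_iff hx

omit he hx in
lemma scri_subset_timelikeNormal : scri Ω ⊆ timelikeNormal g Ω := fun p hp => by
  obtain ⟨e, he, hps⟩ := exists_isChart p
  have hx : e.extend (𝓡∂ 4) p ∈ dom e := extend_mem_dom hps
  rw [← pt_extend hps] at hp ⊢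
  exact (mem_timelikeNormal_iff hc he hx).2 ((hc.on he).normalSq_neg hx ((scri_iff hc he hx).1 hp))

omit he hx in
-- At 𝒥 the normal is timelike, and two timelike vectors are never orthogonal. This is why 𝒥
-- consists of 𝒥⁺ and 𝒥⁻ only.
lemma normalPairing_ne_zero {T : (p : M) → TangentSpace (𝓡∂ 4) p} (hT : IsTimeOrientation g T) {p : M}
    (hp : p ∈ scri Ω) : normalPairing Ω T p ≠ 0 := by
  obtain ⟨e, he, hps⟩ := exists_isChart p
  obtain ⟨x, hx, rfl⟩ : ∃ x ∈ dom e, pt e x = p := ⟨_, extend_mem_dom hps, pt_extend hps⟩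
  have hC := hc.on he
  have hlt := (mem_timelikeNormal_iff hc he hx).1 (scri_subset_timelikeNormal hc hp)
  have ht := hT.timelike (pt e x)
  rw [normalPairing, ← metric_normal hc he hx]
  obtain ⟨w, hw⟩ := exists_toTangent_eq he hx (T (pt e x))
  rw [← hw, ← bil_comps] at ht ⊢
  exact (hC.lorentz x hx).bil_ne_zero ht (((bil_normal (Ω := inChart Ω e) hC.met hx).2).trans_lt hlt)

end timelikeNormal

end Scri

/-! ### Assembly of the chart-wise results -/

theorem mainTheorem2 {M : Type*} [TopologicalSpace M] [ChartedSpace (EuclideanHalfSpace 4) M]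
    [IsManifold (𝓡∂ 4) ∞ M] (κ Λ : ℝ) (hκ : 0 < κ) (hΛ : 0 < Λ)
    (g : BilinField M) (Ω : M → ℝ) (hcompl : IsConformalCompletion κ Λ g Ω) :
    -- the normal is timelike at `𝒥`, and the rescaled Weyl tensor is regular up to `𝒥`
    (∀ e, IsChart e → ∀ x ∈ dom e, pt e x ∈ scri Ω →
      normalSq (comps g e) (inChart Ω e) x = -Λ / 3) ∧
    (∀ e, IsChart e → ∀ a b c d,
      ContDiffOn ℝ 1 (rescaledWeyl (comps g e) (inChart Ω e) a b c d) (dom e) ∧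
      ∀ x ∈ dom e, inChart Ω e x * rescaledWeyl (comps g e) (inChart Ω e) a b c d x
        = weyl (comps g e) a b c d x) ∧
    -- the three properties hold for the canonical supermomentum, and for `p^a` as well
    (∀ P : MetricComp → (Coord → ℝ) → Coord → Fin 4 → ℝ,
      P = canonicalSupermomentum ∨ P = asymptoticSupermomentum →
      -- 1. causal and future-pointing at and around `𝒥` (past-pointing around `𝒥⁻`, where `N^a` is)
      (∀ T : (p : M) → TangentSpace (𝓡∂ 4) p, IsTimeOrientation g T →
        scri Ω = futureScri Ω T ∪ pastScri Ω T ∧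
        (∃ U : Set M, IsOpen U ∧ futureScri Ω T ⊆ U ∧
          ∀ e, IsChart e → ∀ x ∈ dom e, pt e x ∈ U →
            FutureTimelike (g (pt e x)) (T (pt e x))
              (toTangent e x (normal (comps g e) (inChart Ω e) x)) ∧
            FutureCausal (g (pt e x)) (T (pt e x))
              (toTangent e x (P (comps g e) (inChart Ω e) x))) ∧
        (∃ U : Set M, IsOpen U ∧ pastScri Ω T ⊆ U ∧
          ∀ e, IsChart e → ∀ x ∈ dom e, pt e x ∈ U →
            FutureTimelike (g (pt e x)) (-T (pt e x))
              (toTangent e x (normal (comps g e) (inChart Ω e) x)) ∧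
            FutureCausal (g (pt e x)) (-T (pt e x))
              (toTangent e x (P (comps g e) (inChart Ω e) x)))) ∧
      -- 2. behaviour at `𝒥` under the gauge transformation `(g, Ω) ↦ (φ² g, φ Ω)`
      (∀ φ : M → ℝ, ContMDiff (𝓡∂ 4) 𝓘(ℝ, ℝ) ∞ φ → (∀ p, 0 < φ p) →
        ∀ e, IsChart e → ∀ x ∈ dom e, pt e x ∈ scri Ω → ∀ a,
          P (comps (gaugeMetric φ g) e) (inChart (fun p => φ p * Ω p) e) x a
            = (inChart φ e x ^ 7)⁻¹ * P (comps g e) (inChart Ω e) x a) ∧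
      -- 3. divergence-free at `𝒥` for fast decaying matter, in a divergence-free gauge
      (∀ e, IsChart e → ∀ x ∈ dom e, pt e x ∈ scri Ω →
        ∀ a, ContDiffWithinAt ℝ 1 (fun y => P (comps g e) (inChart Ω e) y a) HS x) ∧
      (DivergenceFreeGauge g Ω → EnergyMomentumDecay κ Λ g Ω 3 →
        ∀ e, IsChart e → ∀ x ∈ dom e, pt e x ∈ scri Ω →
          divergence (comps g e) (P (comps g e) (inChart Ω e)) x = 0)) ∧
    -- gauge invariance of the no-radiation criterion
    (∀ φ : M → ℝ, ContMDiff (𝓡∂ 4) 𝓘(ℝ, ℝ) ∞ φ → (∀ p, 0 < φ p) →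
      ∀ Δ : Set M, Δ ⊆ scri Ω →
        (NoRadiationOn (gaugeMetric φ g) (fun p => φ p * Ω p) Δ ↔ NoRadiationOn g Ω Δ)) := by
  have hc : PosCompletion κ Λ g Ω := ⟨hcompl, hκ, hΛ⟩
  have hat : ∀ {e x}, IsChart e → x ∈ dom e → pt e x ∈ scri Ω → x 0 = 0 := fun he hx h =>
    (scri_iff hc he hx).1 h
  refine ⟨fun e he x hx h => (hc.on he).normalSq_eq hx (hat he hx h), fun e he a b c d => ⟨fun x hx =>
    (((hc.on he).sm_rescaledWeyl hx a b c d).of_le (by simp)).mono (relOpen_dom e).sub,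
    fun x hx => (hc.on he).mul_rescaledWeyl hx a b c d⟩, fun P hP => ⟨fun T hT => ?_, ?_, ?_, ?_⟩, ?_⟩
  · have hcont := continuous_normalPairing hc.smooth hT.continuous
    have hopen := isOpen_timelikeNormal hc
    refine ⟨Subset.antisymm (fun p hp => ?_) (union_subset (fun p h => h.1) fun p h => h.1),
      -- The neighbourhood requires only that N be timelike with the right sign of N_a T^a, both
      -- open conditions; the causality of the supermomentum needs nothing more.
      ⟨{p | normalPairing Ω T p < 0} ∩ timelikeNormal g Ω,
        (isOpen_lt hcont continuous_const).inter hopen,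
        fun p hp => ⟨hp.2, scri_subset_timelikeNormal hc hp.1⟩, fun e he x hx h => ?_⟩,
      ⟨{p | 0 < normalPairing Ω T p} ∩ timelikeNormal g Ω,
        (isOpen_lt continuous_const hcont).inter hopen,
        fun p hp => ⟨hp.2, scri_subset_timelikeNormal hc hp.1⟩, fun e he x hx h => ?_⟩⟩
    · exact (normalPairing_ne_zero hc hT hp).lt_or_gt.imp (fun h => ⟨hp, h⟩) fun h => ⟨hp, h⟩
    · refine future_of_pairing_neg hc he hx hP h.2 (hT.timelike _) ?_
      rw [metric_normal hc he hx]
      exact h.1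
    -- Around 𝒥⁻ the same argument runs with the reversed orientation -T.
    · refine future_of_pairing_neg hc he hx hP h.2 ?_ ?_
      · simpa using hT.timelike (pt e x)
      · rw [map_neg, LinearMap.neg_apply, metric_normal hc he hx]
        exact neg_neg_of_pos h.1
  · intro φ hφ hφ0 e he x hx h a
    exact (hc.on he).main_gauge (fun y hy => smAt_inChart hφ he hy) (fun y _ => hφ0 _) hx (hat he hx h) hP a
  · intro e he x hx h a
    have h0 := hat he hx h
    exact ((hc.on he).sm_main hP hx ((hc.on he).normalSq_neg hx h0) a).of_le (by simp)
  · intro hdiv hdec e he x hx h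
    exact (hc.on he).divergence_main hP (hdec e he) hx (hat he hx h) (hdiv e he x hx h)
  · intro φ hφ hφ0 Δ hΔ
    have key : ∀ e, IsChart e → ∀ x ∈ dom e, pt e x ∈ Δ → ∀ a,
        superPoynting (comps (gaugeMetric φ g) e) (inChart (fun p => φ p * Ω p) e) x a
          = (inChart φ e x ^ 7)⁻¹ * superPoynting (comps g e) (inChart Ω e) x a := fun e he x hx h a =>
      (hc.on he).superPoynting_gauge (fun y hy => smAt_inChart hφ he hy) (fun y _ => hφ0 _) hx
        (hat he hx (hΔ h)) a
    refine forall₅_congr fun e he x hx h => forall_congr' fun a => ?_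
    rw [key e he x hx h]
    exact mul_eq_zero_iff_left (inv_ne_zero (pow_ne_zero 7 (hφ0 (pt e x)).ne'))
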